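/- **Setting.** A tagged $d$-simplex ($d\ge 1$) is an ordered list of affinely independent vertices with a type, $K=(z_0,\dots,z_d)_t$, $t\in\{0,\dots,d-1\}$. Its refinement edge is $z_0z_d$; with $\bar z=\tfrac12(z_0+z_d)$, bisection replaces $K$ by its children $$(z_0,\bar z,z_1,\dots,z_t,z_{t+1},\dots,z_{d-1})_{(t+1)\bmod d},\qquad (z_d,\bar z,z_1,\dots,z_t,z_{d-1},\dots,z_{t+1})_{(t+1)\bmod d}.$$ The reflection of $K$ is $K_R=(z_d,z_1,\dots,z_t,z_{d-1},\dots,z_{t+1},z_0)_t$ (it has the same children). Two simplices of the same type sharing a face are reflected neighbours if the ordered vertices of the first, or of its reflection, coincide with those of the second at all but one position. A "face" always means a $(d-1)$-dimensional one. A finite set of simplices is conforming if any two distinct members have different vertex sets and intersect exactly in the (possibly empty) convex hull of their common vertices. Let $\mathcal T_0$ be a conforming mesh of the polyhedral set $\Omega=\operatorname{int}\bigcup_{K\in\mathcal T_0}K\subset\mathbb R^d$ such that * (matching condition) all elements of $\mathcal T_0$ have the same type, and whenever two distinct elements share a face $F$: if the refinement edge of at least one of them lies in $F$, they are reflected neighbours;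 otherwise their two children having $F$ as a face are reflected neighbours; * (face-connectedness) any two elements of $\mathcal T_0$ with a common point $z$ are joined by a finite chain of elements of $\mathcal T_0$ in which any two consecutive ones share a face containing $z$. Let $\mathbb T_c$ be the set of all conforming meshes generated from $\mathcal T_0$ by finitely many successive bisections, and let the master tree $\mathfrak T$ be the forest of all simplices obtained from elements of $\mathcal T_0$ by successive bisections, each simplex being connected with its two children. For a face $F$ of a simplex in $\mathfrak T$, the minimal pair is $$\omega_\star(F)=\bigcap_{\mathcal T\in\mathbb T_c:\ F\text{ is a face of }\mathcal T}\ \bigcup\{K\in\mathcal T: F\text{ is a face of }K\}.$$ For $\ell\in\mathbb N_0$ let $S|_{\omega_\star(F)}$ be the space of continuous functions on $\omega_\star(F)$ that are polynomials of degree at most $\ell$ on each set $K\cap\omega_\star(F)$, where $K$ is an element, having $F$ as a face, of a mesh in $\mathbb T_c$. Let $\varepsilon>0$, $u\in H^1(\Omega)$, and $|||v|||_\omega^2=\|v\|_{L^2(\omega)}^2+\varepsilon\|\nabla v\|_{L^2(\omega)}^2$. Define, for $K\in\mathfrak T$, $$e(K)=\sum_{F\text{ face of }K}\ \inf_{P\in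 S|_{\omega_\star(F)}}|||u-P|||^2_{\omega_\star(F)} .$$ **Proposition (weak subadditivity).** Let $K\in\mathfrak T$ and let $\mathcal B\subset\mathfrak T$ be a finite tree with single root $K$ in which every node either is a leaf or has both its children in $\mathcal B$. If the set $\mathcal L(\mathcal B)$ of leaves of $\mathcal B$ is conforming, then $e(K)<\infty$ and $$\sum_{K'\in\mathcal L(\mathcal B)}e(K')\ \le\ 2d\,e(K).$$ -/

import Mathlib

open MeasureTheory Set
open scoped ENNReal

/-- A tagged `d`-simplex `(z₀, z₁, …, z_d)_t` in `ℝ^d`: an ordered list of vertices together with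
a type `t ∈ {0, …, d - 1}`. (Affine independence of the vertices is part of the definition of a
conforming mesh below, and it is inherited under bisection.) -/
@[ext]
structure TaggedSimplex (d : ℕ) where
  vert : Fin (d + 1) → EuclideanSpace ℝ (Fin d)
  type : Fin d

noncomputable instance (d : ℕ) : DecidableEq (TaggedSimplex d) := Classical.decEq _

namespace TaggedSimplex

variable {d : ℕ}

/-- The set of vertices of a simplex. -/
def vertexSet (K : TaggedSimplex d) : Set (EuclideanSpace ℝ (Fin d)) := Set.range K.vert

/-- The closed simplex as a set of points. -/
def carrier (K : TaggedSimplex d) : Set (EuclideanSpace ℝ (Fin d)) := convexHull ℝ K.vertexSet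

/-- The `i`-th face of `K`, the one opposite to the vertex `z_i`. Faces are represented by their
sets of vertices; the geometric face is the convex hull of this set. -/
def face (K : TaggedSimplex d) (i : Fin (d + 1)) : Set (EuclideanSpace ℝ (Fin d)) :=
  K.vert '' {j | j ≠ i}

/-- `F` is (the vertex set of) a `(d-1)`-dimensional face of `K`. -/
def HasFace (K : TaggedSimplex d) (F : Set (EuclideanSpace ℝ (Fin d))) : Prop :=
  ∃ i, F = K.face i

/-- The end points `z₀`, `z_d` of the refinement edge of `K`. -/
def refinementEdge (K : TaggedSimplex d) : Set (EuclideanSpace ℝ (Fin d)) :=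
  {K.vert 0, K.vert (Fin.last d)}

/-- The midpoint of the refinement edge. -/
noncomputable def mid (K : TaggedSimplex d) : EuclideanSpace ℝ (Fin d) :=
  midpoint ℝ (K.vert 0) (K.vert (Fin.last d))

/-- The type `(t + 1) mod d` of the children. -/
def childType (K : TaggedSimplex d) : Fin d :=
  ⟨((K.type : ℕ) + 1) % d, Nat.mod_lt _ K.type.pos⟩

/-- The first child `(z₀, z̄, z₁, …, z_t, z_{t+1}, …, z_{d-1})_{(t+1) mod d}`. -/
noncomputable def child₁ (K : TaggedSimplex d) : TaggedSimplex d where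
  vert j :=
    if (j : ℕ) = 0 then K.vert 0
    else if (j : ℕ) = 1 then K.mid
    else K.vert (Fin.ofNat (d + 1) ((j : ℕ) - 1))
  type := K.childType

/-- The second child `(z_d, z̄, z₁, …, z_t, z_{d-1}, …, z_{t+1})_{(t+1) mod d}`. -/
noncomputable def child₂ (K : TaggedSimplex d) : TaggedSimplex d where
  vert j :=
    if (j : ℕ) = 0 then K.vert (Fin.last d)
    else if (j : ℕ) = 1 then K.mid
    else if (j : ℕ) ≤ (K.type : ℕ) + 1 then K.vert (Fin.ofNat (d + 1) ((j : ℕ) - 1))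
    else K.vert (Fin.ofNat (d + 1) (d + (K.type : ℕ) + 1 - (j : ℕ)))
  type := K.childType

/-- `C` is one of the two children of `K`. -/
def IsChild (C K : TaggedSimplex d) : Prop := C = K.child₁ ∨ C = K.child₂

/-- The tagged simplex `(z_d, z₁, …, z_t, z_{d-1}, …, z_{t+1}, z₀)_t`, which has the same two
children as `(z₀, z₁, …, z_d)_t`. -/
def reflect (K : TaggedSimplex d) : TaggedSimplex d where
  vert j :=
    if (j : ℕ) = 0 then K.vert (Fin.last d)
    else if (j : ℕ) = d then K.vert 0
    else if (j : ℕ) ≤ (K.type : ℕ) then K.vert j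
    else K.vert (Fin.ofNat (d + 1) (d + (K.type : ℕ) - (j : ℕ)))
  type := K.type

/-- Reflected neighbours: the ordered vertices of `K`, or those of `K.reflect`, coincide with the
ordered vertices of `L` at all positions but one. (It is used for distinct simplices sharing a
face.) -/
def IsReflected (K L : TaggedSimplex d) : Prop :=
  K.type = L.type ∧
    ((∃ i, ∀ j, j ≠ i → K.vert j = L.vert j) ∨ (∃ i, ∀ j, j ≠ i → K.reflect.vert j = L.vert j))

end TaggedSimplex

section Meshes

variable {d : ℕ}

/-- A conforming mesh: a finite set of nondegenerate simplices, with pairwise different sets of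
vertices, such that two of them always intersect in the (possibly empty) simplex spanned by their
common vertices. -/
def IsConformingMesh (T : Finset (TaggedSimplex d)) : Prop :=
  (∀ K ∈ T, AffineIndependent ℝ K.vert) ∧
    ∀ K ∈ T, ∀ L ∈ T, K ≠ L →
      K.vertexSet ≠ L.vertexSet ∧
        K.carrier ∩ L.carrier = convexHull ℝ (K.vertexSet ∩ L.vertexSet)

/-- The open polyhedral set `Ω` triangulated by `T`: its closure is the union of the elements. -/
def meshDomain (T : Finset (TaggedSimplex d)) : Set (EuclideanSpace ℝ (Fin d)) :=
  interior (⋃ K ∈ T, K.carrier)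

/-- The matching condition: all elements have the same type, and if two elements `K`, `L` share a
face `F`, then they are reflected neighbours whenever the refinement edge of one of them lies in
`F`; otherwise their children adjacent to `F` are reflected neighbours. -/
def MatchingCondition (T : Finset (TaggedSimplex d)) : Prop :=
  (∀ K ∈ T, ∀ L ∈ T, K.type = L.type) ∧
    ∀ K ∈ T, ∀ L ∈ T, K ≠ L → ∀ F, K.HasFace F → L.HasFace F →
      ((K.refinementEdge ⊆ F ∨ L.refinementEdge ⊆ F) → K.IsReflected L) ∧
      (¬ (K.refinementEdge ⊆ F ∨ L.refinementEdge ⊆ F) →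
        ∀ C C' : TaggedSimplex d, C.IsChild K → C'.IsChild L → C.HasFace F → C'.HasFace F →
          C.IsReflected C')

/-- Face-connectedness: two elements with a common point `z` are joined by a finite chain of
elements in which any two consecutive ones share a face containing `z`. -/
def FaceConnected (T : Finset (TaggedSimplex d)) : Prop :=
  ∀ K ∈ T, ∀ L ∈ T, ∀ z ∈ K.carrier ∩ L.carrier,
    Relation.ReflTransGen
      (fun M N : TaggedSimplex d => M ∈ T ∧ N ∈ T ∧
        ∃ F, M.HasFace F ∧ N.HasFace F ∧ z ∈ convexHull ℝ F) K L

/-- `T'` arises from `T` by bisecting one element. -/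
def BisectStep (T T' : Finset (TaggedSimplex d)) : Prop :=
  ∃ K ∈ T, T' = insert K.child₁ (insert K.child₂ (T.erase K))

/-- The set `𝕋_c` of all conforming meshes generated from `T₀` by successive bisections. -/
def conformingRefinements (T₀ : Finset (TaggedSimplex d)) : Set (Finset (TaggedSimplex d)) :=
  {T | Relation.ReflTransGen BisectStep T₀ T ∧ IsConformingMesh T}

/-- The nodes of the master tree: all simplices obtained from elements of `T₀` by bisections. -/
inductive InMasterTree (T₀ : Finset (TaggedSimplex d)) : TaggedSimplex d → Prop
  | root (K : TaggedSimplex d) : K ∈ T₀ → InMasterTree T₀ K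
  | left (K : TaggedSimplex d) : InMasterTree T₀ K → InMasterTree T₀ K.child₁
  | right (K : TaggedSimplex d) : InMasterTree T₀ K → InMasterTree T₀ K.child₂

/-- Finite trees of successive bisections with single root `K`: every node either is a leaf or has
both its children in the tree. -/
inductive BisectionTree : TaggedSimplex d → Type
  | leaf (K : TaggedSimplex d) : BisectionTree K
  | node (K : TaggedSimplex d) (l : BisectionTree K.child₁) (r : BisectionTree K.child₂) :
      BisectionTree K

/-- The set of leaves of a tree. -/
noncomputable def BisectionTree.leaves : {K : TaggedSimplex d} → BisectionTree K →
    Finset (TaggedSimplex d)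
  | _, .leaf K => {K}
  | _, .node _ l r => l.leaves ∪ r.leaves

/-- `F` is a face of (some element of) the mesh `T`. -/
def IsMeshFace (T : Finset (TaggedSimplex d)) (F : Set (EuclideanSpace ℝ (Fin d))) : Prop :=
  ∃ K ∈ T, K.HasFace F

/-- The pair `ω_T(F)`: the union of the elements of `T` sharing the face `F`. -/
def facePair (T : Finset (TaggedSimplex d)) (F : Set (EuclideanSpace ℝ (Fin d))) :
    Set (EuclideanSpace ℝ (Fin d)) :=
  {x | ∃ K ∈ T, K.HasFace F ∧ x ∈ K.carrier}

/-- The minimal pair `ω_⋆(F)`: the intersection of the pairs `ω_T(F)` over all conforming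
refinements `T` of `T₀` that have `F` as a face. -/
def minimalPair (T₀ : Finset (TaggedSimplex d)) (F : Set (EuclideanSpace ℝ (Fin d))) :
    Set (EuclideanSpace ℝ (Fin d)) :=
  {x | ∀ T ∈ conformingRefinements T₀, IsMeshFace T F → x ∈ facePair T F}

/-- `v` coincides on `A` with a polynomial of total degree at most `ℓ`. -/
def IsPolynomialOn (ℓ : ℕ) (A : Set (EuclideanSpace ℝ (Fin d)))
    (v : EuclideanSpace ℝ (Fin d) → ℝ) : Prop :=
  ∃ p : MvPolynomial (Fin d) ℝ, p.totalDegree ≤ ℓ ∧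
    ∀ x ∈ A, v x = MvPolynomial.eval (fun i => x i) p

/-- The finite element space `S|_{ω_⋆(F)}` on the minimal pair of `F`: functions continuous on
`ω_⋆(F)` that are polynomials of degree at most `ℓ` on each of its (at most two) constituents
`K ∩ ω_⋆(F)`, where `K` is an element with face `F` of a conforming refinement of `T₀`. Only the
values on `ω_⋆(F)` matter. -/
def minimalPairSpace (T₀ : Finset (TaggedSimplex d)) (ℓ : ℕ)
    (F : Set (EuclideanSpace ℝ (Fin d))) : Set (EuclideanSpace ℝ (Fin d) → ℝ) :=
  {v | ContinuousOn v (minimalPair T₀ F) ∧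
    ∀ T ∈ conformingRefinements T₀, ∀ K ∈ T, K.HasFace F →
      IsPolynomialOn ℓ (K.carrier ∩ minimalPair T₀ F) v}

end Meshes

section ErrorFunctional

variable {d : ℕ}

/-- `u ∈ H¹(Ω)` with weak gradient `Du`: both are square integrable on `Ω`, and
`∫_Ω u ∇φ = - ∫_Ω φ Du` for all smooth `φ` with compact support in `Ω`. -/
structure IsSobolevH1 (Ω : Set (EuclideanSpace ℝ (Fin d))) (u : EuclideanSpace ℝ (Fin d) → ℝ)
    (Du : EuclideanSpace ℝ (Fin d) → EuclideanSpace ℝ (Fin d)) : Prop where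
  memLp : MemLp u 2 (volume.restrict Ω)
  memLp_grad : MemLp Du 2 (volume.restrict Ω)
  weak_grad : ∀ φ : EuclideanSpace ℝ (Fin d) → ℝ, ContDiff ℝ ((⊤ : ℕ∞) : WithTop ℕ∞) φ → HasCompactSupport φ →
    tsupport φ ⊆ Ω → ∫ x in Ω, u x • gradient φ x = - ∫ x in Ω, φ x • Du x

/-- The squared reaction-diffusion norm `‖w‖²_A + ε ‖Dw‖²_A` on `A` of a function `w` with weak
gradient `Dw`. -/
noncomputable def rdNormSq (ε : ℝ) (A : Set (EuclideanSpace ℝ (Fin d)))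
    (w : EuclideanSpace ℝ (Fin d) → ℝ)
    (Dw : EuclideanSpace ℝ (Fin d) → EuclideanSpace ℝ (Fin d)) : ℝ≥0∞ :=
  (∫⁻ x in A, ‖w x‖ₑ ^ 2) + ENNReal.ofReal ε * ∫⁻ x in A, ‖Dw x‖ₑ ^ 2

/-- The squared best error on the minimal pair of `F`. The elements `P` of the local space are
continuous and piecewise polynomial, so that their weak gradient is, almost everywhere on the
minimal pair, the classical one. -/
noncomputable def bestErrorSq (T₀ : Finset (TaggedSimplex d)) (ℓ : ℕ) (ε : ℝ)
    (u : EuclideanSpace ℝ (Fin d) → ℝ)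
    (Du : EuclideanSpace ℝ (Fin d) → EuclideanSpace ℝ (Fin d))
    (F : Set (EuclideanSpace ℝ (Fin d))) : ℝ≥0∞ :=
  ⨅ P ∈ minimalPairSpace T₀ ℓ F,
    rdNormSq ε (minimalPair T₀ F) (fun x => u x - P x) (fun x => Du x - gradient P x)

/-- The local error functional
`e(K) = ∑_{F face of K} inf_{P ∈ S|_{ω_⋆(F)}} |||u - P|||²_{ω_⋆(F)}`. -/
noncomputable def localError (T₀ : Finset (TaggedSimplex d)) (ℓ : ℕ) (ε : ℝ)
    (u : EuclideanSpace ℝ (Fin d) → ℝ)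
    (Du : EuclideanSpace ℝ (Fin d) → EuclideanSpace ℝ (Fin d)) (K : TaggedSimplex d) : ℝ≥0∞ :=
  ∑ i : Fin (d + 1), bestErrorSq T₀ ℓ ε u Du (K.face i)

end ErrorFunctional

/-! The argument compares minimal pairs with the elements of uniform refinements. Bisecting all
elements at once preserves conformity, the matching condition and face-connectedness
(`IsGoodMesh.isGoodMesh_bisectAll`). Hence every node of the master tree is an element of a uniform
refinement, which is a conforming refinement and therefore an admissible test mesh for minimal
pairs. Three facts about ω_⋆(F), for a face F of a node K, follow. On the side of K, the pair stays
inside K (`IsGoodMesh.mem_carrier_of_mem_minimalPair`). If the refinement edge of K lies in F, then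
the pair contains all of K (`IsGoodMesh.carrier_subset_minimalPair`). If it does not, then the part
of the pair in K stays in one child (`IsGoodMesh.minimalPair_inter_subset_child`).

The third fact produces the factor d. For a measure ν ≪ volume, each of the d - 1 faces containing
the refinement edge contributes at most ν(K), and the two remaining faces contribute at most the two
children, together again ν(K). So the sum of ν(ω_⋆(F) ∩ K) over the faces of K is at most d ν(K)
(`IsGoodMesh.sum_minimalPair_inter_le`).

Let d ≥ 2, and for each face F_j of K let P_j be a competitor on ω_⋆(F_j), with ν_j(A) the squared
norm of u - P_j on A. Fix a face F_o containing the refinement edge; then P_o is one polynomial on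
all of K. A face of a leaf that lies in no boundary face of K is shared by exactly two leaves, its
minimal pair lies in their union, and P_o is admissible there; counting both leaves gives a factor
2. For the faces contained in F_j, the function P_j is admissible, and their minimal pairs lie in
ω_⋆(F_j) and overlap in null sets (`IsGoodMesh.minimalPairSpace_mono`,
`IsGoodMesh.minimalPair_mono`, `IsGoodMesh.volume_minimalPair_inter`). For j = o the part inside K
is absorbed into the count by d, and only the part outside K is estimated by disjointness.
Altogether the sum is at most 2d ν_o(K) + ν_o(ω_⋆(F_o) \ K) plus the sum of ν_j(ω_⋆(F_j)) over j ≠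
o, hence at most 2d times the sum of all ν_j(ω_⋆(F_j)). Nearly optimal P_j give the claim. For d = 1
faces are points, minimal pairs shrink to points, and all errors vanish. -/

/-! ### Barycentric coordinates, bisection and faces of a single simplex -/

section SimplexGeometry

variable {E : Type*} [NormedAddCommGroup E] [NormedSpace ℝ E]

/-- `V` is the vertex set of a nondegenerate simplex of full dimension. -/
structure IsSimplex (V : Set E) : Prop where
  indep : AffineIndependent ℝ ((↑) : V → E)
  span : affineSpan ℝ V = ⊤

/-- A point of a finite set's convex hull in relative interior position. -/
theorem exists_mem_convexHull_forall_affine {F : Set E} (hF : F.Finite)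
    (hne : F.Nonempty) :
    ∃ b ∈ convexHull ℝ F, ∀ f : E →ᵃ[ℝ] ℝ, (∀ v ∈ F, 0 ≤ f v) → f b = 0 → ∀ v ∈ F, f v = 0 := by
  classical
  have hne' : hF.toFinset.Nonempty := by simpa using hne
  have hc : (0 : ℝ) < (hF.toFinset.card : ℝ) := by exact_mod_cast hne'.card_pos
  have hw : ∑ _v ∈ hF.toFinset, ((hF.toFinset.card : ℝ)⁻¹) = 1 := by
    rw [Finset.sum_const, nsmul_eq_mul, mul_inv_cancel₀ hc.ne']
  -- The point is the centroid: a nonnegative affine function whose mean over `F` is zero vanishes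
  -- at each point of `F`.
  refine ⟨hF.toFinset.affineCombination ℝ id fun _ => (hF.toFinset.card : ℝ)⁻¹, ?_, ?_⟩
  · rw [Finset.affineCombination_eq_linear_combination _ _ _ hw]
    exact (convex_convexHull ℝ F).sum_mem (fun _ _ => (inv_pos.2 hc).le) hw
      fun v hv => subset_convexHull ℝ F (by simpa using hv)
  · intro f hf hfb v hv
    rw [Finset.map_affineCombination _ _ _ hw,
      Finset.affineCombination_eq_linear_combination _ _ _ hw] at hfb
    have h0 : ∀ w ∈ hF.toFinset, 0 ≤ (hF.toFinset.card : ℝ)⁻¹ • (f ∘ id) w := fun w hw =>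
      mul_nonneg (inv_pos.2 hc).le (hf w (by simpa using hw))
    have := (Finset.sum_eq_zero_iff_of_nonneg h0).1 hfb v (by simpa using hv)
    simpa [hc.ne', hne.ne_empty] using this

namespace IsSimplex

variable {V W : Set E}

/-- The affine basis formed by the vertices. -/
def basis (h : IsSimplex V) : AffineBasis V ℝ E :=
  ⟨(↑), h.indep, by simpa using h.span⟩

@[simp] theorem basis_apply (h : IsSimplex V) (v : V) : h.basis v = v := rfl

end IsSimplex

open Classical in
/-- The barycentric coordinate of the vertex `v` of `V`. -/
noncomputable def baryCoord (V : Set E) (v : E) : E →ᵃ[ℝ] ℝ :=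
  if h : IsSimplex V ∧ v ∈ V then h.1.basis.coord ⟨v, h.2⟩ else 0

namespace IsSimplex

variable {V W F G H : Set E} {a b v w x y : E}

theorem baryCoord_eq (h : IsSimplex V) (hv : v ∈ V) :
    baryCoord V v = h.basis.coord ⟨v, hv⟩ := by
  simp [baryCoord, h, hv]

theorem baryCoord_self (h : IsSimplex V) (hv : v ∈ V) : baryCoord V v v = 1 := by
  rw [h.baryCoord_eq hv]
  exact h.basis.coord_apply_eq ⟨v, hv⟩

theorem baryCoord_of_ne (h : IsSimplex V) (hv : v ∈ V) (hw : w ∈ V) (hne : v ≠ w) :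
    baryCoord V v w = 0 := by
  rw [h.baryCoord_eq hv]
  exact h.basis.coord_apply_ne (i := ⟨v, hv⟩) (j := ⟨w, hw⟩) (by simpa using hne)

theorem affineMap_ext (h : IsSimplex V) {f g : E →ᵃ[ℝ] ℝ} (hfg : ∀ v ∈ V, f v = g v) : f = g :=
  AffineMap.ext_on h.span hfg

/-- A barycentric coordinate is determined by its values on the vertices. -/
theorem eq_baryCoord (h : IsSimplex V) (hv : v ∈ V) {f : E →ᵃ[ℝ] ℝ} (h1 : f v = 1)
    (h0 : ∀ w ∈ V, w ≠ v → f w = 0) : f = baryCoord V v := by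
  refine h.affineMap_ext fun w hw => ?_
  rcases eq_or_ne w v with rfl | hne
  · rw [h1, h.baryCoord_self hv]
  · rw [h0 w hw hne, h.baryCoord_of_ne hv hw hne.symm]

theorem eq_mul_baryCoord (h : IsSimplex V) (hv : v ∈ V) {f : E →ᵃ[ℝ] ℝ}
    (h0 : ∀ w ∈ V \ {v}, f w = 0) (x : E) : f x = f v * baryCoord V v x := by
  have : f = f v • baryCoord V v := by
    refine h.affineMap_ext fun w hw => ?_
    rcases eq_or_ne w v with rfl | hne
    · simp [h.baryCoord_self hv]
    · simp [h0 w ⟨hw, hne⟩, h.baryCoord_of_ne hv hw hne.symm]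
  conv_lhs => rw [this]
  simp

/-- Two affine functions vanishing on a face are proportional. -/
theorem mul_eq_mul_of_vanish (h : IsSimplex V) (hv : v ∈ V) {f g : E →ᵃ[ℝ] ℝ}
    (hf : ∀ w ∈ V \ {v}, f w = 0) (hg : ∀ w ∈ V \ {v}, g w = 0) (x y : E) :
    f x * g y = f y * g x := by
  rw [h.eq_mul_baryCoord hv hf x, h.eq_mul_baryCoord hv hg y, h.eq_mul_baryCoord hv hf y,
    h.eq_mul_baryCoord hv hg x]
  ring

theorem of_span (hV : V.ncard = Module.finrank ℝ E + 1) (hs : affineSpan ℝ V = ⊤) :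
    IsSimplex V := by
  have hf : V.Finite := Set.finite_of_ncard_ne_zero (by omega)
  have := hf.fintype
  refine ⟨?_, hs⟩
  rw [affineIndependent_iff_finrank_vectorSpan_eq ℝ _ (n := Module.finrank ℝ E)]
  · rw [Subtype.range_coe, ← direction_affineSpan, hs, AffineSubspace.direction_top, finrank_top]
  · rw [← hV, Set.ncard_eq_toFinset_card', Set.toFinset_card]

theorem _root_.affineMap_midpoint (f : E →ᵃ[ℝ] ℝ) (a b : E) :
    f (midpoint ℝ a b) = (f a + f b) / 2 := by
  rw [AffineMap.map_midpoint, midpoint_eq_smul_add]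
  simp; ring

theorem midpoint_notMem (h : IsSimplex V) (ha : a ∈ V) (hb : b ∈ V) (hab : a ≠ b) :
    midpoint ℝ a b ∉ V := by
  intro hm
  have h1 : baryCoord V a (midpoint ℝ a b) = 1 / 2 := by
    rw [affineMap_midpoint, h.baryCoord_self ha, h.baryCoord_of_ne ha hb hab]; norm_num
  rcases eq_or_ne a (midpoint ℝ a b) with e | hne
  · rw [← e, h.baryCoord_self ha] at h1; norm_num at h1
  · rw [h.baryCoord_of_ne ha hm hne] at h1; norm_num at h1

/-- A face of a nondegenerate simplex does not lie in two different hyperplanes. -/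
theorem not_vanish_two (hV : IsSimplex V) (hW : IsSimplex W) (hw : w ∈ W) {u v : E}
    (hu : u ∈ V) (hv : v ∈ V) (huv : u ≠ v) (h1 : ∀ y ∈ W \ {w}, baryCoord V u y = 0)
    (h2 : ∀ y ∈ W \ {w}, baryCoord V v y = 0) : False := by
  have := hW.mul_eq_mul_of_vanish hw h1 h2 u v
  rw [hV.baryCoord_self hu, hV.baryCoord_self hv, hV.baryCoord_of_ne hu hv huv] at this
  simp at this

section FiniteDimensional

variable [FiniteDimensional ℝ E]

theorem finite (h : IsSimplex V) : V.Finite :=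
  have := finite_of_fin_dim_affineIndependent ℝ h.indep
  Set.toFinite V

theorem ncard (h : IsSimplex V) : V.ncard = Module.finrank ℝ E + 1 := by
  have := h.finite.fintype
  rw [← h.basis.card_eq_finrank_add_one, Set.ncard_eq_toFinset_card', Set.toFinset_card]

theorem eq_of_subset (h : IsSimplex V) (h' : IsSimplex W) (hVW : V ⊆ W) : V = W :=
  Set.eq_of_subset_of_ncard_le hVW (by rw [h.ncard, h'.ncard]) h'.finite

theorem sum_baryCoord_smul (h : IsSimplex V) (x : E) :
    ∑ v ∈ h.finite.toFinset, baryCoord V v x • v = x := by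
  have := h.finite.fintype
  conv_rhs => rw [← h.basis.linear_combination_coord_eq_self x]
  rw [← Finset.sum_coe_sort]
  refine Fintype.sum_equiv (Equiv.subtypeEquivRight (by simp)) _ _ fun v => ?_
  have hv : (v : E) ∈ V := by simpa using v.2
  rw [h.baryCoord_eq hv]
  rfl

theorem sum_baryCoord (h : IsSimplex V) (x : E) :
    ∑ v ∈ h.finite.toFinset, baryCoord V v x = 1 := by
  have := h.finite.fintype
  conv_rhs => rw [← h.basis.sum_coord_apply_eq_one x]
  rw [← Finset.sum_coe_sort]
  refine Fintype.sum_equiv (Equiv.subtypeEquivRight (by simp)) _ _ fun v => ?_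
  have hv : (v : E) ∈ V := by simpa using v.2
  rw [h.baryCoord_eq hv]
  rfl

/-- The conditions on the right define a convex set containing `G`; conversely, the barycentric
representation of `x` then uses only vertices in `G`. Most of the geometry below reduces to signs
and zeros of coordinates through this criterion. -/
theorem mem_convexHull_iff (h : IsSimplex V) (hG : G ⊆ V) :
    x ∈ convexHull ℝ G ↔
      (∀ v ∈ V, 0 ≤ baryCoord V v x) ∧ ∀ v ∈ V, v ∉ G → baryCoord V v x = 0 := by
  constructor
  · have key : convexHull ℝ G ⊆
        (⋂ v ∈ V, baryCoord V v ⁻¹' Ici 0) ∩ ⋂ v ∈ V, ⋂ _ : v ∉ G, baryCoord V v ⁻¹' {0} := by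
      refine convexHull_min ?_ ?_
      · intro w hw
        simp only [mem_inter_iff, mem_iInter, mem_preimage, mem_Ici, mem_singleton_iff]
        refine ⟨fun v hv => ?_, fun v hv hvG => ?_⟩
        · rcases eq_or_ne v w with rfl | hne
          · rw [h.baryCoord_self hv]; exact zero_le_one
          · rw [h.baryCoord_of_ne hv (hG hw) hne]
        · exact h.baryCoord_of_ne hv (hG hw) (fun e => hvG (e ▸ hw))
      · exact (convex_iInter₂ fun v _ => (convex_Ici 0).affine_preimage _).inter
          (convex_iInter₂ fun v _ => convex_iInter fun _ =>
            (convex_singleton 0).affine_preimage _)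
    intro hx
    simpa using key hx
  · rintro ⟨h0, h1⟩
    classical
    have hGf : G.Finite := h.finite.subset hG
    have hsub : hGf.toFinset ⊆ h.finite.toFinset := by simpa using hG
    have e1 := h.sum_baryCoord_smul x
    have e2 := h.sum_baryCoord x
    rw [← Finset.sum_subset hsub] at e1 e2
    · rw [← e1]
      refine (convex_convexHull ℝ G).sum_mem (fun v hv => h0 v ?_) e2 fun v hv => ?_
      · exact hG (by simpa using hv)
      · exact subset_convexHull ℝ G (by simpa using hv)
    · intro v hv hvG
      exact h1 v (by simpa using hv) (by simpa using hvG)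
    · intro v hv hvG
      rw [h1 v (by simpa using hv) (by simpa using hvG), zero_smul]

theorem mem_convexHull_self_iff (h : IsSimplex V) :
    x ∈ convexHull ℝ V ↔ ∀ v ∈ V, 0 ≤ baryCoord V v x := by
  rw [h.mem_convexHull_iff subset_rfl]
  exact ⟨fun h => h.1, fun h => ⟨h, fun v hv hv' => absurd hv hv'⟩⟩

theorem convexHull_inter (h : IsSimplex V) (hG : G ⊆ V) (hH : H ⊆ V) :
    convexHull ℝ G ∩ convexHull ℝ H = convexHull ℝ (G ∩ H) := by
  ext x
  rw [mem_inter_iff, h.mem_convexHull_iff hG, h.mem_convexHull_iff hH,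
    h.mem_convexHull_iff (inter_subset_left.trans hG)]
  constructor
  · rintro ⟨⟨h1, h2⟩, -, h3⟩
    refine ⟨h1, fun v hv hv' => ?_⟩
    by_cases hvG : v ∈ G
    · exact h3 v hv fun hvH => hv' ⟨hvG, hvH⟩
    · exact h2 v hv hvG
  · rintro ⟨h1, h2⟩
    exact ⟨⟨h1, fun v hv hv' => h2 v hv fun h => hv' h.1⟩, h1,
      fun v hv hv' => h2 v hv fun h => hv' h.2⟩

theorem mem_of_mem_convexHull (h : IsSimplex V) (hG : G ⊆ V) (hv : v ∈ V)
    (hvG : v ∈ convexHull ℝ G) : v ∈ G := by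
  by_contra hn
  have := ((h.mem_convexHull_iff hG).1 hvG).2 v hv hn
  rw [h.baryCoord_self hv] at this
  exact one_ne_zero this

theorem subset_of_subset_convexHull (h : IsSimplex V) (hG : G ⊆ V) (hF : F ⊆ V)
    (hFG : F ⊆ convexHull ℝ G) : F ⊆ G :=
  fun _ hv => h.mem_of_mem_convexHull hG (hF hv) (hFG hv)

theorem mem_face_iff (h : IsSimplex V) (hv : v ∈ V) :
    x ∈ convexHull ℝ (V \ {v}) ↔ x ∈ convexHull ℝ V ∧ baryCoord V v x = 0 := by
  rw [h.mem_convexHull_iff sdiff_subset, h.mem_convexHull_self_iff]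
  refine and_congr_right fun _ => ⟨fun h => h v hv (by simp), fun h0 w hw hw' => ?_⟩
  have : w = v := by by_contra hne; exact hw' ⟨hw, hne⟩
  rwa [this]

/-- The vertex set of the child containing `a` when `V` is bisected at the edge `ab`. -/
def _root_.bisectSet (V : Set E) (a b : E) : Set E := insert (midpoint ℝ a b) (V \ {b})

theorem bisect (h : IsSimplex V) (ha : a ∈ V) (hb : b ∈ V) (hab : a ≠ b) :
    IsSimplex (bisectSet V a b) := by
  refine of_span ?_ ?_
  · rw [bisectSet, Set.ncard_insert_of_notMem (fun hm => h.midpoint_notMem ha hb hab hm.1)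
      (h.finite.sdiff), Set.ncard_sdiff_singleton_add_one hb h.finite, h.ncard]
  · rw [eq_top_iff, ← h.span, affineSpan_le]
    intro v hv
    rcases eq_or_ne v b with rfl | hne
    · have hv : v = AffineMap.lineMap a (midpoint ℝ a v) (2 : ℝ) := by
        rw [AffineMap.lineMap_apply, midpoint_eq_smul_add]
        simp only [vsub_eq_sub, vadd_eq_add, smul_sub, smul_smul, smul_add]
        norm_num
        module
      have := AffineMap.lineMap_mem (2 : ℝ) (subset_affineSpan ℝ (bisectSet V a v)
        (Or.inr ⟨ha, hab⟩ : a ∈ bisectSet V a v))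
        (subset_affineSpan ℝ (bisectSet V a v) (Or.inl rfl))
      rwa [← hv] at this
    · exact subset_affineSpan ℝ _ (Or.inr ⟨hv, hne⟩)

/-- This and the next two lemmas give the change of coordinates under bisection. Each formula is
affine, so it is enough to check it at the vertices of the child. -/
theorem baryCoord_bisect_mid (h : IsSimplex V) (ha : a ∈ V) (hb : b ∈ V) (hab : a ≠ b) (x : E) :
    baryCoord (bisectSet V a b) (midpoint ℝ a b) x = 2 * baryCoord V b x := by
  rw [← (h.bisect ha hb hab).eq_baryCoord (f := (2 : ℝ) • baryCoord V b) (Or.inl rfl)]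
  · simp
  · rw [affineMap_midpoint]
    simp [h.baryCoord_self hb, h.baryCoord_of_ne hb ha hab.symm]
  · rintro w (rfl | ⟨hw, hwb⟩) hne
    · exact absurd rfl hne
    · simp [h.baryCoord_of_ne hb hw (Ne.symm hwb)]

theorem baryCoord_bisect_left (h : IsSimplex V) (ha : a ∈ V) (hb : b ∈ V) (hab : a ≠ b) (x : E) :
    baryCoord (bisectSet V a b) a x = baryCoord V a x - baryCoord V b x := by
  rw [← (h.bisect ha hb hab).eq_baryCoord (f := baryCoord V a - baryCoord V b)
    (Or.inr ⟨ha, hab⟩)]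
  · simp
  · simp [h.baryCoord_self ha, h.baryCoord_of_ne hb ha hab.symm]
  · rintro w (rfl | ⟨hw, hwb⟩) hne
    · simp [h.baryCoord_self hb, h.baryCoord_of_ne hb ha hab.symm,
        h.baryCoord_self ha, h.baryCoord_of_ne ha hb hab]
    · simp [h.baryCoord_of_ne hb hw (Ne.symm hwb), h.baryCoord_of_ne ha hw hne.symm]

theorem baryCoord_bisect_of_ne (h : IsSimplex V) (ha : a ∈ V) (hb : b ∈ V) (hab : a ≠ b)
    (hv : v ∈ V) (hva : v ≠ a) (hvb : v ≠ b) (x : E) :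
    baryCoord (bisectSet V a b) v x = baryCoord V v x := by
  rw [← (h.bisect ha hb hab).eq_baryCoord (f := baryCoord V v) (Or.inr ⟨hv, hvb⟩)]
  · exact h.baryCoord_self hv
  · rintro w (rfl | ⟨hw, hwb⟩) hne
    · simp [h.baryCoord_of_ne hv ha hva, h.baryCoord_of_ne hv hb hvb]
    · exact h.baryCoord_of_ne hv hw hne.symm

/-- The child at `a` is cut out of the parent by the bisecting hyperplane, on which the coordinates
of `a` and `b` agree. -/
theorem mem_bisect_iff (h : IsSimplex V) (ha : a ∈ V) (hb : b ∈ V) (hab : a ≠ b) :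
    x ∈ convexHull ℝ (bisectSet V a b) ↔
      x ∈ convexHull ℝ V ∧ baryCoord V b x ≤ baryCoord V a x := by
  rw [(h.bisect ha hb hab).mem_convexHull_self_iff, h.mem_convexHull_self_iff]
  constructor
  · intro h0
    have hm := h0 _ (Or.inl rfl)
    have ha' := h0 a (Or.inr ⟨ha, hab⟩)
    rw [h.baryCoord_bisect_mid ha hb hab] at hm
    rw [h.baryCoord_bisect_left ha hb hab] at ha'
    refine ⟨fun v hv => ?_, by linarith⟩
    rcases eq_or_ne v a with rfl | hva
    · linarith
    rcases eq_or_ne v b with rfl | hvb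
    · linarith
    rw [← h.baryCoord_bisect_of_ne ha hb hab hv hva hvb]
    exact h0 v (Or.inr ⟨hv, hvb⟩)
  · rintro ⟨h0, h1⟩ v (rfl | ⟨hv, hvb⟩)
    · rw [h.baryCoord_bisect_mid ha hb hab]; linarith [h0 b hb]
    · rcases eq_or_ne v a with rfl | hva
      · rw [h.baryCoord_bisect_left ha hb hab]; linarith
      · rw [h.baryCoord_bisect_of_ne ha hb hab hv hva hvb]; exact h0 v hv

theorem bisect_subset (h : IsSimplex V) (ha : a ∈ V) (hb : b ∈ V) (hab : a ≠ b) :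
    convexHull ℝ (bisectSet V a b) ⊆ convexHull ℝ V :=
  fun _ hx => ((h.mem_bisect_iff ha hb hab).1 hx).1

theorem union_bisect (h : IsSimplex V) (ha : a ∈ V) (hb : b ∈ V) (hab : a ≠ b) :
    convexHull ℝ (bisectSet V a b) ∪ convexHull ℝ (bisectSet V b a) = convexHull ℝ V := by
  ext x
  rw [mem_union, h.mem_bisect_iff ha hb hab, h.mem_bisect_iff hb ha hab.symm]
  constructor
  · rintro (h | h) <;> exact h.1
  · intro hx
    rcases le_total (baryCoord V b x) (baryCoord V a x) with h | h
    · exact Or.inl ⟨hx, h⟩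
    · exact Or.inr ⟨hx, h⟩

/-- The part of a subsimplex with vertices `G` in a child. -/
theorem mem_bisect_inter_of_subset (h : IsSimplex V) (ha : a ∈ V) (hb : b ∈ V) (hab : a ≠ b)
    (hG : G ⊆ V) (haG : a ∈ G) (hx : x ∈ convexHull ℝ (bisectSet V a b))
    (hxG : x ∈ convexHull ℝ G) : x ∈ convexHull ℝ (bisectSet G a b) := by
  have h' := h.bisect ha hb hab
  have hsub : bisectSet G a b ⊆ bisectSet V a b :=
    insert_subset_insert (sdiff_subset_sdiff_left hG)
  rw [h'.mem_convexHull_iff hsub]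
  refine ⟨h'.mem_convexHull_self_iff.1 hx, ?_⟩
  rintro v (rfl | ⟨hv, hvb⟩) hvG
  · exact absurd (Or.inl rfl) hvG
  · have hvG' : v ∉ G := fun h => hvG (Or.inr ⟨h, hvb⟩)
    rw [h.baryCoord_bisect_of_ne ha hb hab hv (fun e => hvG' (e ▸ haG)) hvb]
    exact ((h.mem_convexHull_iff hG).1 hxG).2 v hv hvG'

/-- An uncut subsimplex meets the child in a subsimplex spanned by old vertices. The coordinate of
`b` vanishes at `x`: either `b` is missing from `G`, or `a` is, and then 0 ≤ λ_b ≤ λ_a = 0. -/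
theorem mem_bisect_inter_of_not_subset (h : IsSimplex V) (ha : a ∈ V) (hb : b ∈ V) (hab : a ≠ b)
    (hG : G ⊆ V) (habG : ¬ (a ∈ G ∧ b ∈ G)) (hx : x ∈ convexHull ℝ (bisectSet V a b))
    (hxG : x ∈ convexHull ℝ G) : x ∈ convexHull ℝ (bisectSet V a b ∩ G) := by
  have h' := h.bisect ha hb hab
  have hG' := (h.mem_convexHull_iff hG).1 hxG
  have hx' := (h.mem_bisect_iff ha hb hab).1 hx
  have hb0 : baryCoord V b x = 0 := by
    by_cases hbG : b ∈ G
    · have : baryCoord V a x = 0 := hG'.2 a ha fun haG => habG ⟨haG, hbG⟩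
      linarith [hG'.1 b hb, hx'.2]
    · exact hG'.2 b hb hbG
  rw [h'.mem_convexHull_iff inter_subset_left]
  refine ⟨h'.mem_convexHull_self_iff.1 hx, ?_⟩
  rintro v (rfl | ⟨hv, hvb⟩) hvG
  · rw [h.baryCoord_bisect_mid ha hb hab, hb0, mul_zero]
  · have hv0 := hG'.2 v hv fun h => hvG ⟨Or.inr ⟨hv, hvb⟩, h⟩
    rcases eq_or_ne v a with rfl | hva
    · rw [h.baryCoord_bisect_left ha hb hab, hb0, hv0, sub_zero]
    · rw [h.baryCoord_bisect_of_ne ha hb hab hv hva hvb, hv0]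

/-- The intersection of the two children with a subsimplex containing the refinement edge. -/
theorem mem_bisect_both (h : IsSimplex V) (ha : a ∈ V) (hb : b ∈ V) (hab : a ≠ b)
    (hG : G ⊆ V) (haG : a ∈ G) (hx : x ∈ convexHull ℝ (bisectSet V a b))
    (hx' : x ∈ convexHull ℝ (bisectSet V b a)) (hxG : x ∈ convexHull ℝ G) :
    x ∈ convexHull ℝ (insert (midpoint ℝ a b) (G \ {a, b})) := by
  have h' := h.bisect ha hb hab
  have hsub : insert (midpoint ℝ a b) (G \ {a, b}) ⊆ bisectSet V a b := by
    refine insert_subset_insert fun v hv => ⟨hG hv.1, fun h => hv.2 (Or.inr h)⟩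
  rw [h'.mem_convexHull_iff hsub]
  refine ⟨h'.mem_convexHull_self_iff.1 hx, ?_⟩
  rintro v (rfl | ⟨hv, hvb⟩) hvG
  · exact absurd (Or.inl rfl) hvG
  · rcases eq_or_ne v a with rfl | hva
    · rw [h.baryCoord_bisect_left ha hb hab]
      linarith [((h.mem_bisect_iff ha hb hab).1 hx).2,
        ((h.mem_bisect_iff hb ha hab.symm).1 hx').2]
    · rw [h.baryCoord_bisect_of_ne ha hb hab hv hva hvb]
      refine ((h.mem_convexHull_iff hG).1 hxG).2 v hv fun hvG' => hvG (Or.inr ⟨hvG', ?_⟩)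
      rintro (h | h)
      exacts [hva h, hvb h]

/-- Two simplices that intersect exactly in a common face lie on opposite sides of it. -/
theorem baryCoord_opposite_neg (hV : IsSimplex V) (hW : IsSimplex W) (hne : V ≠ W)
    (hVW : convexHull ℝ V ∩ convexHull ℝ W = convexHull ℝ (V ∩ W)) (hF : F.Nonempty)
    (hv : v ∈ V) (hw : w ∈ W) (hFV : F = V \ {v}) (hFW : F = W \ {w}) :
    baryCoord V v w < 0 := by
  have hwV : w ∉ V := fun hwV => hne <| (hW.eq_of_subset hV (by
    intro y hy
    rcases eq_or_ne y w with rfl | hyw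
    · exact hwV
    · have : y ∈ F := hFW ▸ ⟨hy, hyw⟩
      exact (hFV ▸ this : y ∈ V \ {v}).1)).symm
  have hvF : ∀ y ∈ V \ {v}, y ∈ W := fun y hy => (hFW ▸ hFV ▸ hy : y ∈ W \ {w}).1
  have hFfin : F.Finite := hFV ▸ hV.finite.sdiff
  by_contra hn
  push Not at hn
  -- If `w` were not strictly behind the face, a short move from a relative interior point `b` of
  -- `F` towards `w` would stay in the hull of `V`. Conformity would put the moved point into the
  -- hull of `V ∩ W`, where the `w`-coordinate is zero, while it equals `s > 0`.
  obtain ⟨b, hb, hbF⟩ := exists_mem_convexHull_forall_affine hFfin hF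
  have hbV : ∀ y ∈ V, y ≠ v → 0 < baryCoord V y b := by
    intro y hy hyv
    have h0 : ∀ z ∈ F, 0 ≤ baryCoord V y z := fun z hz => by
      rcases eq_or_ne y z with rfl | hyz
      · rw [hV.baryCoord_self hy]; exact zero_le_one
      · rw [hV.baryCoord_of_ne hy (hFV ▸ hz : z ∈ V \ {v}).1 hyz]
    have hb0 : 0 ≤ baryCoord V y b :=
      hV.mem_convexHull_self_iff.1 (convexHull_mono (hFV ▸ sdiff_subset) hb) y hy
    refine lt_of_le_of_ne hb0 fun e => ?_
    have := hbF _ h0 e.symm y (hFV ▸ ⟨hy, hyv⟩)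
    rw [hV.baryCoord_self hy] at this
    exact one_ne_zero this
  have hbv : baryCoord V v b = 0 := ((hV.mem_face_iff hv).1 (hFV ▸ hb)).2
  have hev : ∃ s : ℝ, 0 < s ∧ s ≤ 1 ∧
      ∀ y ∈ V, 0 ≤ baryCoord V y (AffineMap.lineMap b w s) := by
    have hev : ∀ y ∈ V, ∀ᶠ s : ℝ in nhdsWithin 0 (Ioi 0),
        0 ≤ baryCoord V y (AffineMap.lineMap b w s) := by
      intro y hy
      rcases eq_or_ne y v with rfl | hyv
      · filter_upwards [self_mem_nhdsWithin] with s hs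
        rw [AffineMap.apply_lineMap, hbv, AffineMap.lineMap_apply]
        simpa using mul_nonneg (le_of_lt hs) hn
      · have hc : Continuous fun s : ℝ => baryCoord V y (AffineMap.lineMap b w s) := by
          exact (baryCoord V y).continuous_of_finiteDimensional.comp AffineMap.lineMap_continuous
        have := hc.tendsto 0
        simp only [AffineMap.lineMap_apply_zero] at this
        filter_upwards [nhdsWithin_le_nhds (this.eventually (lt_mem_nhds (hbV y hy hyv)))]
          with s hs using hs.le
    have h1 : ∀ᶠ s : ℝ in nhdsWithin 0 (Ioi 0), s ≤ 1 :=
      nhdsWithin_le_nhds (eventually_le_nhds (by norm_num))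
    have h2 := (Filter.eventually_all_finite hV.finite).2 hev
    obtain ⟨s, ⟨hs, hs1⟩, hs2⟩ := ((h2.and h1).and self_mem_nhdsWithin).exists
    exact ⟨s, hs2, hs1, hs⟩
  obtain ⟨s, hs0, hs1, hs⟩ := hev
  have hxW : AffineMap.lineMap b w s ∈ convexHull ℝ W :=
    (convex_convexHull ℝ W).lineMap_mem (convexHull_mono (hFW ▸ sdiff_subset) hb)
      (subset_convexHull ℝ W hw) ⟨hs0.le, hs1⟩
  have hx : AffineMap.lineMap b w s ∈ convexHull ℝ (V ∩ W) :=
    hVW ▸ ⟨hV.mem_convexHull_self_iff.2 hs, hxW⟩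
  have hww : w ∉ V ∩ W := fun h => hwV h.1
  have := ((hW.mem_convexHull_iff inter_subset_right).1 hx).2 w hw hww
  rw [AffineMap.apply_lineMap, hW.baryCoord_self hw,
    ((hW.mem_face_iff hw).1 (hFW ▸ hb)).2, AffineMap.lineMap_apply] at this
  simp at this
  exact hs0.ne' this

theorem measure_convexHull_eq_zero [MeasurableSpace E] [BorelSpace E] (μ : Measure E)
    [μ.IsAddHaarMeasure] (h : IsSimplex V) (hG : G ⊆ V) (hne : G ≠ V) :
    μ (convexHull ℝ G) = 0 := by
  obtain ⟨v, hv, hvG⟩ : ∃ v ∈ V, v ∉ G := by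
    by_contra! hn
    exact hne (hG.antisymm hn)
  refine measure_mono_null (convexHull_subset_affineSpan G)
    (Measure.addHaar_affineSubspace μ _ fun htop => ?_)
  have h0 : baryCoord V v = 0 := AffineMap.ext_on htop fun w hw =>
    h.baryCoord_of_ne hv (hG hw) fun e => hvG (e ▸ hw)
  have h1 := h.baryCoord_self hv
  rw [h0] at h1
  exact zero_ne_one h1

end FiniteDimensional

end IsSimplex

end SimplexGeometry

/-! ### Index calculus of vertex orders, children and reflections -/

namespace TaggedSimplex

variable {d : ℕ} {K L C D : TaggedSimplex d}

theorem dim_pos (K : TaggedSimplex d) : 0 < d := K.type.pos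

/-- The `n`-th vertex, indexed by natural numbers. -/
def v (K : TaggedSimplex d) (n : ℕ) : EuclideanSpace ℝ (Fin d) := K.vert (Fin.ofNat (d + 1) n)

theorem vert_eq_v (K : TaggedSimplex d) (j : Fin (d + 1)) : K.vert j = K.v j := by
  simp [v]

theorem vert_zero_eq_v (K : TaggedSimplex d) : K.vert 0 = K.v 0 := by simp [vert_eq_v]

theorem vert_last_eq_v (K : TaggedSimplex d) : K.vert (Fin.last d) = K.v d := by
  simp [vert_eq_v]

theorem mid_eq_v (K : TaggedSimplex d) : K.mid = midpoint ℝ (K.v 0) (K.v d) := by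
  rw [mid, vert_zero_eq_v, vert_last_eq_v]

theorem ext_v (ht : K.type = L.type) (h : ∀ n ≤ d, K.v n = L.v n) : K = L := by
  refine TaggedSimplex.ext (funext fun j => ?_) ht
  rw [vert_eq_v, vert_eq_v]
  exact h j (by omega)

theorem val_ofNat {n : ℕ} (hn : n ≤ d) : ((Fin.ofNat (d + 1) n : Fin (d + 1)) : ℕ) = n := by
  simp [Nat.mod_eq_of_lt (Nat.lt_succ_of_le hn)]

theorem child₁_v (K : TaggedSimplex d) {n : ℕ} (hn : n ≤ d) :
    K.child₁.v n = if n = 0 then K.v 0 else if n = 1 then K.mid else K.v (n - 1) := by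
  have := val_ofNat hn
  simp only [v, child₁, this]
  rfl

theorem child₂_v (K : TaggedSimplex d) {n : ℕ} (hn : n ≤ d) :
    K.child₂.v n = if n = 0 then K.v d else if n = 1 then K.mid
      else if n ≤ K.type + 1 then K.v (n - 1) else K.v (d + K.type + 1 - n) := by
  have := val_ofNat hn
  simp only [v, child₂, this]
  rw [← v, ← v, ← v, vert_last_eq_v]

theorem reflect_v (K : TaggedSimplex d) {n : ℕ} (hn : n ≤ d) :
    K.reflect.v n = if n = 0 then K.v d else if n = d then K.v 0
      else if n ≤ K.type then K.v n else K.v (d + K.type - n) := by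
  have := val_ofNat hn
  simp only [v, reflect, this]
  rw [← v, ← v, ← v, vert_last_eq_v]
  rfl

@[simp] theorem reflect_type (K : TaggedSimplex d) : K.reflect.type = K.type := rfl

theorem reflect_mid (K : TaggedSimplex d) : K.reflect.mid = K.mid := by
  have := K.dim_pos
  rw [mid_eq_v, mid_eq_v, reflect_v _ le_rfl, reflect_v _ (Nat.zero_le d), midpoint_comm]
  simp [this.ne']

theorem child₁_reflect (K : TaggedSimplex d) : K.reflect.child₁ = K.child₂ := by
  have ht := K.type.isLt
  refine ext_v rfl fun n hn => ?_
  rw [child₁_v _ hn, child₂_v _ hn, reflect_mid, reflect_v _ (Nat.zero_le d),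
    reflect_v _ (by omega)]
  split_ifs <;> first | rfl | omega | (congr 1; omega)

theorem reflect_reflect (K : TaggedSimplex d) : K.reflect.reflect = K := by
  have ht := K.type.isLt
  refine ext_v rfl fun n hn => ?_
  rw [reflect_v _ hn, reflect_type]
  by_cases h0 : n = 0
  · rw [if_pos h0, reflect_v _ le_rfl, if_neg (by omega), if_pos rfl, h0]
  rw [if_neg h0]
  by_cases hd : n = d
  · rw [if_pos hd, reflect_v _ (Nat.zero_le d), if_pos rfl, hd]
  rw [if_neg hd]
  by_cases h : n ≤ K.type
  · rw [if_pos h, reflect_v _ hn, if_neg h0, if_neg hd, if_pos h]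
  · rw [if_neg h, reflect_v _ (by omega), if_neg (by omega), if_neg (by omega),
      if_neg (by omega)]
    congr 1; omega

theorem child₂_reflect (K : TaggedSimplex d) : K.reflect.child₂ = K.child₁ := by
  rw [← child₁_reflect, reflect_reflect]

theorem isChild_reflect : C.IsChild K.reflect ↔ C.IsChild K := by
  rw [IsChild, IsChild, child₁_reflect, child₂_reflect, or_comm]

theorem reflect_refinementEdge (K : TaggedSimplex d) :
    K.reflect.refinementEdge = K.refinementEdge := by
  have := K.dim_pos
  rw [refinementEdge, refinementEdge, vert_zero_eq_v, vert_last_eq_v, vert_zero_eq_v,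
    vert_last_eq_v, reflect_v _ le_rfl, reflect_v _ (Nat.zero_le d), pair_comm]
  simp [this.ne']

theorem v_mem_vertexSet (K : TaggedSimplex d) (n : ℕ) : K.v n ∈ K.vertexSet := mem_range_self _

theorem mem_vertexSet_iff {x : EuclideanSpace ℝ (Fin d)} :
    x ∈ K.vertexSet ↔ ∃ n ≤ d, K.v n = x := by
  constructor
  · rintro ⟨j, rfl⟩
    exact ⟨j, by omega, (K.vert_eq_v j).symm⟩
  · rintro ⟨n, -, rfl⟩
    exact K.v_mem_vertexSet n

theorem reflect_vertexSet (K : TaggedSimplex d) : K.reflect.vertexSet = K.vertexSet := by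
  have ht := K.type.isLt
  ext x
  rw [mem_vertexSet_iff, mem_vertexSet_iff]
  constructor
  · rintro ⟨n, hn, rfl⟩
    rw [reflect_v _ hn]
    split_ifs
    exacts [⟨_, le_rfl, rfl⟩, ⟨_, Nat.zero_le d, rfl⟩, ⟨_, hn, rfl⟩, ⟨_, by omega, rfl⟩]
  · rintro ⟨n, hn, rfl⟩
    refine ⟨if n = 0 then d else if n = d then 0 else if n ≤ K.type then n else d + K.type - n,
      by split_ifs <;> omega, ?_⟩
    rw [reflect_v _ (by split_ifs <;> omega)]
    split_ifs <;> first | rfl | omega | (congr 1; omega)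

/-- The ordered vertices agree at all positions except possibly the `i`-th one. -/
def Agree (K L : TaggedSimplex d) (i : ℕ) : Prop :=
  K.type = L.type ∧ ∀ n ≤ d, n ≠ i → K.v n = L.v n

theorem Agree.isReflected {i : ℕ} (hi : i ≤ d) (h : K.Agree L i) : K.IsReflected L := by
  refine ⟨h.1, Or.inl ⟨⟨i, by omega⟩, fun j hj => ?_⟩⟩
  rw [vert_eq_v, vert_eq_v]
  exact h.2 j (by omega) fun e => hj (Fin.ext e)

theorem Agree.isReflected_of_reflect {i : ℕ} (hi : i ≤ d) (h : K.reflect.Agree L i) :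
    K.IsReflected L := by
  refine ⟨h.1, Or.inr ⟨⟨i, by omega⟩, fun j hj => ?_⟩⟩
  rw [vert_eq_v, vert_eq_v]
  exact h.2 j (by omega) fun e => hj (Fin.ext e)

theorem IsReflected.exists_agree (h : K.IsReflected L) :
    ∃ K' : TaggedSimplex d, (K' = K ∨ K' = K.reflect) ∧ ∃ i ≤ d, K'.Agree L i := by
  obtain ⟨ht, ⟨i, hi⟩ | ⟨i, hi⟩⟩ := h
  · refine ⟨K, Or.inl rfl, i, by omega, ht, fun n hn hni => ?_⟩
    exact hi _ fun e => hni (by rw [← e, val_ofNat hn])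
  · refine ⟨K.reflect, Or.inr rfl, i, by omega, ht, fun n hn hni => ?_⟩
    exact hi _ fun e => hni (by rw [← e, val_ofNat hn])

/-- The first child drops the last vertex, so the two lists then differ only through the midpoint,
which sits in position 1. The next lemma is the mirror case: the second child drops vertex 0. -/
theorem Agree.child₁_of_last (h : K.Agree L d) : K.child₁.Agree L.child₁ 1 := by
  refine ⟨by simp [child₁, childType, h.1], fun n hn hn1 => ?_⟩
  rw [child₁_v _ hn, child₁_v _ hn, if_neg hn1, if_neg hn1]
  have := K.dim_pos
  split_ifs
  exacts [h.2 _ (by omega) (by omega), h.2 _ (by omega) (by omega)]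

theorem Agree.child₂_of_zero (h : K.Agree L 0) : K.child₂.Agree L.child₂ 1 := by
  refine ⟨by simp [child₂, childType, h.1], fun n hn hn1 => ?_⟩
  rw [child₂_v _ hn, child₂_v _ hn, if_neg hn1, if_neg hn1, ← h.1]
  have := K.dim_pos
  split_ifs
  exacts [h.2 _ (by omega) (by omega), h.2 _ (by omega) (by omega), h.2 _ (by omega) (by omega)]

theorem Agree.mid_eq {i : ℕ} (h : K.Agree L i) (h0 : 0 < i) (hd : i < d) : K.mid = L.mid := by
  rw [mid_eq_v, mid_eq_v, h.2 0 (by omega) (by omega), h.2 d (by omega) (by omega)]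

theorem Agree.child₁ {i : ℕ} (h : K.Agree L i) (h0 : 0 < i) (hd : i < d) :
    K.child₁.Agree L.child₁ (i + 1) := by
  refine ⟨by simp [TaggedSimplex.child₁, childType, h.1], fun n hn hn1 => ?_⟩
  rw [child₁_v _ hn, child₁_v _ hn, h.mid_eq h0 hd]
  split_ifs
  exacts [h.2 _ (by omega) (by omega), rfl, h.2 _ (by omega) (by omega)]

theorem Agree.child₂ {i : ℕ} (h : K.Agree L i) (h0 : 0 < i) (hd : i < d) :
    ∃ i' ≤ d, K.child₂.Agree L.child₂ i' := by
  have ht := K.type.isLt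
  -- This is the place of the old vertex `i` in the second child: shifted by one in the kept block,
  -- reversed in the block after the type.
  refine ⟨if i ≤ K.type then i + 1 else d + K.type + 1 - i, by split_ifs <;> omega,
    by simp [TaggedSimplex.child₂, childType, h.1], fun n hn hn1 => ?_⟩
  rw [child₂_v _ hn, child₂_v _ hn, h.mid_eq h0 hd, ← h.1]
  split_ifs at hn1 ⊢ <;> first | rfl | exact h.2 _ (by omega) (by omega)

theorem Agree.refinementEdge_eq {i : ℕ} (h : K.Agree L i) (h0 : 0 < i) (hd : i < d) :
    K.refinementEdge = L.refinementEdge := by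
  rw [refinementEdge, refinementEdge, vert_zero_eq_v, vert_last_eq_v, vert_zero_eq_v,
    vert_last_eq_v, h.2 0 (by omega) (by omega), h.2 d (by omega) (by omega)]

theorem childType_val (K : TaggedSimplex d) :
    (K.childType : ℕ) = if (K.type : ℕ) + 1 < d then (K.type : ℕ) + 1 else 0 := by
  have ht := K.type.isLt
  change ((K.type : ℕ) + 1) % d = _
  split_ifs with h
  · exact Nat.mod_eq_of_lt h
  · rw [show (K.type : ℕ) + 1 = d by omega, Nat.mod_self]

/-- Position 1 is left out because it holds the midpoint of the child's edge, where the two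
grandchildren compared below may differ. The bound on the type ensures that the child's type is `t +
1` without wrapping around. -/
theorem child₁_child₂_v (K : TaggedSimplex d) (h : (K.type : ℕ) + 1 < d) {n : ℕ} (hn : n ≤ d)
    (hn1 : n ≠ 1) : K.child₁.child₂.v n = if n = 0 then K.v (d - 1) else if n = 2 then K.mid
      else if n ≤ K.type + 2 then K.v (n - 2) else K.v (d + K.type + 1 - n) := by
  have ht : (K.child₁.type : ℕ) = K.type + 1 := K.childType_val.trans (if_pos h)
  rw [child₂_v _ hn, ht, if_neg hn1]
  by_cases h0 : n = 0
  · rw [if_pos h0, if_pos h0, child₁_v _ le_rfl, if_neg (by omega), if_neg (by omega)]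
  rw [if_neg h0, if_neg h0]
  by_cases h2 : n ≤ K.type + 2
  · rw [if_pos (by omega), child₁_v _ (by omega), if_neg (by omega)]
    split_ifs <;> first | rfl | omega
  · rw [if_neg (by omega), child₁_v _ (by omega), if_neg (by omega), if_neg (by omega),
      if_neg (by omega), if_neg h2]
    congr 1; omega

theorem child₂_child₂_v (K : TaggedSimplex d) (h : (K.type : ℕ) + 1 < d) {n : ℕ} (hn : n ≤ d)
    (hn1 : n ≠ 1) : K.child₂.child₂.v n = if n = 0 then K.v (K.type + 1) else if n = 2 then K.mid
      else if n ≤ K.type + 2 then K.v (n - 2) else K.v (n - 1) := by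
  have ht : (K.child₂.type : ℕ) = K.type + 1 := K.childType_val.trans (if_pos h)
  rw [child₂_v _ hn, ht, if_neg hn1]
  by_cases h0 : n = 0
  · rw [if_pos h0, if_pos h0, child₂_v _ le_rfl, if_neg (by omega), if_neg (by omega),
      if_neg (by omega)]
    congr 1; omega
  rw [if_neg h0, if_neg h0]
  by_cases h2 : n ≤ K.type + 2
  · rw [if_pos (by omega), child₂_v _ (by omega), if_neg (by omega)]
    split_ifs <;> first | rfl | omega
  · rw [if_neg (by omega), child₂_v _ (by omega), if_neg (by omega), if_neg (by omega),
      if_neg (by omega), if_neg (by omega), if_neg h2]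
    congr 1; omega

/-- The grandchildren adjacent to the common face of two siblings are reflected neighbours. -/
theorem isReflected_siblings (K : TaggedSimplex d) :
    K.child₁.child₂.IsReflected K.child₂.child₂ := by
  have ht := K.type.isLt
  have hty : K.child₁.child₂.type = K.child₂.child₂.type := rfl
  -- There are three regimes. If `t + 2 < d`, the grandchildren match after a reflection of type `t
  -- + 2`. If `t + 2 = d`, their type wraps to 0 and the lists match directly. If `t + 1 = d`, the
  -- children already have type 0. The only exceptional position is always 1.
  by_cases h : (K.type : ℕ) + 1 < d
  · by_cases h2 : (K.type : ℕ) + 2 < d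
    · have hG : (K.child₁.child₂.type : ℕ) = K.type + 2 := by
        have e1 : (K.child₁.type : ℕ) = K.type + 1 := K.childType_val.trans (if_pos h)
        have e2 := K.child₁.childType_val
        rw [e1, if_pos h2] at e2
        exact e2
      refine Agree.isReflected_of_reflect (i := 1) (by omega) ⟨hty, fun n hn hn1 => ?_⟩
      rw [reflect_v _ hn, hG, child₂_child₂_v _ h hn hn1]
      by_cases h0 : n = 0
      · rw [if_pos h0, if_pos h0, child₁_child₂_v _ h le_rfl (by omega), if_neg (by omega),
          if_neg (by omega), if_neg (by omega)]
        congr 1; omega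
      rw [if_neg h0, if_neg h0]
      by_cases hd : n = d
      · rw [if_pos hd, child₁_child₂_v _ h (Nat.zero_le d) (by omega), if_pos rfl,
          if_neg (by omega), if_neg (by omega), hd]
      rw [if_neg hd]
      by_cases h3 : n ≤ K.type + 2
      · rw [if_pos h3, if_pos h3, child₁_child₂_v _ h hn hn1, if_neg h0, if_pos h3]
      · rw [if_neg h3, if_neg h3, child₁_child₂_v _ h (by omega) (by omega), if_neg (by omega),
          if_neg (by omega), if_neg (by omega), if_neg (by omega)]
        congr 1; omega
    · refine Agree.isReflected (i := 1) (by omega) ⟨hty, fun n hn hn1 => ?_⟩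
      rw [child₁_child₂_v _ h hn hn1, child₂_child₂_v _ h hn hn1]
      split_ifs <;> first | rfl | omega | (congr 1; omega)
  · refine Agree.isReflected (i := 1) (by omega) ⟨hty, fun n hn hn1 => ?_⟩
    have t1 : (K.child₁.type : ℕ) = 0 := K.childType_val.trans (if_neg h)
    have t2 : (K.child₂.type : ℕ) = 0 := t1
    rw [child₂_v _ hn, child₂_v _ hn, t1, t2]
    by_cases h0 : n = 0
    · rw [if_pos h0, if_pos h0, child₁_v _ le_rfl, child₂_v _ le_rfl]
      split_ifs <;> first | rfl | omega
    rw [if_neg h0, if_neg h0, if_neg hn1, if_neg hn1, if_neg (by omega), if_neg (by omega),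
      child₁_v _ (by omega), child₂_v _ (by omega)]
    split_ifs <;> first | rfl | omega

theorem isReflected_siblings' (K : TaggedSimplex d) :
    K.child₂.child₂.IsReflected K.child₁.child₂ := by
  have := K.reflect.isReflected_siblings
  rwa [child₁_reflect, child₂_reflect] at this

end TaggedSimplex

/-- A relative interior point of `G` belongs to a face only if all of `G` does. -/
theorem IsSimplex.subset_of_forall_affine {E : Type*} [NormedAddCommGroup E] [NormedSpace ℝ E]
    [FiniteDimensional ℝ E] {V F G : Set E} {b : E} (hV : IsSimplex V) (hG : G ⊆ V) (hF : F ⊆ V)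
    (hb : ∀ f : E →ᵃ[ℝ] ℝ, (∀ v ∈ G, 0 ≤ f v) → f b = 0 → ∀ v ∈ G, f v = 0)
    (hbF : b ∈ convexHull ℝ F) : G ⊆ F := by
  intro v hv
  by_contra hvF
  have h0 := hb (baryCoord V v) (fun w hw => by
    rcases eq_or_ne v w with rfl | hne
    · rw [hV.baryCoord_self (hG hv)]; exact zero_le_one
    · rw [hV.baryCoord_of_ne (hG hv) (hG hw) hne])
    (((hV.mem_convexHull_iff hF).1 hbF).2 v (hG hv) hvF) v hv
  rw [hV.baryCoord_self (hG hv)] at h0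
  exact one_ne_zero h0

/-! ### Vertex sets of children, common faces and reflected neighbours -/

namespace TaggedSimplex

variable {d : ℕ} {K L C D : TaggedSimplex d} {F : Set (EuclideanSpace ℝ (Fin d))}
  {z : EuclideanSpace ℝ (Fin d)}

theorem isSimplex_iff : IsSimplex K.vertexSet ↔ AffineIndependent ℝ K.vert := by
  constructor
  · intro h
    refine AffineIndependent.of_set_of_injective h.indep ?_
    have hn : (K.vert '' Set.univ).ncard = (Set.univ : Set (Fin (d + 1))).ncard := by
      rw [Set.image_univ]
      exact h.ncard.trans (by simp [Set.ncard_univ])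
    exact Set.injOn_univ.1 (Set.injOn_of_ncard_image_eq hn)
  · intro h
    exact ⟨h.range, h.affineSpan_eq_top_iff_card_eq_finrank_add_one.2 (by simp)⟩

theorem v_inj (hK : IsSimplex K.vertexSet) {m n : ℕ} (hm : m ≤ d) (hn : n ≤ d)
    (h : K.v m = K.v n) : m = n := by
  have := (isSimplex_iff.1 hK).injective h
  rw [← val_ofNat hm, ← val_ofNat hn, this]

theorem v_zero_ne_last (hK : IsSimplex K.vertexSet) : K.v 0 ≠ K.v d := fun h =>
  K.dim_pos.ne (v_inj hK (Nat.zero_le d) le_rfl h)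

theorem face_eq (hK : IsSimplex K.vertexSet) (i : Fin (d + 1)) :
    K.face i = K.vertexSet \ {K.vert i} := by
  ext x
  constructor
  · rintro ⟨j, hj, rfl⟩
    exact ⟨mem_range_self j, fun h => hj ((isSimplex_iff.1 hK).injective h)⟩
  · rintro ⟨⟨j, rfl⟩, hj⟩
    exact ⟨j, fun h => hj (by rw [h]; rfl), rfl⟩

theorem hasFace_iff (hK : IsSimplex K.vertexSet) :
    K.HasFace F ↔ ∃ v ∈ K.vertexSet, F = K.vertexSet \ {v} := by
  constructor
  · rintro ⟨i, rfl⟩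
    exact ⟨_, mem_range_self i, face_eq hK i⟩
  · rintro ⟨v, ⟨i, rfl⟩, rfl⟩
    exact ⟨i, (face_eq hK i).symm⟩

theorem HasFace.subset (h : K.HasFace F) : F ⊆ K.vertexSet := by
  obtain ⟨i, rfl⟩ := h
  exact image_subset_range _ _

theorem HasFace.nonempty (h : K.HasFace F) : F.Nonempty := by
  obtain ⟨i, rfl⟩ := h
  have := K.dim_pos
  rcases eq_or_ne i 0 with rfl | hi
  · exact ⟨_, Fin.last d, fun h => this.ne' (congrArg Fin.val h), rfl⟩
  · exact ⟨_, 0, hi.symm, rfl⟩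

theorem HasFace.finite (h : K.HasFace F) : F.Finite := by
  obtain ⟨i, rfl⟩ := h
  exact (Set.toFinite _).image _

theorem HasFace.convexHull_subset (h : K.HasFace F) : convexHull ℝ F ⊆ K.carrier :=
  convexHull_mono h.subset

theorem refinementEdge_eq_pair (K : TaggedSimplex d) : K.refinementEdge = {K.v 0, K.v d} := by
  rw [refinementEdge, vert_zero_eq_v, vert_last_eq_v]

theorem refinementEdge_subset (K : TaggedSimplex d) : K.refinementEdge ⊆ K.vertexSet := by
  rw [refinementEdge_eq_pair]
  rintro x (rfl | rfl) <;> exact K.v_mem_vertexSet _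

theorem child₁_vertexSet (hK : IsSimplex K.vertexSet) :
    K.child₁.vertexSet = bisectSet K.vertexSet (K.v 0) (K.v d) := by
  have := K.dim_pos
  ext x
  rw [bisectSet, mem_insert_iff, mem_sdiff, mem_vertexSet_iff, mem_vertexSet_iff, ← mid_eq_v]
  constructor
  · rintro ⟨n, hn, rfl⟩
    rw [child₁_v _ hn]
    split_ifs with h0 h1
    · exact Or.inr ⟨⟨0, by omega, rfl⟩, v_zero_ne_last hK⟩
    · exact Or.inl rfl
    · refine Or.inr ⟨⟨_, by omega, rfl⟩, fun h => ?_⟩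
      have := v_inj hK (by omega) le_rfl h
      omega
  · rintro (rfl | ⟨⟨n, hn, rfl⟩, hnd⟩)
    · exact ⟨1, this, by rw [child₁_v _ (by omega)]; simp⟩
    · have hnd' : n ≠ d := fun e => hnd (by rw [e]; rfl)
      rcases Nat.eq_zero_or_pos n with rfl | h0
      · exact ⟨0, by omega, by rw [child₁_v _ (by omega)]; simp⟩
      · refine ⟨n + 1, by omega, ?_⟩
        rw [child₁_v _ (by omega), if_neg (by omega), if_neg (by omega)]
        rfl

theorem reflect_v_zero (K : TaggedSimplex d) : K.reflect.v 0 = K.v d := by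
  rw [reflect_v _ (Nat.zero_le d), if_pos rfl]

theorem reflect_v_last (K : TaggedSimplex d) : K.reflect.v d = K.v 0 := by
  rw [reflect_v _ le_rfl, if_neg K.dim_pos.ne', if_pos rfl]

theorem child₂_vertexSet (hK : IsSimplex K.vertexSet) :
    K.child₂.vertexSet = bisectSet K.vertexSet (K.v d) (K.v 0) := by
  rw [← child₁_reflect, child₁_vertexSet (by rwa [reflect_vertexSet]), reflect_vertexSet,
    reflect_v_zero, reflect_v_last]

/-- `a` and `b` are the end points of the refinement edge and `C` is the child containing `a`. -/
structure ChildAt (C K : TaggedSimplex d) (a b : EuclideanSpace ℝ (Fin d)) : Prop where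
  isChild : C.IsChild K
  edge : K.refinementEdge = {a, b}
  left_mem : a ∈ K.vertexSet
  right_mem : b ∈ K.vertexSet
  ne : a ≠ b
  vertexSet_eq : C.vertexSet = bisectSet K.vertexSet a b

theorem childAt_child₁ (hK : IsSimplex K.vertexSet) : ChildAt K.child₁ K (K.v 0) (K.v d) :=
  ⟨Or.inl rfl, K.refinementEdge_eq_pair, K.v_mem_vertexSet _, K.v_mem_vertexSet _, v_zero_ne_last hK,
    child₁_vertexSet hK⟩

theorem childAt_child₂ (hK : IsSimplex K.vertexSet) : ChildAt K.child₂ K (K.v d) (K.v 0) :=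
  ⟨Or.inr rfl, by rw [K.refinementEdge_eq_pair, pair_comm], K.v_mem_vertexSet _, K.v_mem_vertexSet _,
    (v_zero_ne_last hK).symm, child₂_vertexSet hK⟩

theorem IsChild.exists_childAt (hK : IsSimplex K.vertexSet) (h : C.IsChild K) :
    ∃ a b, ChildAt C K a b := by
  rcases h with rfl | rfl
  exacts [⟨_, _, childAt_child₁ hK⟩, ⟨_, _, childAt_child₂ hK⟩]

theorem exists_childAt_of_edge (hK : IsSimplex K.vertexSet) {a b : EuclideanSpace ℝ (Fin d)}
    (hab : K.refinementEdge = {a, b}) : ∃ C, ChildAt C K a b := by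
  rw [refinementEdge_eq_pair] at hab
  rcases Set.pair_eq_pair_iff.1 hab with ⟨rfl, rfl⟩ | ⟨rfl, rfl⟩
  exacts [⟨_, childAt_child₁ hK⟩, ⟨_, childAt_child₂ hK⟩]

/-- The labelled end points determine the child: a child never contains the end point that was cut
off, so `a` is `z₀` for the first child and `z_d` for the second. -/
theorem ChildAt.eq_of_eq (hK : IsSimplex K.vertexSet) {a b a' b' : EuclideanSpace ℝ (Fin d)}
    (h : ChildAt C K a b) (h' : ChildAt D K a' b') : (a = a' ∧ b = b' ∧ C = D) ∨
      (a' = b ∧ b' = a ∧ ((C = K.child₁ ∧ D = K.child₂) ∨ (C = K.child₂ ∧ D = K.child₁))) := by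
  have key : ∀ {X : TaggedSimplex d} {x y}, ChildAt X K x y →
      (X = K.child₁ ∧ x = K.v 0 ∧ y = K.v d) ∨ (X = K.child₂ ∧ x = K.v d ∧ y = K.v 0) := by
    intro X x y hX
    have hne := v_zero_ne_last hK
    have hx : x ∈ X.vertexSet := hX.vertexSet_eq ▸ Or.inr ⟨hX.left_mem, hX.ne⟩
    have he := hX.edge
    rw [refinementEdge_eq_pair] at he
    rcases hX.isChild with rfl | rfl
    · rw [child₁_vertexSet hK] at hx
      rcases Set.pair_eq_pair_iff.1 he with ⟨h1, h2⟩ | ⟨h1, h2⟩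
      · exact Or.inl ⟨rfl, h1.symm, h2.symm⟩
      · exfalso
        rcases hx with hx | hx
        · exact hK.midpoint_notMem (K.v_mem_vertexSet 0) (K.v_mem_vertexSet d) hne
            (hx ▸ hX.left_mem)
        · exact hx.2 h2.symm
    · rw [child₂_vertexSet hK] at hx
      rcases Set.pair_eq_pair_iff.1 he with ⟨h1, h2⟩ | ⟨h1, h2⟩
      · exfalso
        rcases hx with hx | hx
        · exact hK.midpoint_notMem (K.v_mem_vertexSet d) (K.v_mem_vertexSet 0) hne.symm
            (hx ▸ hX.left_mem)
        · exact hx.2 h1.symm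
      · exact Or.inr ⟨rfl, h2.symm, h1.symm⟩
  rcases key h with ⟨r1, r2, r3⟩ | ⟨r1, r2, r3⟩ <;>
    rcases key h' with ⟨s1, s2, s3⟩ | ⟨s1, s2, s3⟩ <;> simp [r1, r2, r3, s1, s2, s3]

theorem ChildAt.isSimplex (hK : IsSimplex K.vertexSet) {a b : EuclideanSpace ℝ (Fin d)}
    (h : ChildAt C K a b) : IsSimplex C.vertexSet := by
  rw [h.vertexSet_eq]
  exact hK.bisect h.left_mem h.right_mem h.ne

theorem IsChild.isSimplex (hK : IsSimplex K.vertexSet) (h : C.IsChild K) :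
    IsSimplex C.vertexSet := by
  obtain ⟨a, b, h⟩ := h.exists_childAt hK
  exact h.isSimplex hK

theorem IsChild.carrier_subset (hK : IsSimplex K.vertexSet) (h : C.IsChild K) :
    C.carrier ⊆ K.carrier := by
  obtain ⟨a, b, h⟩ := h.exists_childAt hK
  rw [carrier, h.vertexSet_eq]
  exact hK.bisect_subset h.left_mem h.right_mem h.ne

theorem exists_child_mem (hK : IsSimplex K.vertexSet) (hz : z ∈ K.carrier) :
    ∃ C : TaggedSimplex d, C.IsChild K ∧ z ∈ C.carrier := by
  rw [carrier, ← hK.union_bisect (K.v_mem_vertexSet 0) (K.v_mem_vertexSet d)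
    (v_zero_ne_last hK), ← child₁_vertexSet hK, ← child₂_vertexSet hK] at hz
  rcases hz with hz | hz
  exacts [⟨_, Or.inl rfl, hz⟩, ⟨_, Or.inr rfl, hz⟩]

/-- The position at which two reflected neighbours differ is the one opposite to the common
face. -/
theorem Agree.face_eq (hK : IsSimplex K.vertexSet) (hL : IsSimplex L.vertexSet)
    (hne : K.vertexSet ≠ L.vertexSet) {i : ℕ} (h : K.Agree L i) (hKF : K.HasFace F)
    (hLF : L.HasFace F) : F = K.vertexSet \ {K.v i} := by
  have h1 : K.v i ∉ L.vertexSet := fun hi => hne <| hK.eq_of_subset hL fun x hx => by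
    obtain ⟨n, hn, rfl⟩ := mem_vertexSet_iff.1 hx
    rcases eq_or_ne n i with rfl | hni
    · exact hi
    · rw [h.2 n hn hni]; exact L.v_mem_vertexSet n
  obtain ⟨v, hv, rfl⟩ := (hasFace_iff hK).1 hKF
  by_cases hvi : v = K.v i
  · rw [hvi]
  · exact absurd (hLF.subset ⟨K.v_mem_vertexSet i, fun e => hvi e.symm⟩) h1

theorem Agree.symm {i : ℕ} (h : K.Agree L i) : L.Agree K i :=
  ⟨h.1.symm, fun n hn hni => (h.2 n hn hni).symm⟩

/-- The exceptional position is the one opposite to `F`; if a refinement edge survives in `F`, that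
position can be neither 0 nor `d`. -/
theorem Agree.interior_index (hK : IsSimplex K.vertexSet) (hL : IsSimplex L.vertexSet)
    (hne : K.vertexSet ≠ L.vertexSet) {i : ℕ} (hi : i ≤ d) (h : K.Agree L i) (hKF : K.HasFace F)
    (hLF : L.HasFace F) (he : K.refinementEdge ⊆ F ∨ L.refinementEdge ⊆ F) : 0 < i ∧ i < d := by
  have key : ∀ {K : TaggedSimplex d}, F = K.vertexSet \ {K.v i} → K.refinementEdge ⊆ F →
      0 < i ∧ i < d := by
    intro K hF he
    rw [hF, refinementEdge_eq_pair] at he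
    constructor
    · rw [Nat.pos_iff_ne_zero]; rintro rfl
      exact (he (Or.inl rfl)).2 rfl
    · refine lt_of_le_of_ne hi ?_
      rintro rfl
      exact (he (Or.inr rfl)).2 rfl
  rcases he with he | he
  · exact key (h.face_eq hK hL hne hKF hLF) he
  · exact key (h.symm.face_eq hL hK hne.symm hLF hKF) he

theorem eq_or_reflect_vertexSet {K' : TaggedSimplex d} (h : K' = K ∨ K' = K.reflect) :
    K'.vertexSet = K.vertexSet := by
  rcases h with rfl | rfl
  exacts [rfl, K.reflect_vertexSet]

theorem eq_or_reflect_refinementEdge {K' : TaggedSimplex d} (h : K' = K ∨ K' = K.reflect) :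
    K'.refinementEdge = K.refinementEdge := by
  rcases h with rfl | rfl
  exacts [rfl, K.reflect_refinementEdge]

theorem eq_or_reflect_isChild {K' : TaggedSimplex d} (h : K' = K ∨ K' = K.reflect) :
    C.IsChild K' ↔ C.IsChild K := by
  rcases h with rfl | rfl
  exacts [Iff.rfl, isChild_reflect]

theorem eq_or_reflect_hasFace {K' : TaggedSimplex d} (h : K' = K ∨ K' = K.reflect)
    (hK : IsSimplex K.vertexSet) : K'.HasFace F ↔ K.HasFace F := by
  rw [hasFace_iff hK, hasFace_iff (by rwa [eq_or_reflect_vertexSet h]), eq_or_reflect_vertexSet h]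

theorem IsReflected.refinementEdge_eq (hK : IsSimplex K.vertexSet) (hL : IsSimplex L.vertexSet)
    (hne : K.vertexSet ≠ L.vertexSet) (h : K.IsReflected L) (hKF : K.HasFace F)
    (hLF : L.HasFace F) (he : K.refinementEdge ⊆ F ∨ L.refinementEdge ⊆ F) :
    K.refinementEdge = L.refinementEdge := by
  obtain ⟨K', hK', i, hi, hA⟩ := h.exists_agree
  rw [← eq_or_reflect_refinementEdge hK'] at he ⊢
  rw [← eq_or_reflect_hasFace hK' hK] at hKF
  rw [← eq_or_reflect_vertexSet hK'] at hK hne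
  obtain ⟨h0, hd⟩ := hA.interior_index hK hL hne hi hKF hLF he
  exact hA.refinementEdge_eq h0 hd

/-- A child adjacent to a face of `K` that does not contain the refinement edge. -/
theorem IsChild.eq_of_hasFace (hK : IsSimplex K.vertexSet) (h : C.IsChild K) {i : ℕ} (hi : i ≤ d)
    (hF : F = K.vertexSet \ {K.v i}) (hC : C.HasFace F) :
    (i = 0 ∧ C = K.child₂) ∨ (i = d ∧ C = K.child₁) := by
  have hne := v_zero_ne_last hK
  rcases h with rfl | rfl
  · refine Or.inr ⟨?_, rfl⟩
    by_contra hid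
    have : K.v d ∈ F := hF ▸ ⟨K.v_mem_vertexSet d, fun e => hid (v_inj hK hi le_rfl e.symm)⟩
    have := hC.subset this
    rw [child₁_vertexSet hK] at this
    rcases this with h | h
    · exact hK.midpoint_notMem (K.v_mem_vertexSet 0) (K.v_mem_vertexSet d) hne
        (h ▸ K.v_mem_vertexSet d)
    · exact h.2 rfl
  · refine Or.inl ⟨?_, rfl⟩
    by_contra hid
    have : K.v 0 ∈ F := hF ▸ ⟨K.v_mem_vertexSet 0,
      fun e => hid (v_inj hK hi (Nat.zero_le d) e.symm)⟩
    have := hC.subset this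
    rw [child₂_vertexSet hK] at this
    rcases this with h | h
    · exact hK.midpoint_notMem (K.v_mem_vertexSet d) (K.v_mem_vertexSet 0) hne.symm
        (h ▸ K.v_mem_vertexSet 0)
    · exact h.2 rfl

/-- The children adjacent to the common face of two reflected neighbours are reflected
neighbours. -/
theorem IsReflected.children (hK : IsSimplex K.vertexSet) (hL : IsSimplex L.vertexSet)
    (hne : K.vertexSet ≠ L.vertexSet) (h : K.IsReflected L) (hKF : K.HasFace F)
    (hLF : L.HasFace F) (hC : C.IsChild K) (hD : D.IsChild L)
    (hCF : C.HasFace F) (hDF : D.HasFace F) : C.IsReflected D := by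
  obtain ⟨K', hK', i, hi, hA⟩ := h.exists_agree
  rw [← eq_or_reflect_hasFace hK' hK] at hKF
  rw [← eq_or_reflect_vertexSet hK'] at hK hne
  rw [← eq_or_reflect_isChild hK'] at hC
  have hdim := K.dim_pos
  have hF1 := hA.face_eq hK hL hne hKF hLF
  have hF2 := hA.symm.face_eq hL hK hne.symm hLF hKF
  -- A child still having `F` means that `F` misses an end of the edge, so `i` is 0 or `d`. The same
  -- `i` serves both simplices, hence corresponding children are selected.
  rcases hC.eq_of_hasFace hK hi hF1 hCF with ⟨rfl, rfl⟩ | ⟨rfl, rfl⟩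
  · rcases hD.eq_of_hasFace hL hi hF2 hDF with ⟨-, rfl⟩ | ⟨h, -⟩
    · exact hA.child₂_of_zero.isReflected hdim
    · omega
  · rcases hD.eq_of_hasFace hL hi hF2 hDF with ⟨h, -⟩ | ⟨-, rfl⟩
    · omega
    · exact hA.child₁_of_last.isReflected hdim

end TaggedSimplex

/-! ### Uniform bisection preserves conformity, matching and face-connectedness -/

section UniformRefinement

open TaggedSimplex

variable {d : ℕ} {T T₀ : Finset (TaggedSimplex d)} {K L C D : TaggedSimplex d}
  {F : Set (EuclideanSpace ℝ (Fin d))} {z a b a' b' : EuclideanSpace ℝ (Fin d)}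

theorem IsConformingMesh.isSimplex (hT : IsConformingMesh T) (hK : K ∈ T) :
    IsSimplex K.vertexSet := isSimplex_iff.2 (hT.1 K hK)

/-- The properties of the initial mesh that are inherited by its uniform refinements. -/
structure IsGoodMesh (T : Finset (TaggedSimplex d)) : Prop where
  conf : IsConformingMesh T
  matching : MatchingCondition T
  connected : FaceConnected T

/-- If the refinement edge of `K` belongs to `L`, then it is also the one of `L`. -/
theorem IsGoodMesh.refinementEdge_eq (hT : IsGoodMesh T) (hK : K ∈ T) (hL : L ∈ T)
    (he : K.refinementEdge ⊆ L.vertexSet) : K.refinementEdge = L.refinementEdge := by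
  have hKs := hT.conf.isSimplex hK
  have hG : (K.vertexSet ∩ L.vertexSet).Finite := hKs.finite.inter_of_left _
  have heG : K.refinementEdge ⊆ K.vertexSet ∩ L.vertexSet :=
    subset_inter K.refinementEdge_subset he
  have hGne : (K.vertexSet ∩ L.vertexSet).Nonempty := by
    refine Set.Nonempty.mono heG ?_
    rw [refinementEdge_eq_pair]
    exact ⟨_, Or.inl rfl⟩
  -- Choosing `z` in the relative interior of the common subsimplex makes every face in the chain
  -- through `z` contain all common vertices, hence the edge of `K`. Reflected neighbours across
  -- such a face share their refinement edge, so it propagates along the chain to `L`.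
  obtain ⟨z, hz, hzG⟩ := exists_mem_convexHull_forall_affine hG hGne
  have hchain := hT.connected K hK L hL z
    ⟨convexHull_mono inter_subset_left hz, convexHull_mono inter_subset_right hz⟩
  have key : ∀ M, Relation.ReflTransGen (fun M N : TaggedSimplex d => M ∈ T ∧ N ∈ T ∧
      ∃ F, M.HasFace F ∧ N.HasFace F ∧ z ∈ convexHull ℝ F) K M →
      K.vertexSet ∩ L.vertexSet ⊆ M.vertexSet ∧ M.refinementEdge = K.refinementEdge := by
    intro M hM
    induction hM with
    | refl => exact ⟨inter_subset_left, rfl⟩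
    | @tail M N _ hMN ih =>
      obtain ⟨hM, hN, F, hMF, hNF, hzF⟩ := hMN
      have hGF := (hT.conf.isSimplex hM).subset_of_forall_affine ih.1 hMF.subset hzG hzF
      refine ⟨hGF.trans hNF.subset, ?_⟩
      rcases eq_or_ne M N with rfl | hne
      · exact ih.2
      · have heF : M.refinementEdge ⊆ F := ih.2 ▸ heG.trans hGF
        rw [← ih.2]
        exact (((hT.matching.2 M hM N hN hne F hMF hNF).1 (Or.inl heF)).refinementEdge_eq
          (hT.conf.isSimplex hM) (hT.conf.isSimplex hN) (hT.conf.2 M hM N hN hne).1 hMF hNF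
          (Or.inl heF)).symm
  exact (key L hchain).2.symm

/-- The mesh obtained by bisecting all elements once. -/
noncomputable def bisectAll (T : Finset (TaggedSimplex d)) : Finset (TaggedSimplex d) :=
  T.image child₁ ∪ T.image child₂

theorem mem_bisectAll : C ∈ bisectAll T ↔ ∃ K ∈ T, C.IsChild K := by
  simp only [bisectAll, Finset.mem_union, Finset.mem_image, IsChild]
  constructor
  · rintro (⟨K, hK, rfl⟩ | ⟨K, hK, rfl⟩)
    exacts [⟨K, hK, Or.inl rfl⟩, ⟨K, hK, Or.inr rfl⟩]
  · rintro ⟨K, hK, rfl | rfl⟩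
    exacts [Or.inl ⟨K, hK, rfl⟩, Or.inr ⟨K, hK, rfl⟩]

theorem insert_midpoint_subset_bisectSet (V : Set (EuclideanSpace ℝ (Fin d)))
    (a b : EuclideanSpace ℝ (Fin d)) :
    insert (midpoint ℝ a b) (V \ {a, b}) ⊆ bisectSet V a b ∧
      insert (midpoint ℝ a b) (V \ {a, b}) ⊆ bisectSet V b a := by
  refine ⟨insert_subset_insert fun v hv => ⟨hv.1, fun h => hv.2 (Or.inr h)⟩, ?_⟩
  rw [bisectSet, midpoint_comm b a]
  exact insert_subset_insert fun v hv => ⟨hv.1, fun h => hv.2 (Or.inl h)⟩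

theorem notMem_bisectSet_right {V : Set (EuclideanSpace ℝ (Fin d))} (hV : IsSimplex V)
    (ha : a ∈ V) (hb : b ∈ V) (hab : a ≠ b) : b ∉ bisectSet V a b := by
  rintro (h | h)
  · exact hV.midpoint_notMem ha hb hab (h ▸ hb)
  · exact h.2 rfl

/-- For conformity only two situations matter: the common subsimplex is cut by both elements at the
same edge, or it is cut by neither. -/
theorem IsGoodMesh.edge_mem_iff (hT : IsGoodMesh T) (hK : K ∈ T) (hL : L ∈ T)
    (hCK : ChildAt C K a b) (hDL : ChildAt D L a' b') :
    ((a ∈ K.vertexSet ∩ L.vertexSet ∧ b ∈ K.vertexSet ∩ L.vertexSet) ∧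
      ((a' = a ∧ b' = b) ∨ (a' = b ∧ b' = a))) ∨
    (¬ (a ∈ K.vertexSet ∩ L.vertexSet ∧ b ∈ K.vertexSet ∩ L.vertexSet) ∧
      ¬ (a' ∈ K.vertexSet ∩ L.vertexSet ∧ b' ∈ K.vertexSet ∩ L.vertexSet)) := by
  by_cases h : a ∈ K.vertexSet ∩ L.vertexSet ∧ b ∈ K.vertexSet ∩ L.vertexSet
  · refine Or.inl ⟨h, ?_⟩
    have he : K.refinementEdge ⊆ L.vertexSet := by
      rw [hCK.edge]
      rintro x (rfl | rfl)
      exacts [h.1.2, h.2.2]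
    have := hT.refinementEdge_eq hK hL he
    rw [hCK.edge, hDL.edge] at this
    exact Set.pair_eq_pair_iff.1 this.symm
  · refine Or.inr ⟨h, fun h' => h ?_⟩
    have he : L.refinementEdge ⊆ K.vertexSet := by
      rw [hDL.edge]
      rintro x (rfl | rfl)
      exacts [h'.1.1, h'.2.1]
    have := hT.refinementEdge_eq hL hK he
    rw [hCK.edge, hDL.edge] at this
    rcases Set.pair_eq_pair_iff.1 this with ⟨rfl, rfl⟩ | ⟨rfl, rfl⟩
    exacts [h', h'.symm]

/-- By conformity of `T`, a common point lies in the hull of the common vertices. If that subsimplex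
is cut, it is cut identically from both sides: children at the same end share its half, children at
opposite ends only its bisecting slice. If it is not cut, only old common vertices are involved. -/
theorem IsGoodMesh.inter_subset (hT : IsGoodMesh T) (hK : K ∈ T) (hL : L ∈ T) (hKL : K ≠ L)
    (hCK : ChildAt C K a b) (hDL : ChildAt D L a' b') :
    C.carrier ∩ D.carrier ⊆ convexHull ℝ (C.vertexSet ∩ D.vertexSet) := by
  rintro x ⟨hxC, hxD⟩
  have hKs := hT.conf.isSimplex hK
  have hLs := hT.conf.isSimplex hL
  have hxG : x ∈ convexHull ℝ (K.vertexSet ∩ L.vertexSet) := by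
    rw [← (hT.conf.2 K hK L hL hKL).2]
    exact ⟨hCK.isChild.carrier_subset hKs hxC, hDL.isChild.carrier_subset hLs hxD⟩
  rw [carrier, hCK.vertexSet_eq] at hxC
  rw [carrier, hDL.vertexSet_eq] at hxD
  rw [hCK.vertexSet_eq, hDL.vertexSet_eq]
  have hGK : K.vertexSet ∩ L.vertexSet ⊆ K.vertexSet := inter_subset_left
  have hGL : K.vertexSet ∩ L.vertexSet ⊆ L.vertexSet := inter_subset_right
  rcases hT.edge_mem_iff hK hL hCK hDL with
    ⟨⟨haG, hbG⟩, ⟨rfl, rfl⟩ | ⟨rfl, rfl⟩⟩ | ⟨h1, h2⟩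
  · refine convexHull_mono (subset_inter ?_ ?_) (hKs.mem_bisect_inter_of_subset hCK.left_mem
      hCK.right_mem hCK.ne hGK haG hxC hxG)
    · exact insert_subset_insert (sdiff_subset_sdiff_left hGK)
    · exact insert_subset_insert (sdiff_subset_sdiff_left hGL)
  · have hxG' : x ∈ convexHull ℝ (bisectSet K.vertexSet a' b') := by
      refine convexHull_mono ?_ (hLs.mem_bisect_inter_of_subset hDL.left_mem
        hDL.right_mem hDL.ne hGL hbG hxD hxG)
      exact insert_subset_insert (sdiff_subset_sdiff_left hGK)
    refine convexHull_mono (subset_inter ?_ ?_) (hKs.mem_bisect_both hCK.left_mem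
      hCK.right_mem hCK.ne hGK haG hxC hxG' hxG)
    · exact (insert_midpoint_subset_bisectSet _ _ _).1.trans
        (insert_subset_insert (sdiff_subset_sdiff_left hGK))
    · exact (insert_midpoint_subset_bisectSet _ _ _).2.trans
        (insert_subset_insert (sdiff_subset_sdiff_left hGL))
  · have e1 := hKs.mem_bisect_inter_of_not_subset hCK.left_mem hCK.right_mem hCK.ne hGK h1 hxC hxG
    have e2 := hLs.mem_bisect_inter_of_not_subset hDL.left_mem hDL.right_mem hDL.ne hGL h2 hxD hxG
    have := (hKs.convexHull_inter (inter_subset_right.trans hGK)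
      (inter_subset_right.trans hGK)).subset ⟨e1, e2⟩
    refine convexHull_mono ?_ this
    exact fun y hy => ⟨hy.1.1, hy.2.1⟩

theorem IsGoodMesh.bisectAll_conf (hT : IsGoodMesh T) : IsConformingMesh (bisectAll T) := by
  refine ⟨fun C hC => ?_, fun C hC D hD hCD => ?_⟩
  · obtain ⟨K, hK, hCK⟩ := mem_bisectAll.1 hC
    exact isSimplex_iff.1 (hCK.isSimplex (hT.conf.isSimplex hK))
  obtain ⟨K, hK, hCK⟩ := mem_bisectAll.1 hC
  obtain ⟨L, hL, hDL⟩ := mem_bisectAll.1 hD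
  have hKs := hT.conf.isSimplex hK
  have hLs := hT.conf.isSimplex hL
  obtain ⟨a, b, hCK⟩ := hCK.exists_childAt hKs
  obtain ⟨a', b', hDL⟩ := hDL.exists_childAt hLs
  have hsup : convexHull ℝ (C.vertexSet ∩ D.vertexSet) ⊆ C.carrier ∩ D.carrier :=
    subset_inter (convexHull_mono inter_subset_left) (convexHull_mono inter_subset_right)
  rcases eq_or_ne K L with rfl | hKL
  · rcases hCK.eq_of_eq hKs hDL with ⟨-, -, h⟩ | ⟨rfl, rfl, -⟩
    · exact absurd h hCD
    · constructor
      · intro h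
        refine notMem_bisectSet_right hKs hDL.left_mem hDL.right_mem hDL.ne ?_
        rw [← hDL.vertexSet_eq, ← h, hCK.vertexSet_eq]
        exact Or.inr ⟨hCK.left_mem, hCK.ne⟩
      · refine Subset.antisymm ?_ hsup
        rintro x ⟨hxC, hxD⟩
        rw [carrier, hCK.vertexSet_eq] at hxC
        rw [carrier, hDL.vertexSet_eq] at hxD
        rw [hCK.vertexSet_eq, hDL.vertexSet_eq]
        exact convexHull_mono (subset_inter (insert_midpoint_subset_bisectSet _ _ _).1
          (insert_midpoint_subset_bisectSet _ _ _).2) (hKs.mem_bisect_both hCK.left_mem hCK.right_mem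
          hCK.ne subset_rfl hCK.left_mem hxC hxD
          (hKs.bisect_subset hCK.left_mem hCK.right_mem hCK.ne hxC))
  · refine ⟨fun h => ?_, Subset.antisymm (hT.inter_subset hK hL hKL hCK hDL) hsup⟩
    obtain ⟨hne, hint⟩ := hT.conf.2 K hK L hL hKL
    obtain ⟨v, hv, hvL⟩ : ∃ v ∈ K.vertexSet, v ∉ L.vertexSet := by
      by_contra! hn
      exact hne (hKs.eq_of_subset hLs hn)
    -- Children with equal vertex sets would lie in the intersection of `K` and `L`, where the
    -- coordinate of `v` vanishes, although the vertices of a child span the whole space.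
    have h0 : baryCoord K.vertexSet v = 0 := by
      refine (hCK.isSimplex hKs).affineMap_ext fun w hw => ?_
      have hwG : w ∈ convexHull ℝ (K.vertexSet ∩ L.vertexSet) := by
        rw [← hint]
        exact ⟨hCK.isChild.carrier_subset hKs (subset_convexHull ℝ _ hw),
          hDL.isChild.carrier_subset hLs (subset_convexHull ℝ _ (h ▸ hw))⟩
      exact ((hKs.mem_convexHull_iff inter_subset_left).1 hwG).2 v hv fun h => hvL h.2
    have h1 := hKs.baryCoord_self hv
    rw [h0] at h1
    exact zero_ne_one h1

/-- Two different children containing `z` share a face containing `z`. -/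
theorem TaggedSimplex.ChildAt.exists_sibling_face (hK : IsSimplex K.vertexSet) (hC : ChildAt C K a b)
    (hD : ChildAt D K b a) (hzC : z ∈ C.carrier) (hzD : z ∈ D.carrier) :
    ∃ F, C.HasFace F ∧ D.HasFace F ∧ z ∈ convexHull ℝ F := by
  have hm := hK.midpoint_notMem hC.left_mem hC.right_mem hC.ne
  refine ⟨insert (midpoint ℝ a b) (K.vertexSet \ {a, b}), ?_, ?_, ?_⟩
  · rw [hasFace_iff (hC.isSimplex hK), hC.vertexSet_eq]
    refine ⟨a, Or.inr ⟨hC.left_mem, hC.ne⟩, ?_⟩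
    rw [bisectSet, insert_sdiff_of_notMem, Set.sdiff_sdiff, union_comm]
    · rfl
    · exact fun h => hm (by rw [mem_singleton_iff.1 h]; exact hC.left_mem)
  · rw [hasFace_iff (hD.isSimplex hK), hD.vertexSet_eq]
    refine ⟨b, Or.inr ⟨hC.right_mem, hC.ne.symm⟩, ?_⟩
    rw [bisectSet, insert_sdiff_of_notMem, Set.sdiff_sdiff, midpoint_comm b a]
    · rfl
    · exact fun h => hm (by rw [midpoint_comm, mem_singleton_iff.1 h]; exact hC.right_mem)
  · have hzC' := hzC
    rw [carrier, hC.vertexSet_eq] at hzC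
    rw [carrier, hD.vertexSet_eq] at hzD
    exact hK.mem_bisect_both hC.left_mem hC.right_mem hC.ne subset_rfl hC.left_mem hzC hzD
      (hC.isChild.carrier_subset hK hzC')

theorem TaggedSimplex.ChildAt.hasFace_right (hK : IsSimplex K.vertexSet) (hC : ChildAt C K a b) :
    C.HasFace (K.vertexSet \ {b}) := by
  rw [hasFace_iff (hC.isSimplex hK), hC.vertexSet_eq]
  refine ⟨_, Or.inl rfl, ?_⟩
  rw [bisectSet, insert_sdiff_self_of_notMem]
  exact fun h => hK.midpoint_notMem hC.left_mem hC.right_mem hC.ne h.1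

theorem exists_child_hasFace (hK : IsSimplex K.vertexSet) (hKF : K.HasFace F)
    (he : ¬ K.refinementEdge ⊆ F) : ∃ C : TaggedSimplex d, C.IsChild K ∧ C.HasFace F := by
  obtain ⟨v, hv, rfl⟩ := (hasFace_iff hK).1 hKF
  by_cases h0 : v = K.v 0
  · exact ⟨K.child₂, Or.inr rfl, h0 ▸ (childAt_child₂ hK).hasFace_right hK⟩
  · have hd : v = K.v d := by
      by_contra hd
      refine he ?_
      rw [refinementEdge_eq_pair]
      rintro x (rfl | rfl)
      exacts [⟨K.v_mem_vertexSet _, fun e => h0 e.symm⟩,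
        ⟨K.v_mem_vertexSet _, fun e => hd e.symm⟩]
    exact ⟨K.child₁, Or.inl rfl, hd ▸ (childAt_child₁ hK).hasFace_right hK⟩

/-- If the common face contains the refinement edge, both elements bisect it in the same way, and
the half containing `z` is again common. Otherwise neither element cuts the face, and it survives in
one child of each. -/
theorem IsGoodMesh.exists_children_face (hT : IsGoodMesh T) (hK : K ∈ T) (hL : L ∈ T)
    (hKF : K.HasFace F) (hLF : L.HasFace F) (hz : z ∈ convexHull ℝ F) :
    ∃ C D : TaggedSimplex d, C.IsChild K ∧ D.IsChild L ∧
      ∃ F', C.HasFace F' ∧ D.HasFace F' ∧ z ∈ convexHull ℝ F' := by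
  have hKs := hT.conf.isSimplex hK
  have hLs := hT.conf.isSimplex hL
  by_cases he : K.refinementEdge ⊆ F
  · have heq := hT.refinementEdge_eq hK hL (he.trans hLF.subset)
    -- Here `a` is the edge end with the larger coordinate at `z`, so that `z` lies in the children
    -- containing `a`.
    have key : ∀ a b, a ≠ b → K.refinementEdge = {a, b} →
        baryCoord K.vertexSet b z ≤ baryCoord K.vertexSet a z →
        ∃ C D : TaggedSimplex d, C.IsChild K ∧ D.IsChild L ∧
          ∃ F', C.HasFace F' ∧ D.HasFace F' ∧ z ∈ convexHull ℝ F' := by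
      intro a b hab hKe hle
      obtain ⟨C, hC⟩ := exists_childAt_of_edge hKs hKe
      obtain ⟨D, hD⟩ := exists_childAt_of_edge hLs (heq ▸ hKe)
      refine ⟨C, D, hC.isChild, hD.isChild, bisectSet F a b, ?_, ?_, ?_⟩
      · obtain ⟨v, hv, rfl⟩ := (hasFace_iff hKs).1 hKF
        rw [hasFace_iff (hC.isSimplex hKs), hC.vertexSet_eq]
        have hbv : v ≠ b := fun e => (he (hKe ▸ Or.inr rfl : b ∈ _)).2 e.symm
        refine ⟨v, Or.inr ⟨hv, hbv⟩, ?_⟩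
        rw [bisectSet, bisectSet, insert_sdiff_of_notMem, Set.sdiff_sdiff_comm]
        exact fun h => hKs.midpoint_notMem hC.left_mem hC.right_mem hC.ne (h ▸ hv)
      · obtain ⟨v, hv, rfl⟩ := (hasFace_iff hLs).1 hLF
        rw [hasFace_iff (hD.isSimplex hLs), hD.vertexSet_eq]
        have hbv : v ≠ b := fun e => (he (hKe ▸ Or.inr rfl : b ∈ _)).2 e.symm
        refine ⟨v, Or.inr ⟨hv, hbv⟩, ?_⟩
        rw [bisectSet, bisectSet, insert_sdiff_of_notMem, Set.sdiff_sdiff_comm]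
        exact fun h => hLs.midpoint_notMem hD.left_mem hD.right_mem hD.ne (h ▸ hv)
      · refine hKs.mem_bisect_inter_of_subset hC.left_mem hC.right_mem hC.ne hKF.subset
          (he (hKe ▸ Or.inl rfl)) ?_ hz
        rw [hKs.mem_bisect_iff hC.left_mem hC.right_mem hC.ne]
        exact ⟨hKF.convexHull_subset hz, hle⟩
    have hne := v_zero_ne_last hKs
    rcases le_total (baryCoord K.vertexSet (K.v d) z) (baryCoord K.vertexSet (K.v 0) z) with h | h
    · exact key _ _ hne K.refinementEdge_eq_pair h
    · exact key _ _ hne.symm (K.refinementEdge_eq_pair.trans (pair_comm _ _)) h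
  · have he' : ¬ L.refinementEdge ⊆ F := fun h =>
      he ((hT.refinementEdge_eq hL hK (h.trans hKF.subset)) ▸ h)
    obtain ⟨C, hC, hCF⟩ := exists_child_hasFace hKs hKF he
    obtain ⟨D, hD, hDF⟩ := exists_child_hasFace hLs hLF he'
    exact ⟨C, D, hC, hD, F, hCF, hDF, hz⟩

/-- A chain of parents lifts to a chain of children: each shared face is replaced by a shared face
of suitable children, and siblings are linked through their own common face whenever both contain
`z`. -/
theorem IsGoodMesh.bisectAll_connected (hT : IsGoodMesh T) : FaceConnected (bisectAll T) := by
  intro C₀ hC₀ D₀ hD₀ z hz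
  set R := fun M N : TaggedSimplex d => M ∈ bisectAll T ∧ N ∈ bisectAll T ∧
    ∃ F, M.HasFace F ∧ N.HasFace F ∧ z ∈ convexHull ℝ F with hR
  have hsib : ∀ K ∈ T, ∀ C D : TaggedSimplex d, C.IsChild K → D.IsChild K → z ∈ C.carrier →
      z ∈ D.carrier → Relation.ReflTransGen R C D := by
    intro K hK C D hC hD hzC hzD
    have hKs := hT.conf.isSimplex hK
    obtain ⟨a, b, hC'⟩ := hC.exists_childAt hKs
    obtain ⟨a', b', hD'⟩ := hD.exists_childAt hKs
    rcases hC'.eq_of_eq hKs hD' with ⟨-, -, rfl⟩ | ⟨rfl, rfl, -⟩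
    · exact Relation.ReflTransGen.refl
    · exact Relation.ReflTransGen.single ⟨mem_bisectAll.2 ⟨K, hK, hC⟩,
        mem_bisectAll.2 ⟨K, hK, hD⟩, hC'.exists_sibling_face hKs hD' hzC hzD⟩
  obtain ⟨K, hK, hCK⟩ := mem_bisectAll.1 hC₀
  obtain ⟨L, hL, hDL⟩ := mem_bisectAll.1 hD₀
  have hchain := hT.connected K hK L hL z
    ⟨hCK.carrier_subset (hT.conf.isSimplex hK) hz.1,
      hDL.carrier_subset (hT.conf.isSimplex hL) hz.2⟩
  have key : ∀ M, Relation.ReflTransGen (fun M N : TaggedSimplex d => M ∈ T ∧ N ∈ T ∧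
      ∃ F, M.HasFace F ∧ N.HasFace F ∧ z ∈ convexHull ℝ F) K M →
      ∀ D : TaggedSimplex d, D.IsChild M → z ∈ D.carrier → Relation.ReflTransGen R C₀ D := by
    intro M hM
    induction hM with
    | refl => exact fun D hD hzD => hsib K hK C₀ D hCK hD hz.1 hzD
    | @tail M N _ hMN ih =>
      obtain ⟨hM, hN, F, hMF, hNF, hzF⟩ := hMN
      intro D hD hzD
      obtain ⟨C', D', hC', hD', F', hC'F, hD'F, hzF'⟩ :=
        hT.exists_children_face hM hN hMF hNF hzF
      refine ((ih C' hC' (hC'F.convexHull_subset hzF')).tail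
        ⟨mem_bisectAll.2 ⟨M, hM, hC'⟩, mem_bisectAll.2 ⟨N, hN, hD'⟩, F', hC'F, hD'F, hzF'⟩).trans
        (hsib N hN D' D hD' hD (hD'F.convexHull_subset hzF') hzD)
  exact key L hchain D₀ hDL hz.2

/-- Two simplices of a conforming mesh have a common face as soon as their intersection contains
a nondegenerate face `F`. -/
theorem exists_common_face {V W X : Set (EuclideanSpace ℝ (Fin d))} (hV : IsSimplex V)
    (hW : IsSimplex W) (hVW : V ≠ W) (hX : IsSimplex X)
    {p : EuclideanSpace ℝ (Fin d)} (hp : p ∈ X) (hF : X \ {p} ⊆ convexHull ℝ (V ∩ W)) :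
    ∃ v ∈ V, V ∩ W = V \ {v} := by
  obtain ⟨v, hv, hvW⟩ : ∃ v ∈ V, v ∉ W := by
    by_contra! hn
    exact hVW (hV.eq_of_subset hW hn)
  refine ⟨v, hv, Subset.antisymm (fun x hx => ⟨hx.1, fun e => hvW (e ▸ hx.2)⟩) ?_⟩
  rintro u ⟨hu, huv⟩
  refine ⟨hu, ?_⟩
  by_contra huW
  -- Two vertices of `V` outside `W` would give two non-proportional coordinates vanishing on the
  -- face `X \ {p}`, which spans a hyperplane.
  have key : ∀ w ∈ V, w ∉ W → ∀ y ∈ X \ {p}, baryCoord V w y = 0 := fun w hw hwW y hy =>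
    ((hV.mem_convexHull_iff inter_subset_left).1 (hF hy)).2 w hw fun h => hwW h.2
  exact hV.not_vanish_two hX hp hu hv huv (key u hu huW) (key v hv hvW)

theorem TaggedSimplex.IsChild.type_eq (h : C.IsChild K) : C.type = K.childType := by
  rcases h with rfl | rfl <;> rfl

theorem TaggedSimplex.HasFace.eq_of_notMem (hC : IsSimplex C.vertexSet) (hF : C.HasFace F)
    (ha : a ∈ C.vertexSet) (haF : a ∉ F) : F = C.vertexSet \ {a} := by
  obtain ⟨p, hp, rfl⟩ := (hasFace_iff hC).1 hF
  have : a = p := by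
    by_contra h
    exact haF ⟨ha, h⟩
  rw [this]

/-- With an interior exceptional position the two parents have the same refinement edge, so children
at the same end inherit the agreement. -/
theorem isReflected_of_interior_edge (hK : IsSimplex K.vertexSet) (hL : IsSimplex L.vertexSet)
    {i : ℕ} (h0 : 0 < i) (hd : i < d) (hA : K.Agree L i) (hi : K.v i ∉ L.vertexSet)
    (hC : C.IsChild K) (hD : D.IsChild L) (hCF : C.HasFace F) (hDF : D.HasFace F) :
    C.IsReflected D := by
  have e0 : K.v 0 = L.v 0 := hA.2 0 (by omega) (by omega)
  have ed : K.v d = L.v d := hA.2 d (by omega) (by omega)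
  -- Children at opposite ends share no face: `a` and `K.v i` would be two different vertices of `C`
  -- outside `F`, but a face omits only one vertex.
  have mixed : ∀ a b, a ≠ K.v i → b ≠ K.v i → ChildAt C K a b → ChildAt D L b a → False := by
    intro a b hai hbi hCa hDb
    have h1 : a ∉ F := fun h => by
      have := hDF.subset h
      rw [hDb.vertexSet_eq] at this
      exact notMem_bisectSet_right hL hDb.left_mem hDb.right_mem hDb.ne this
    have h2 : K.v i ∉ F := fun h => by
      have := hDF.subset h
      rw [hDb.vertexSet_eq] at this
      rcases this with h | h
      · rw [midpoint_comm] at h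
        exact hK.midpoint_notMem hCa.left_mem hCa.right_mem hCa.ne (h ▸ K.v_mem_vertexSet i)
      · exact hi h.1
    have ha : a ∈ C.vertexSet := hCa.vertexSet_eq ▸ Or.inr ⟨hCa.left_mem, hCa.ne⟩
    have hvi : K.v i ∈ C.vertexSet :=
      hCa.vertexSet_eq ▸ Or.inr ⟨K.v_mem_vertexSet i, fun e => hbi e.symm⟩
    rw [hCF.eq_of_notMem (hCa.isSimplex hK) ha h1] at h2
    exact h2 ⟨hvi, fun e => hai e.symm⟩
  have n0 : K.v 0 ≠ K.v i := fun e => h0.ne (v_inj hK (by omega) (by omega) e)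
  have nd : K.v d ≠ K.v i := fun e => hd.ne' (v_inj hK (by omega) (by omega) e)
  rcases hC with rfl | rfl <;> rcases hD with rfl | rfl
  · exact (hA.child₁ h0 hd).isReflected (by omega)
  · have := childAt_child₂ hL
    rw [← e0, ← ed] at this
    exact (mixed _ _ n0 nd (childAt_child₁ hK) this).elim
  · have := childAt_child₁ hL
    rw [← e0, ← ed] at this
    exact (mixed _ _ nd n0 (childAt_child₂ hK) this).elim
  · obtain ⟨i', hi', h⟩ := hA.child₂ h0 hd
    exact h.isReflected hi'

/-- A common face of children lies in the intersection of the parents and has full face dimension,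
so the parents share a face. The two clauses of the matching condition for `T` then cover the case
of a cut and of an uncut parental face. -/
theorem IsGoodMesh.isReflected_children (hT : IsGoodMesh T) (hK : K ∈ T) (hL : L ∈ T)
    (hKL : K ≠ L) (hC : C.IsChild K) (hD : D.IsChild L) (hCF : C.HasFace F)
    (hDF : D.HasFace F) : C.IsReflected D := by
  have hKs := hT.conf.isSimplex hK
  have hLs := hT.conf.isSimplex hL
  have hCs := hC.isSimplex hKs
  obtain ⟨hne, hint⟩ := hT.conf.2 K hK L hL hKL
  have hFG : F ⊆ convexHull ℝ (K.vertexSet ∩ L.vertexSet) := fun x hx => by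
    rw [← hint]
    exact ⟨hC.carrier_subset hKs (subset_convexHull ℝ _ (hCF.subset hx)),
      hD.carrier_subset hLs (subset_convexHull ℝ _ (hDF.subset hx))⟩
  obtain ⟨p, hp, hFp⟩ := (hasFace_iff hCs).1 hCF
  obtain ⟨v, hv, hGv⟩ := exists_common_face hKs hLs hne hCs hp (hFp ▸ hFG)
  obtain ⟨w, hw, hGw⟩ := exists_common_face hLs hKs hne.symm hCs hp
    (inter_comm _ _ ▸ hFp ▸ hFG)
  rw [inter_comm] at hGw
  have hKG := (hasFace_iff hKs).2 ⟨v, hv, hGv⟩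
  have hLG := (hasFace_iff hLs).2 ⟨w, hw, hGw⟩
  by_cases he : K.refinementEdge ⊆ K.vertexSet ∩ L.vertexSet ∨
      L.refinementEdge ⊆ K.vertexSet ∩ L.vertexSet
  · obtain ⟨K', hK', i, hi, hA⟩ :=
      ((hT.matching.2 K hK L hL hKL _ hKG hLG).1 he).exists_agree
    rw [← eq_or_reflect_refinementEdge hK', ← eq_or_reflect_vertexSet hK'] at he
    rw [← eq_or_reflect_isChild hK'] at hC
    rw [← eq_or_reflect_hasFace hK' hKs, ← eq_or_reflect_vertexSet hK'] at hKG
    rw [← eq_or_reflect_vertexSet hK'] at hKs hne hLG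
    obtain ⟨h0, hd⟩ := hA.interior_index hKs hLs hne hi hKG hLG he
    have hface := hA.face_eq hKs hLs hne hKG hLG
    refine isReflected_of_interior_edge hKs hLs h0 hd hA (fun h => ?_) hC hD hCF hDF
    have : K'.v i ∈ K'.vertexSet ∩ L.vertexSet := ⟨K'.v_mem_vertexSet i, h⟩
    rw [hface] at this
    exact this.2 rfl
  · have hmain := (hT.matching.2 K hK L hL hKL _ hKG hLG).2 he C D hC hD
    -- The matching condition speaks of the parental face. The vertex of `K` missing from it is an
    -- end of the edge, so the midpoint cannot lie on it, and the child's face `F` must be this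
    -- uncut face itself.
    suffices h : F = K.vertexSet ∩ L.vertexSet by
      rw [← h] at hmain
      exact hmain hCF hDF
    obtain ⟨a, b, hCab⟩ := hC.exists_childAt hKs
    have hv' : v = a ∨ v = b := by
      by_contra! hn
      refine he (Or.inl ?_)
      rw [hCab.edge, hGv]
      rintro x (rfl | rfl)
      exacts [⟨hCab.left_mem, hn.1.symm⟩, ⟨hCab.right_mem, hn.2.symm⟩]
    have hm : midpoint ℝ a b ∉ F := fun hm => by
      have h1 := ((hKs.mem_convexHull_iff inter_subset_left).1 (hFG hm)).2 v hv
        (by rw [hGv]; exact fun h => h.2 rfl)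
      rw [affineMap_midpoint] at h1
      rcases hv' with rfl | rfl
      · rw [hKs.baryCoord_self hv, hKs.baryCoord_of_ne hv hCab.right_mem hCab.ne] at h1
        norm_num at h1
      · rw [hKs.baryCoord_self hv, hKs.baryCoord_of_ne hv hCab.left_mem hCab.ne.symm] at h1
        norm_num at h1
    have hFb : F = K.vertexSet \ {b} := by
      rw [hCF.eq_of_notMem hCs (hCab.vertexSet_eq ▸ Or.inl rfl) hm, hCab.vertexSet_eq, bisectSet,
        insert_sdiff_self_of_notMem]
      exact fun h => hKs.midpoint_notMem hCab.left_mem hCab.right_mem hCab.ne h.1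
    have hsub : F ⊆ K.vertexSet ∩ L.vertexSet :=
      hKs.subset_of_subset_convexHull inter_subset_left (hFb ▸ sdiff_subset) hFG
    have hvb : v = b := by
      by_contra hn
      have : v ∈ F := hFb ▸ ⟨hv, hn⟩
      have := hsub this
      rw [hGv] at this
      exact this.2 rfl
    rw [hFb, hGv, hvb]

/-- Adjacent children of different parents are always reflected neighbours, and this passes to their
own children when the face is not cut. Siblings fall under the second clause only, which is settled
by the explicit computation for their grandchildren. -/
theorem IsGoodMesh.bisectAll_matching (hT : IsGoodMesh T) : MatchingCondition (bisectAll T) := by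
  refine ⟨fun C hC D hD => ?_, fun C hC D hD hCD F hCF hDF => ?_⟩
  · obtain ⟨K, hK, hCK⟩ := mem_bisectAll.1 hC
    obtain ⟨L, hL, hDL⟩ := mem_bisectAll.1 hD
    rw [hCK.type_eq, hDL.type_eq]
    simp only [childType, hT.matching.1 K hK L hL]
  have hconf := hT.bisectAll_conf
  have hCs := hconf.isSimplex hC
  have hDs := hconf.isSimplex hD
  obtain ⟨K, hK, hCK⟩ := mem_bisectAll.1 hC
  obtain ⟨L, hL, hDL⟩ := mem_bisectAll.1 hD
  rcases eq_or_ne K L with rfl | hKL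
  · have hKs := hT.conf.isSimplex hK
    have hdim := K.dim_pos
    -- The face common to siblings omits vertex 0 of each, so it contains neither refinement edge,
    -- and the adjacent grandchild is the second child on both sides.
    have main : C.v 0 ∉ D.vertexSet → D.v 0 ∉ C.vertexSet → C.child₂.IsReflected D.child₂ →
        (C.refinementEdge ⊆ F ∨ D.refinementEdge ⊆ F → C.IsReflected D) ∧
        (¬(C.refinementEdge ⊆ F ∨ D.refinementEdge ⊆ F) → ∀ C' D' : TaggedSimplex d,
          C'.IsChild C → D'.IsChild D → C'.HasFace F → D'.HasFace F → C'.IsReflected D') := by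
      intro h1 h2 h3
      have hC0 : C.v 0 ∉ F := fun h => h1 (hDF.subset h)
      have hD0 : D.v 0 ∉ F := fun h => h2 (hCF.subset h)
      refine ⟨?_, fun _ C' D' hC' hD' hC'F hD'F => ?_⟩
      · rintro (h | h)
        · exact absurd (h (C.refinementEdge_eq_pair ▸ Or.inl rfl)) hC0
        · exact absurd (h (D.refinementEdge_eq_pair ▸ Or.inl rfl)) hD0
      · have eC := hC'.eq_of_hasFace hCs (Nat.zero_le d)
          (hCF.eq_of_notMem hCs (C.v_mem_vertexSet 0) hC0) hC'F
        have eD := hD'.eq_of_hasFace hDs (Nat.zero_le d)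
          (hDF.eq_of_notMem hDs (D.v_mem_vertexSet 0) hD0) hD'F
        rcases eC with ⟨-, rfl⟩ | ⟨h, -⟩
        · rcases eD with ⟨-, rfl⟩ | ⟨h, -⟩
          · exact h3
          · omega
        · omega
    have hne := v_zero_ne_last hKs
    have n1 : K.child₁.v 0 ∉ K.child₂.vertexSet := by
      rw [child₂_vertexSet hKs, child₁_v _ (Nat.zero_le d), if_pos rfl]
      exact notMem_bisectSet_right hKs (K.v_mem_vertexSet _) (K.v_mem_vertexSet _) hne.symm
    have n2 : K.child₂.v 0 ∉ K.child₁.vertexSet := by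
      rw [child₁_vertexSet hKs, child₂_v _ (Nat.zero_le d), if_pos rfl]
      exact notMem_bisectSet_right hKs (K.v_mem_vertexSet _) (K.v_mem_vertexSet _) hne
    rcases hCK with rfl | rfl <;> rcases hDL with rfl | rfl
    · exact absurd rfl hCD
    · exact main n1 n2 K.isReflected_siblings
    · exact main n2 n1 K.isReflected_siblings'
    · exact absurd rfl hCD
  · have hrefl := hT.isReflected_children hK hL hKL hCK hDL hCF hDF
    exact ⟨fun _ => hrefl, fun _ C' D' hC' hD' hC'F hD'F =>
      hrefl.children hCs hDs (hconf.2 C hC D hD hCD).1 hCF hDF hC' hD' hC'F hD'F⟩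

theorem IsGoodMesh.isGoodMesh_bisectAll (hT : IsGoodMesh T) : IsGoodMesh (bisectAll T) :=
  ⟨hT.bisectAll_conf, hT.bisectAll_matching, hT.bisectAll_connected⟩

end UniformRefinement

/-! ### Minimal pairs against uniform meshes and arbitrary conforming refinements -/

section MinimalPairs

open TaggedSimplex

variable {d : ℕ} {T T' T₀ : Finset (TaggedSimplex d)} {K L M N C D : TaggedSimplex d}
  {F : Set (EuclideanSpace ℝ (Fin d))} {x z a b v w : EuclideanSpace ℝ (Fin d)}

theorem IsConformingMesh.eq_of_carrier_subset (hT : IsConformingMesh T) (hK : K ∈ T) (hL : L ∈ T)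
    (h : K.carrier ⊆ L.carrier) : K = L := by
  by_contra hne
  obtain ⟨h1, h2⟩ := hT.2 K hK L hL hne
  have hKs := hT.isSimplex hK
  refine h1 (hKs.eq_of_subset (hT.isSimplex hL) ?_)
  refine (hKs.subset_of_subset_convexHull inter_subset_left subset_rfl ?_).trans
    inter_subset_right
  rw [← h2, inter_eq_left.2 h]
  exact subset_convexHull ℝ _

theorem IsConformingMesh.not_isChild (hT : IsConformingMesh T) (hK : K ∈ T) (hL : L ∈ T) :
    ¬ K.IsChild L := by
  intro h
  have hLs := hT.isSimplex hL
  obtain ⟨a, b, hab⟩ := h.exists_childAt hLs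
  have : K = L := hT.eq_of_carrier_subset hK hL (h.carrier_subset hLs)
  refine notMem_bisectSet_right hLs hab.left_mem hab.right_mem hab.ne ?_
  rw [← hab.vertexSet_eq, this]
  exact hab.right_mem

theorem IsConformingMesh.reflTransGen_bisectAll (hT : IsConformingMesh T) :
    Relation.ReflTransGen BisectStep T (bisectAll T) := by
  have key : ∀ S : Finset (TaggedSimplex d), S ⊆ T →
      Relation.ReflTransGen BisectStep T ((T \ S) ∪ bisectAll S) := by
    intro S
    induction S using Finset.induction_on with
    | empty =>
      intro _
      simp [bisectAll, Relation.ReflTransGen.refl]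
    | insert K S hKS ih =>
      intro hsub
      have hK : K ∈ T := hsub (Finset.mem_insert_self _ _)
      have hS : S ⊆ T := (Finset.subset_insert _ _).trans hsub
      refine (ih hS).tail ⟨K, by simp [hK, hKS], ?_⟩
      -- When elements are bisected one by one, erasing `K` must not delete a child created earlier;
      -- a conforming mesh contains no child of one of its elements.
      have hn : ∀ C, C ∈ bisectAll S → C ≠ K := by
        rintro C hC rfl
        obtain ⟨L, hL, hCL⟩ := mem_bisectAll.1 hC
        exact hT.not_isChild hK (hS hL) hCL
      ext C
      have hC := hn C
      have e : C ∈ bisectAll (insert K S) ↔ (C = K.child₁ ∨ C = K.child₂) ∨ C ∈ bisectAll S := by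
        simp [mem_bisectAll, IsChild]
      simp only [Finset.mem_union, Finset.mem_sdiff, Finset.mem_insert, Finset.mem_erase, e]
      tauto
  simpa using key T subset_rfl

/-- The `n`-th uniform refinement. -/
noncomputable def uniformMesh (T₀ : Finset (TaggedSimplex d)) (n : ℕ) : Finset (TaggedSimplex d) :=
  bisectAll^[n] T₀

theorem uniformMesh_succ (T₀ : Finset (TaggedSimplex d)) (n : ℕ) :
    uniformMesh T₀ (n + 1) = bisectAll (uniformMesh T₀ n) := Function.iterate_succ_apply' _ _ _

theorem IsGoodMesh.isGoodMesh_uniformMesh (hT : IsGoodMesh T₀) (n : ℕ) : IsGoodMesh (uniformMesh T₀ n) := by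
  induction n with
  | zero => exact hT
  | succ n ih => rw [uniformMesh_succ]; exact ih.isGoodMesh_bisectAll

theorem IsGoodMesh.uniformMesh_mem (hT : IsGoodMesh T₀) (n : ℕ) :
    uniformMesh T₀ n ∈ conformingRefinements T₀ := by
  refine ⟨?_, (hT.isGoodMesh_uniformMesh n).conf⟩
  induction n with
  | zero => exact Relation.ReflTransGen.refl
  | succ n ih => rw [uniformMesh_succ]; exact ih.trans (hT.isGoodMesh_uniformMesh n).conf.reflTransGen_bisectAll

theorem InMasterTree.isChild (hK : InMasterTree T₀ K) (h : C.IsChild K) : InMasterTree T₀ C := by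
  rcases h with rfl | rfl
  exacts [.left _ hK, .right _ hK]

theorem InMasterTree.exists_unif (hK : InMasterTree T₀ K) : ∃ n, K ∈ uniformMesh T₀ n := by
  induction hK with
  | root K h => exact ⟨0, h⟩
  | left K _ ih =>
    obtain ⟨n, hn⟩ := ih
    exact ⟨n + 1, by rw [uniformMesh_succ]; exact mem_bisectAll.2 ⟨K, hn, Or.inl rfl⟩⟩
  | right K _ ih =>
    obtain ⟨n, hn⟩ := ih
    exact ⟨n + 1, by rw [uniformMesh_succ]; exact mem_bisectAll.2 ⟨K, hn, Or.inr rfl⟩⟩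

theorem inMasterTree_of_mem_unif {n : ℕ} (h : K ∈ uniformMesh T₀ n) : InMasterTree T₀ K := by
  induction n generalizing K with
  | zero => exact .root _ h
  | succ n ih =>
    rw [uniformMesh_succ] at h
    obtain ⟨L, hL, hKL⟩ := mem_bisectAll.1 h
    exact (ih hL).isChild hKL

theorem InMasterTree.isSimplex (hT : IsConformingMesh T₀) (hK : InMasterTree T₀ K) :
    IsSimplex K.vertexSet := by
  induction hK with
  | root K h => exact hT.isSimplex h
  | left K _ ih => exact IsChild.isSimplex ih (Or.inl rfl)
  | right K _ ih => exact IsChild.isSimplex ih (Or.inr rfl)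

theorem IsGoodMesh.exists_ancestor (hT : IsGoodMesh T₀) {m n : ℕ} (hmn : m ≤ n)
    (hN : N ∈ uniformMesh T₀ n) : ∃ A ∈ uniformMesh T₀ m, N.carrier ⊆ A.carrier := by
  induction n, hmn using Nat.le_induction generalizing N with
  | base => exact ⟨N, hN, subset_rfl⟩
  | succ n _ ih =>
    rw [uniformMesh_succ] at hN
    obtain ⟨L, hL, hNL⟩ := mem_bisectAll.1 hN
    obtain ⟨A, hA, hLA⟩ := ih hL
    exact ⟨A, hA, (hNL.carrier_subset ((hT.isGoodMesh_uniformMesh n).conf.isSimplex hL)).trans hLA⟩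

/-- `K` is the union of elements of `T` generated from `K` by bisections. -/
inductive IsSubdivided (T : Finset (TaggedSimplex d)) : TaggedSimplex d → Prop
  | mem (K : TaggedSimplex d) : K ∈ T → IsSubdivided T K
  | node (K : TaggedSimplex d) : IsSubdivided T K.child₁ → IsSubdivided T K.child₂ →
      IsSubdivided T K

theorem IsSubdivided.step (h : IsSubdivided T K) (hs : BisectStep T T') : IsSubdivided T' K := by
  obtain ⟨M, hM, rfl⟩ := hs
  induction h with
  | mem K hK =>
    rcases eq_or_ne K M with rfl | hne
    · exact .node _ (.mem _ (by simp)) (.mem _ (by simp))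
    · exact .mem _ (by simp [hK, hne])
  | node K _ _ ih1 ih2 => exact .node K ih1 ih2

theorem InMasterTree.eq_or_child (h : InMasterTree {M} K) :
    K = M ∨ InMasterTree {M.child₁} K ∨ InMasterTree {M.child₂} K := by
  induction h with
  | root K h => exact Or.inl (by simpa using h)
  | left K _ ih =>
    rcases ih with rfl | h | h
    · exact Or.inr (Or.inl (.root _ (by simp)))
    · exact Or.inr (Or.inl (.left _ h))
    · exact Or.inr (Or.inr (.left _ h))
  | right K _ ih =>
    rcases ih with rfl | h | h
    · exact Or.inr (Or.inr (.root _ (by simp)))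
    · exact Or.inr (Or.inl (.right _ h))
    · exact Or.inr (Or.inr (.right _ h))

theorem InMasterTree.exists_root (h : InMasterTree T₀ K) : ∃ M ∈ T₀, InMasterTree {M} K := by
  induction h with
  | root K h => exact ⟨K, h, .root _ (by simp)⟩
  | left K _ ih =>
    obtain ⟨M, hM, h⟩ := ih
    exact ⟨M, hM, .left _ h⟩
  | right K _ ih =>
    obtain ⟨M, hM, h⟩ := ih
    exact ⟨M, hM, .right _ h⟩

/-- This dichotomy is invariant under a single bisection: splitting an element above `K` either
passes to a child still above `K` or, if the element is `K` itself, starts its subdivision. -/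
theorem InMasterTree.exists_ancestor_or_isSubdivided (hK : InMasterTree T₀ K)
    (h : Relation.ReflTransGen BisectStep T₀ T) :
    (∃ M ∈ T, InMasterTree {M} K) ∨ IsSubdivided T K := by
  induction h with
  | refl => exact Or.inl hK.exists_root
  | tail _ hstep ih =>
    rcases ih with ⟨M, hM, hMK⟩ | h
    · obtain ⟨A, hA, rfl⟩ := hstep
      rcases eq_or_ne M A with rfl | hne
      · rcases hMK.eq_or_child with rfl | h | h
        · exact Or.inr (.node _ (.mem _ (by simp)) (.mem _ (by simp)))
        · exact Or.inl ⟨_, by simp, h⟩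
        · exact Or.inl ⟨_, by simp, h⟩
      · exact Or.inl ⟨M, by simp [hM, hne], hMK⟩
    · exact Or.inr (h.step hstep)

theorem InMasterTree.carrier_subset (hM : IsSimplex M.vertexSet) (h : InMasterTree {M} K) :
    IsSimplex K.vertexSet ∧ K.carrier ⊆ M.carrier := by
  induction h with
  | root K h => rw [Finset.mem_singleton.1 h]; exact ⟨hM, subset_rfl⟩
  | left K _ ih => exact ⟨IsChild.isSimplex ih.1 (Or.inl rfl),
      (IsChild.carrier_subset ih.1 (Or.inl rfl)).trans ih.2⟩
  | right K _ ih => exact ⟨IsChild.isSimplex ih.1 (Or.inr rfl),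
      (IsChild.carrier_subset ih.1 (Or.inr rfl)).trans ih.2⟩

/-- Bisection never removes a vertex: each vertex survives in one of the children. -/
theorem IsSubdivided.exists_mem_vertexSet (hK : IsSimplex K.vertexSet) (h : IsSubdivided T K)
    (hv : v ∈ K.vertexSet) : ∃ M ∈ T, v ∈ M.vertexSet := by
  induction h with
  | mem K h => exact ⟨K, h, hv⟩
  | node K _ _ ih1 ih2 =>
    by_cases hvd : v = K.v d
    · refine ih2 (IsChild.isSimplex hK (Or.inr rfl)) ?_
      rw [child₂_vertexSet hK]
      exact Or.inr ⟨hv, fun e => v_zero_ne_last hK (e.symm.trans hvd)⟩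
    · refine ih1 (IsChild.isSimplex hK (Or.inl rfl)) ?_
      rw [child₁_vertexSet hK]
      exact Or.inr ⟨hv, hvd⟩

/-- An element with a face of a conforming mesh in its intersection with another one. -/
theorem IsConformingMesh.hasFace_of_subset (hT : IsConformingMesh T) (hM : M ∈ T) (hN : N ∈ T)
    (hNF : N.HasFace F) (hFM : F ⊆ M.carrier) : M.HasFace F := by
  rcases eq_or_ne M N with rfl | hne
  · exact hNF
  have hMs := hT.isSimplex hM
  have hNs := hT.isSimplex hN
  obtain ⟨h1, h2⟩ := hT.2 M hM N hN hne
  have hFG : F ⊆ convexHull ℝ (M.vertexSet ∩ N.vertexSet) := fun y hy => by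
    rw [← h2]
    exact ⟨hFM hy, subset_convexHull ℝ _ (hNF.subset hy)⟩
  obtain ⟨p, hp, hFp⟩ := (hasFace_iff hNs).1 hNF
  obtain ⟨v, hv, hGv⟩ := exists_common_face hMs hNs h1 hNs hp (hFp ▸ hFG)
  have hsub := hNs.subset_of_subset_convexHull inter_subset_right hNF.subset hFG
  refine (hasFace_iff hMs).2 ⟨v, hv, ?_⟩
  rw [← hGv]
  refine hsub.antisymm fun y hy => ?_
  rw [hFp]
  refine ⟨hy.2, fun e => h1 ?_⟩
  refine (hNs.eq_of_subset hMs fun q hq => ?_).symm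
  by_cases hqp : q = p
  · rw [hqp, ← mem_singleton_iff.1 e]; exact hy.1
  · exact (hsub (hFp ▸ ⟨hq, hqp⟩ : q ∈ F)).1

/-- An element of `T` containing `K` also contains `F`, and conformity makes `F` one of its faces.
The alternative, that `T` properly subdivides `K`, is impossible: it would create a vertex inside
`F`, which is a face of `T`. -/
theorem IsGoodMesh.carrier_subset_facePair (hT₀ : IsGoodMesh T₀) (hK : InMasterTree T₀ K)
    (hKF : K.HasFace F) (he : K.refinementEdge ⊆ F) (hT : T ∈ conformingRefinements T₀)
    (hF : IsMeshFace T F) : K.carrier ⊆ facePair T F := by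
  obtain ⟨N, hN, hNF⟩ := hF
  have hKs := hK.isSimplex hT₀.conf
  rcases hK.exists_ancestor_or_isSubdivided hT.1 with ⟨M, hM, hMK⟩ | h
  · have hsub := (hMK.carrier_subset (hT.2.isSimplex hM)).2
    have hMF := hT.2.hasFace_of_subset hM hN hNF
      (((subset_convexHull ℝ F).trans hKF.convexHull_subset).trans hsub)
    exact fun y hy => ⟨M, hM, hMF, hsub hy⟩
  · cases h with
    | mem _ h => exact fun y hy => ⟨K, h, hKF, hy⟩
    | node _ h1 _ =>
      exfalso
      have hc := childAt_child₁ hKs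
      -- The midpoint of the edge is a vertex of the first child, hence of some element of `T`. As
      -- it lies on the face `F` of `N`, conformity would force it into `F`, a set of vertices of
      -- `K`.
      obtain ⟨M, hM, hmM⟩ := h1.exists_mem_vertexSet (hc.isSimplex hKs)
        (v := midpoint ℝ (K.v 0) (K.v d)) (hc.vertexSet_eq ▸ Or.inl rfl)
      rw [refinementEdge_eq_pair] at he
      have hmF : midpoint ℝ (K.v 0) (K.v d) ∈ convexHull ℝ F :=
        (convex_convexHull ℝ F).midpoint_mem (subset_convexHull ℝ F (he (Or.inl rfl)))
          (subset_convexHull ℝ F (he (Or.inr rfl)))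
      have hmN : midpoint ℝ (K.v 0) (K.v d) ∈ N.vertexSet := by
        rcases eq_or_ne M N with rfl | hne
        · exact hmM
        · have : midpoint ℝ (K.v 0) (K.v d) ∈ M.carrier ∩ N.carrier :=
            ⟨subset_convexHull ℝ _ hmM, hNF.convexHull_subset hmF⟩
          rw [(hT.2.2 M hM N hN hne).2] at this
          exact ((hT.2.isSimplex hM).mem_of_mem_convexHull inter_subset_left hmM this).2
      have := (hT.2.isSimplex hN).mem_of_mem_convexHull hNF.subset hmN hmF
      exact hKs.midpoint_notMem (K.v_mem_vertexSet 0) (K.v_mem_vertexSet d) (v_zero_ne_last hKs)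
        (hKF.subset this)

/-- A simplex whose refinement edge lies in `F` is part of the minimal pair of `F`. -/
theorem IsGoodMesh.carrier_subset_minimalPair (hT₀ : IsGoodMesh T₀) (hK : InMasterTree T₀ K)
    (hKF : K.HasFace F) (he : K.refinementEdge ⊆ F) : K.carrier ⊆ minimalPair T₀ F :=
  fun _ hy _ hT hF => hT₀.carrier_subset_facePair hK hKF he hT hF hy

theorem baryCoord_face_eq_zero (hK : IsSimplex K.vertexSet) (hv : v ∈ K.vertexSet)
    (hF : F = K.vertexSet \ {v}) : ∀ y ∈ F, baryCoord K.vertexSet v y = 0 := by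
  intro y hy
  rw [hF] at hy
  exact hK.baryCoord_of_ne hv hy.1 fun e => hy.2 e.symm

theorem IsConformingMesh.baryCoord_neg (hT : IsConformingMesh T) (hK : K ∈ T) (hL : L ∈ T)
    (hKL : K ≠ L) (hv : v ∈ K.vertexSet) (hKF : F = K.vertexSet \ {v}) (hw : w ∈ L.vertexSet)
    (hLF : F = L.vertexSet \ {w}) : baryCoord K.vertexSet v w < 0 :=
  (hT.isSimplex hK).baryCoord_opposite_neg (hT.isSimplex hL) (hT.2 K hK L hL hKL).1
    (hT.2 K hK L hL hKL).2 ((hasFace_iff (hT.isSimplex hK)).2 ⟨v, hv, hKF⟩ : K.HasFace F).nonempty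
    hv hw hKF hLF

/-- On `L`, the coordinate of `v` is a negative multiple of the coordinate of the vertex of `L`
opposite `F`, so it is nonnegative only on `F`. -/
theorem IsConformingMesh.mem_face_of_baryCoord_nonneg (hT : IsConformingMesh T) (hK : K ∈ T)
    (hL : L ∈ T) (hKL : K ≠ L) (hv : v ∈ K.vertexSet) (hKF : F = K.vertexSet \ {v})
    (hLF : L.HasFace F) (hx : x ∈ L.carrier) (h0 : 0 ≤ baryCoord K.vertexSet v x) :
    x ∈ convexHull ℝ F := by
  have hLs := hT.isSimplex hL
  obtain ⟨w, hw, hFw⟩ := (hasFace_iff hLs).1 hLF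
  have hneg := hT.baryCoord_neg hK hL hKL hv hKF hw hFw
  have h1 := hLs.eq_mul_baryCoord hw (f := baryCoord K.vertexSet v) (fun y hy =>
    baryCoord_face_eq_zero (hT.isSimplex hK) hv hKF y (hFw ▸ hy)) x
  rw [hFw, hLs.mem_face_iff hw]
  refine ⟨hx, ?_⟩
  have h2 := hLs.mem_convexHull_self_iff.1 hx w hw
  rw [h1] at h0
  nlinarith

/-- At most two elements share a face. -/
theorem IsConformingMesh.eq_of_three (hT : IsConformingMesh T) (hK : K ∈ T) (hL : L ∈ T)
    (hM : M ∈ T) (hKF : K.HasFace F) (hLF : L.HasFace F) (hMF : M.HasFace F) (hKL : K ≠ L)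
    (hKM : K ≠ M) : L = M := by
  by_contra hLM
  obtain ⟨v, hv, hFv⟩ := (hasFace_iff (hT.isSimplex hK)).1 hKF
  obtain ⟨w, hw, hFw⟩ := (hasFace_iff (hT.isSimplex hL)).1 hLF
  obtain ⟨m, hm, hFm⟩ := (hasFace_iff (hT.isSimplex hM)).1 hMF
  have h1 := hT.baryCoord_neg hK hL hKL hv hFv hw hFw
  have h2 := hT.baryCoord_neg hK hM hKM hv hFv hm hFm
  have h3 := hT.baryCoord_neg hL hM hLM hw hFw hm hFm
  -- The product rule for coordinates vanishing on `F` makes the value at `m` a product of two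
  -- negative numbers, against `h2`: three elements cannot lie pairwise on opposite sides.
  have h4 := (hT.isSimplex hL).eq_mul_baryCoord hw (f := baryCoord K.vertexSet v) (fun y hy =>
    baryCoord_face_eq_zero (hT.isSimplex hK) hv hFv y (hFw ▸ hy)) m
  nlinarith

/-- On the side of `K`, the minimal pair of a face of `K` is contained in `K`. -/
theorem IsGoodMesh.mem_carrier_of_mem_minimalPair (hT₀ : IsGoodMesh T₀) (hK : InMasterTree T₀ K)
    (hv : v ∈ K.vertexSet) (hF : F = K.vertexSet \ {v}) (hx : x ∈ minimalPair T₀ F)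
    (h0 : 0 ≤ baryCoord K.vertexSet v x) : x ∈ K.carrier := by
  obtain ⟨n, hn⟩ := hK.exists_unif
  have hconf := (hT₀.isGoodMesh_uniformMesh n).conf
  have hKF : K.HasFace F := (hasFace_iff (hK.isSimplex hT₀.conf)).2 ⟨v, hv, hF⟩
  obtain ⟨N, hN, hNF, hxN⟩ := hx _ (hT₀.uniformMesh_mem n) ⟨K, hn, hKF⟩
  rcases eq_or_ne K N with rfl | hne
  · exact hxN
  · exact hKF.convexHull_subset
      (hconf.mem_face_of_baryCoord_nonneg hn hN hne hv hF hNF hxN h0)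

end MinimalPairs

/-! ### Monotonicity, one-sided localisation and essential disjointness of minimal pairs -/

section MinimalPairSpaces

open TaggedSimplex

variable {d : ℕ} {T T' T₀ : Finset (TaggedSimplex d)} {K L M N C D : TaggedSimplex d}
  {F F' : Set (EuclideanSpace ℝ (Fin d))} {x z a b v w : EuclideanSpace ℝ (Fin d)}

/-- Refinements of the other elements at a face `F` containing the refinement edge of `K`. -/
theorem IsGoodMesh.exists_ancestor_hasFace (hT₀ : IsGoodMesh T₀) {m n : ℕ} (hnm : n ≤ m)
    (hK : K ∈ uniformMesh T₀ n) (hKF : K.HasFace F) (he : K.refinementEdge ⊆ F)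
    (hN : N ∈ uniformMesh T₀ m) (hNF : N.HasFace F') (hsub : F' ⊆ convexHull ℝ F) :
    ∃ A ∈ uniformMesh T₀ n, N.carrier ⊆ A.carrier ∧ A.HasFace F ∧ A.carrier ⊆ minimalPair T₀ F := by
  have hconf := (hT₀.isGoodMesh_uniformMesh n).conf
  have hKs := hconf.isSimplex hK
  have hNs := (hT₀.isGoodMesh_uniformMesh m).conf.isSimplex hN
  obtain ⟨A, hA, hNA⟩ := hT₀.exists_ancestor hnm hN
  have hAs := hconf.isSimplex hA
  have main : A.HasFace F := by
    rcases eq_or_ne A K with rfl | hne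
    · exact hKF
    refine hconf.hasFace_of_subset hA hK hKF ?_
    obtain ⟨h1, h2⟩ := hconf.2 K hK A hA hne.symm
    have hFG : F' ⊆ convexHull ℝ (K.vertexSet ∩ A.vertexSet) := fun y hy => by
      rw [← h2]
      exact ⟨hKF.convexHull_subset (hsub hy),
        hNA (subset_convexHull ℝ _ (hNF.subset hy))⟩
    obtain ⟨p, hp, rfl⟩ := (hasFace_iff hNs).1 hNF
    obtain ⟨u, hu, hGu⟩ := exists_common_face hKs hAs h1 hNs hp hFG
    obtain ⟨v, hv, rfl⟩ := (hasFace_iff hKs).1 hKF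
    -- The face `F'` lies in the two faces of `K` opposite to `u` and `v`, and so cannot be
    -- nondegenerate unless they coincide.
    have huv : u = v := by
      by_contra huv
      refine hKs.not_vanish_two hNs hp hu hv huv (fun y hy => ?_) fun y hy => ?_
      · exact ((hKs.mem_face_iff hu).1 (hGu ▸ hFG hy)).2
      · exact ((hKs.mem_face_iff hv).1 (hsub hy)).2
    rw [← huv, ← hGu]
    exact inter_subset_right.trans (subset_convexHull ℝ _)
  refine ⟨A, hA, hNA, main, hT₀.carrier_subset_minimalPair (inMasterTree_of_mem_unif hA) main ?_⟩
  rw [← (hT₀.isGoodMesh_uniformMesh n).refinementEdge_eq hK hA (he.trans main.subset)]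
  exact he

theorem IsGoodMesh.minimalPair_mono (hT₀ : IsGoodMesh T₀) {m n : ℕ} (hnm : n ≤ m)
    (hK : K ∈ uniformMesh T₀ n) (hKF : K.HasFace F) (he : K.refinementEdge ⊆ F)
    (hF' : IsMeshFace (uniformMesh T₀ m) F') (hsub : F' ⊆ convexHull ℝ F) :
    minimalPair T₀ F' ⊆ minimalPair T₀ F := by
  intro x hx
  obtain ⟨N, hN, hNF, hxN⟩ := hx _ (hT₀.uniformMesh_mem m) hF'
  obtain ⟨A, -, hNA, -, hA⟩ := hT₀.exists_ancestor_hasFace hnm hK hKF he hN hNF hsub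
  exact hA (hNA hxN)

theorem IsPolynomialOn.mono {ℓ : ℕ} {A B : Set (EuclideanSpace ℝ (Fin d))}
    {f : EuclideanSpace ℝ (Fin d) → ℝ} (h : IsPolynomialOn ℓ A f) (hBA : B ⊆ A) :
    IsPolynomialOn ℓ B f := by
  obtain ⟨p, hp, hpA⟩ := h
  exact ⟨p, hp, fun x hx => hpA x (hBA hx)⟩

variable {ℓ : ℕ} {P : EuclideanSpace ℝ (Fin d) → ℝ}

theorem isPolynomialOn_carrier (hP : P ∈ minimalPairSpace T₀ ℓ F)
    (hT : T ∈ conformingRefinements T₀) (hA : K ∈ T) (hAF : K.HasFace F)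
    (hsub : K.carrier ⊆ minimalPair T₀ F) : IsPolynomialOn ℓ K.carrier P :=
  (hP.2 T hT K hA hAF).mono (subset_inter subset_rfl hsub)

theorem mem_minimalPairSpace_of_subset (hP : ContinuousOn P L.carrier)
    (hP' : IsPolynomialOn ℓ L.carrier P) (hsub : minimalPair T₀ F ⊆ L.carrier) :
    P ∈ minimalPairSpace T₀ ℓ F :=
  ⟨hP.mono hsub, fun _ _ _ _ _ => hP'.mono (inter_subset_right.trans hsub)⟩

/-- Restriction to the minimal pair of a subset of the face `F`. -/
theorem IsGoodMesh.minimalPairSpace_mono (hT₀ : IsGoodMesh T₀) {m n : ℕ} (hnm : n ≤ m)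
    (hK : K ∈ uniformMesh T₀ n) (hKF : K.HasFace F) (he : K.refinementEdge ⊆ F)
    (hM : M ∈ uniformMesh T₀ m) (hMF : M.HasFace F') (hsub : F' ⊆ convexHull ℝ F)
    (hP : P ∈ minimalPairSpace T₀ ℓ F) : P ∈ minimalPairSpace T₀ ℓ F' := by
  have hmono := hT₀.minimalPair_mono hnm hK hKF he ⟨M, hM, hMF⟩ hsub
  refine ⟨hP.1.mono hmono, fun T hT L hL hLF => ?_⟩
  have hpoly : ∀ N ∈ uniformMesh T₀ m, N.HasFace F' → IsPolynomialOn ℓ N.carrier P := by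
    intro N hN hNF
    obtain ⟨A, hA, hNA, hAF, hAF'⟩ := hT₀.exists_ancestor_hasFace hnm hK hKF he hN hNF hsub
    exact (isPolynomialOn_carrier hP (hT₀.uniformMesh_mem n) hA hAF hAF').mono hNA
  have hconf := (hT₀.isGoodMesh_uniformMesh m).conf
  have hMs := hconf.isSimplex hM
  have hLs := hT.2.isSimplex hL
  obtain ⟨q, hq, hFq⟩ := (hasFace_iff hMs).1 hMF
  obtain ⟨w, hw, hFw⟩ := (hasFace_iff hLs).1 hLF
  have hfL := hLs.eq_mul_baryCoord hw (f := baryCoord M.vertexSet q) fun y hy =>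
    baryCoord_face_eq_zero hMs hq hFq y (hFw ▸ hy)
  -- The element `L` belongs to an arbitrary conforming refinement. The side of `F'` on which its
  -- opposite vertex lies decides which element of the uniform mesh contains its part of the minimal
  -- pair, and on that element `P` is a polynomial.
  rcases le_total 0 (baryCoord M.vertexSet q w) with h0 | h0
  · refine (hpoly M hM hMF).mono ?_
    rintro x ⟨hxL, hx⟩
    refine hT₀.mem_carrier_of_mem_minimalPair (inMasterTree_of_mem_unif hM) hq hFq hx ?_
    rw [hfL]
    exact mul_nonneg h0 (hLs.mem_convexHull_self_iff.1 hxL w hw)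
  · by_cases hex : ∃ N ∈ uniformMesh T₀ m, N ≠ M ∧ N.HasFace F'
    · obtain ⟨N, hN, hNM, hNF⟩ := hex
      refine (hpoly N hN hNF).mono ?_
      rintro x ⟨hxL, hx⟩
      obtain ⟨N', hN', hN'F, hxN'⟩ := hx _ (hT₀.uniformMesh_mem m) ⟨M, hM, hMF⟩
      by_cases hN'M : N' = M
      · refine hNF.convexHull_subset ?_
        rw [hFq, hMs.mem_face_iff hq]
        rw [hN'M] at hxN'
        refine ⟨hxN', le_antisymm ?_ (hMs.mem_convexHull_self_iff.1 hxN' q hq)⟩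
        rw [hfL]
        exact mul_nonpos_of_nonpos_of_nonneg h0 (hLs.mem_convexHull_self_iff.1 hxL w hw)
      · rw [hconf.eq_of_three hM hN hN' hMF hNF hN'F hNM.symm (Ne.symm hN'M)]
        exact hxN'
    · push Not at hex
      refine (hpoly M hM hMF).mono ?_
      rintro x ⟨hxL, hx⟩
      obtain ⟨N', hN', hN'F, hxN'⟩ := hx _ (hT₀.uniformMesh_mem m) ⟨M, hM, hMF⟩
      by_cases hN'M : N' = M
      · rwa [← hN'M]
      · exact absurd hN'F (hex N' hN' hN'M)

/-- The minimal pair of a face shared by two elements of a conforming set of simplices from the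
master tree. -/
theorem IsGoodMesh.minimalPair_subset_union (hT₀ : IsGoodMesh T₀) (hT : IsConformingMesh T)
    (hM : M ∈ T) (hN : N ∈ T) (hMN : M ≠ N) (hM' : InMasterTree T₀ M) (hN' : InMasterTree T₀ N)
    (hMF : M.HasFace F) (hNF : N.HasFace F) : minimalPair T₀ F ⊆ M.carrier ∪ N.carrier := by
  intro x hx
  have hMs := hT.isSimplex hM
  have hNs := hT.isSimplex hN
  obtain ⟨v, hv, hFv⟩ := (hasFace_iff hMs).1 hMF
  obtain ⟨w, hw, hFw⟩ := (hasFace_iff hNs).1 hNF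
  have hneg := hT.baryCoord_neg hM hN hMN hv hFv hw hFw
  -- The hyperplane through `F` separates `M` from `N`; on each closed side the minimal pair stays
  -- in the adjacent leaf.
  rcases le_or_gt 0 (baryCoord M.vertexSet v x) with h0 | h0
  · exact Or.inl (hT₀.mem_carrier_of_mem_minimalPair hM' hv hFv hx h0)
  · refine Or.inr (hT₀.mem_carrier_of_mem_minimalPair hN' hw hFw hx ?_)
    rw [hNs.eq_mul_baryCoord hw (f := baryCoord M.vertexSet v) fun y hy =>
      baryCoord_face_eq_zero hMs hv hFv y (hFw ▸ hy)] at h0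
    nlinarith

/-- The part of the minimal pair in `M` of a face that does not contain the refinement edge lies
in a child of `M`. -/
theorem IsGoodMesh.minimalPair_inter_subset_child (hT₀ : IsGoodMesh T₀) (hM : InMasterTree T₀ M)
    (hC : ChildAt C M a b) : minimalPair T₀ (M.vertexSet \ {b}) ∩ M.carrier ⊆ C.carrier := by
  rintro x ⟨hx, hxM⟩
  have hMs := hM.isSimplex hT₀.conf
  have hm : midpoint ℝ a b ∈ C.vertexSet := hC.vertexSet_eq ▸ Or.inl rfl
  refine hT₀.mem_carrier_of_mem_minimalPair (hM.isChild hC.isChild) hm ?_ hx ?_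
  · rw [hC.vertexSet_eq, bisectSet, insert_sdiff_self_of_notMem]
    exact fun h => hMs.midpoint_notMem hC.left_mem hC.right_mem hC.ne h.1
  -- The face opposite `b` in `M` is the face opposite the midpoint in `C`, and the midpoint
  -- coordinate is twice that of `b`, hence nonnegative on `M`.
  · rw [hC.vertexSet_eq, hMs.baryCoord_bisect_mid hC.left_mem hC.right_mem hC.ne]
    have := hMs.mem_convexHull_self_iff.1 hxM b hC.right_mem
    positivity

theorem TaggedSimplex.isCompact_carrier (K : TaggedSimplex d) : IsCompact K.carrier :=
  Set.Finite.isCompact_convexHull (𝕜 := ℝ) (Set.finite_range K.vert)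

theorem TaggedSimplex.measurableSet_carrier (K : TaggedSimplex d) : MeasurableSet K.carrier :=
  K.isCompact_carrier.isClosed.measurableSet

theorem isClosed_facePair (T : Finset (TaggedSimplex d)) (F : Set (EuclideanSpace ℝ (Fin d))) :
    IsClosed (facePair T F) := by
  have : facePair T F = ⋃ K ∈ {K : TaggedSimplex d | K ∈ T ∧ K.HasFace F}, K.carrier := by
    ext x
    simp [facePair, and_assoc]
  rw [this]
  exact (T.finite_toSet.subset fun K hK => hK.1).isClosed_biUnion
    fun K _ => K.isCompact_carrier.isClosed

theorem isClosed_minimalPair (T₀ : Finset (TaggedSimplex d))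
    (F : Set (EuclideanSpace ℝ (Fin d))) : IsClosed (minimalPair T₀ F) := by
  have : minimalPair T₀ F = ⋂ T ∈ conformingRefinements T₀, ⋂ _ : IsMeshFace T F,
      facePair T F := by
    ext x
    simp [minimalPair]
  rw [this]
  exact isClosed_biInter fun T _ => isClosed_iInter fun _ => isClosed_facePair T F

theorem measurableSet_minimalPair (T₀ : Finset (TaggedSimplex d))
    (F : Set (EuclideanSpace ℝ (Fin d))) : MeasurableSet (minimalPair T₀ F) :=
  (isClosed_minimalPair T₀ F).measurableSet

theorem IsConformingMesh.volume_inter (hT : IsConformingMesh T) (hK : K ∈ T) (hL : L ∈ T)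
    (hKL : K ≠ L) : volume (K.carrier ∩ L.carrier) = 0 := by
  obtain ⟨h1, h2⟩ := hT.2 K hK L hL hKL
  rw [h2]
  refine (hT.isSimplex hK).measure_convexHull_eq_zero volume inter_subset_left fun h => h1 ?_
  exact (hT.isSimplex hK).eq_of_subset (hT.isSimplex hL) (h ▸ inter_subset_right)

/-- The minimal pairs of two faces in the same boundary hyperplane `g = 0` are essentially
disjoint. -/
theorem IsGoodMesh.volume_minimalPair_inter (hT₀ : IsGoodMesh T₀) (hT : IsConformingMesh T)
    (hM : M ∈ T) (hN : N ∈ T) (hMN : M ≠ N) {m n : ℕ} (hmn : m ≤ n) (hM' : M ∈ uniformMesh T₀ m)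
    (hN' : N ∈ uniformMesh T₀ n) (hMF : M.HasFace F) (hNF : N.HasFace F')
    {g : EuclideanSpace ℝ (Fin d) →ᵃ[ℝ] ℝ} (hg : g ≠ 0) (hgM : ∀ y ∈ M.vertexSet, 0 ≤ g y)
    (hgN : ∀ y ∈ N.vertexSet, 0 ≤ g y) (hgF : ∀ y ∈ F, g y = 0) (hgF' : ∀ y ∈ F', g y = 0) :
    volume (minimalPair T₀ F ∩ minimalPair T₀ F') = 0 := by
  have hconf := (hT₀.isGoodMesh_uniformMesh m).conf
  have hMs := hT.isSimplex hM
  have hNs := hT.isSimplex hN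
  have hsub : minimalPair T₀ F ∩ minimalPair T₀ F' ⊆
      ⋃ A ∈ {A : TaggedSimplex d | A ∈ uniformMesh T₀ m ∧ A.HasFace F},
        ⋃ A' ∈ {A' : TaggedSimplex d | A' ∈ uniformMesh T₀ n ∧ A'.HasFace F'},
          A.carrier ∩ A'.carrier := by
    rintro x ⟨hx, hx'⟩
    obtain ⟨A, hA, hAF, hxA⟩ := hx _ (hT₀.uniformMesh_mem m) ⟨M, hM', hMF⟩
    obtain ⟨A', hA', hA'F, hxA'⟩ := hx' _ (hT₀.uniformMesh_mem n) ⟨N, hN', hNF⟩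
    exact mem_biUnion (show A ∈ {A | _} from ⟨hA, hAF⟩)
      (mem_biUnion (show A' ∈ {A' | _} from ⟨hA', hA'F⟩) ⟨hxA, hxA'⟩)
  refine measure_mono_null hsub ?_
  have hf1 : {A : TaggedSimplex d | A ∈ uniformMesh T₀ m ∧ A.HasFace F}.Countable :=
    ((uniformMesh T₀ m).finite_toSet.subset fun A hA => hA.1).countable
  have hf2 : {A : TaggedSimplex d | A ∈ uniformMesh T₀ n ∧ A.HasFace F'}.Countable :=
    ((uniformMesh T₀ n).finite_toSet.subset fun A hA => hA.1).countable
  rw [measure_biUnion_null_iff hf1]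
  rintro A ⟨hA, hAF⟩
  rw [measure_biUnion_null_iff hf2]
  rintro A' ⟨hA', hA'F⟩
  obtain ⟨A'', hA'', hsub'⟩ := hT₀.exists_ancestor hmn hA'
  -- If `A'` lies below a different element than `A`, the overlap is null by conformity at level
  -- `m`. Otherwise `F'` lies both in `A` and in the hyperplane `g = 0`, hence in the hull of `F`,
  -- and so `M` would have the face `F'`.
  by_cases hAA : A = A''
  · exfalso
    have hAs := hconf.isSimplex hA
    have hFM : F' ⊆ M.carrier := fun y hy => by
      refine hMF.convexHull_subset ?_
      obtain ⟨w, hw, rfl⟩ := (hasFace_iff hAs).1 hAF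
      rw [hAs.mem_face_iff hw]
      refine ⟨hAA ▸ hsub' (subset_convexHull ℝ _ (hA'F.subset hy)), ?_⟩
      have h1 := hAs.eq_mul_baryCoord hw hgF y
      rw [hgF' y hy] at h1
      rcases mul_eq_zero.1 h1.symm with h | h
      · exact absurd (hAs.affineMap_ext (g := 0) fun u hu => by
          by_cases huw : u = w
          · rw [huw, h]; rfl
          · exact hgF u ⟨hu, huw⟩) hg
      · exact h
    have hMF' := hT.hasFace_of_subset hM hN hNF hFM
    obtain ⟨u, hu, hFu⟩ := (hasFace_iff hMs).1 hMF
    obtain ⟨u', hu', hFu'⟩ := (hasFace_iff hMs).1 hMF'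
    obtain ⟨w, hw, hFw⟩ := (hasFace_iff hNs).1 hNF
    have hgu : g u ≠ 0 := fun h => hg (hMs.affineMap_ext (g := 0) fun y hy => by
      by_cases hyu : y = u
      · rw [hyu, h]; rfl
      · exact hgF y (hFu ▸ ⟨hy, hyu⟩))
    have huu : u = u' := by
      by_contra hne
      exact hgu (hgF' u (hFu' ▸ ⟨hu, hne⟩))
    have hFF : F = F' := by rw [hFu, hFu', huu]
    -- Now `F = F'` is shared by `M` and `N`, which therefore lie on opposite sides of `g = 0`,
    -- contrary to `g ≥ 0` on both.
    have hneg := hT.baryCoord_neg hM hN hMN hu hFu hw (hFF.trans hFw)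
    have h1 := hMs.eq_mul_baryCoord hu (f := g) (fun y hy => hgF y (hFu ▸ hy)) w
    have h2 := hgN w hw
    have h3 := lt_of_le_of_ne (hgM u hu) hgu.symm
    nlinarith
  · exact measure_mono_null (inter_subset_inter_right _ hsub')
      (hconf.volume_inter hA hA'' hAA)

/-! ### Leaves of trees -/

theorem inMasterTree_of_mem_leaves {T₀ : Finset (TaggedSimplex d)} {K : TaggedSimplex d}
    (hK : InMasterTree T₀ K) (B : BisectionTree K) : ∀ M ∈ B.leaves, InMasterTree T₀ M := by
  induction B with
  | leaf K => simpa [BisectionTree.leaves] using hK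
  | node K l r ihl ihr =>
    intro M hM
    rcases Finset.mem_union.1 hM with h | h
    exacts [ihl (.left _ hK) M h, ihr (.right _ hK) M h]

theorem exists_unif_of_mem_leaves {K : TaggedSimplex d} {n : ℕ} (hK : K ∈ uniformMesh T₀ n)
    (B : BisectionTree K) : ∀ M ∈ B.leaves, ∃ m, n ≤ m ∧ M ∈ uniformMesh T₀ m := by
  induction B generalizing n with
  | leaf K => simpa [BisectionTree.leaves] using ⟨n, le_rfl, hK⟩
  | node K l r ihl ihr =>
    intro M hM
    have hc : ∀ {C : TaggedSimplex d}, C.IsChild K → C ∈ uniformMesh T₀ (n + 1) := fun h => by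
      rw [uniformMesh_succ]; exact mem_bisectAll.2 ⟨K, hK, h⟩
    rcases Finset.mem_union.1 hM with h | h
    · obtain ⟨m, hm, h⟩ := ihl (hc (Or.inl rfl)) M h
      exact ⟨m, by omega, h⟩
    · obtain ⟨m, hm, h⟩ := ihr (hc (Or.inr rfl)) M h
      exact ⟨m, by omega, h⟩

theorem carrier_subset_biUnion_leaves {K : TaggedSimplex d} (hK : IsSimplex K.vertexSet)
    (B : BisectionTree K) : ∀ x ∈ K.carrier, ∃ M ∈ B.leaves, x ∈ M.carrier := by
  induction B with
  | leaf K => exact fun x hx => ⟨K, by simp [BisectionTree.leaves], hx⟩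
  | node K l r ihl ihr =>
    intro x hx
    obtain ⟨C, hC | hC, hxC⟩ := exists_child_mem hK hx
    · subst hC
      obtain ⟨M, hM, h⟩ := ihl (IsChild.isSimplex hK (Or.inl rfl)) x hxC
      exact ⟨M, Finset.mem_union_left _ hM, h⟩
    · subst hC
      obtain ⟨M, hM, h⟩ := ihr (IsChild.isSimplex hK (Or.inr rfl)) x hxC
      exact ⟨M, Finset.mem_union_right _ hM, h⟩

theorem leaf_carrier_subset {K : TaggedSimplex d} (hK : IsSimplex K.vertexSet)
    (B : BisectionTree K) (hM : M ∈ B.leaves) : M.carrier ⊆ K.carrier :=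
  ((inMasterTree_of_mem_leaves (.root K (Finset.mem_singleton_self K)) B M hM).carrier_subset
    hK).2

/-- A face of a leaf that is not on the boundary of the root is shared by another leaf. -/
theorem exists_other_leaf {K : TaggedSimplex d} (hK : IsSimplex K.vertexSet)
    (B : BisectionTree K) (hB : IsConformingMesh B.leaves) (hM : M ∈ B.leaves)
    (hMF : M.HasFace F) (hint : ∀ v ∈ K.vertexSet, ∃ y ∈ F, baryCoord K.vertexSet v y ≠ 0) :
    ∃ N ∈ B.leaves, N ≠ M ∧ N.HasFace F := by
  have hMs := hB.isSimplex hM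
  obtain ⟨b, hb, hbF⟩ := exists_mem_convexHull_forall_affine hMF.finite hMF.nonempty
  obtain ⟨q, hq, hFq⟩ := (hasFace_iff hMs).1 hMF
  have hMK := leaf_carrier_subset hK B hM
  have hpos : ∀ v ∈ K.vertexSet, 0 < baryCoord K.vertexSet v b := by
    intro v hv
    have h0 := hK.mem_convexHull_self_iff.1 (hMK (hMF.convexHull_subset hb)) v hv
    refine lt_of_le_of_ne h0 fun h => ?_
    obtain ⟨y, hy, hne⟩ := hint v hv
    refine hne (hbF _ (fun y hy => ?_) h.symm y hy)
    exact hK.mem_convexHull_self_iff.1 (hMK (subset_convexHull ℝ _ (hMF.subset hy))) v hv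
  have hqb : baryCoord M.vertexSet q b = 0 := by
    rw [hFq] at hb
    exact ((hMs.mem_face_iff hq).1 hb).2
  -- Points slightly beyond `F`, seen from `q`, remain in `K` because `b` has positive coordinates
  -- there, but leave `M`, so other leaves cover them. These form a finite closed union, which must
  -- then contain `b`.
  have hev : ∀ᶠ s : ℝ in nhdsWithin 0 (Iio 0), AffineMap.lineMap b q s ∈
      ⋃ N ∈ {N : TaggedSimplex d | N ∈ B.leaves ∧ N ≠ M}, N.carrier := by
    have h1 : ∀ v ∈ K.vertexSet, ∀ᶠ s : ℝ in nhdsWithin 0 (Iio 0),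
        0 ≤ baryCoord K.vertexSet v (AffineMap.lineMap b q s) := by
      intro v hv
      have hc : Continuous fun s : ℝ => baryCoord K.vertexSet v (AffineMap.lineMap b q s) :=
        (baryCoord K.vertexSet v).continuous_of_finiteDimensional.comp
          AffineMap.lineMap_continuous
      have := hc.tendsto 0
      simp only [AffineMap.lineMap_apply_zero] at this
      filter_upwards [nhdsWithin_le_nhds (this.eventually (lt_mem_nhds (hpos v hv)))]
        with s hs using hs.le
    filter_upwards [(Filter.eventually_all_finite hK.finite).2 h1, self_mem_nhdsWithin]
      with s hs hs0
    obtain ⟨N, hN, hxN⟩ := carrier_subset_biUnion_leaves hK B _ (hK.mem_convexHull_self_iff.2 hs)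
    refine mem_biUnion (show N ∈ {N | _} from ⟨hN, ?_⟩) hxN
    rintro rfl
    have := hMs.mem_convexHull_self_iff.1 hxN q hq
    rw [AffineMap.apply_lineMap, hqb, hMs.baryCoord_self hq, AffineMap.lineMap_apply] at this
    simp at this
    exact absurd hs0 (not_lt.2 this)
  have hclosed : IsClosed (⋃ N ∈ {N : TaggedSimplex d | N ∈ B.leaves ∧ N ≠ M}, N.carrier) :=
    (B.leaves.finite_toSet.subset fun N hN => hN.1).isClosed_biUnion
      fun N _ => N.isCompact_carrier.isClosed
  have htend : Filter.Tendsto (fun s : ℝ => AffineMap.lineMap b q s) (nhdsWithin 0 (Iio 0))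
      (nhds b) := by
    have := (AffineMap.lineMap_continuous (R := ℝ) (p := b) (q := q)).tendsto 0
    rw [AffineMap.lineMap_apply_zero] at this
    exact this.mono_left nhdsWithin_le_nhds
  have hbmem := hclosed.mem_of_tendsto htend hev
  simp only [mem_iUnion] at hbmem
  obtain ⟨N, ⟨hN, hNM⟩, hbN⟩ := hbmem
  refine ⟨N, hN, hNM, hB.hasFace_of_subset hN hM hMF ?_⟩
  have hbG : b ∈ convexHull ℝ (M.vertexSet ∩ N.vertexSet) := by
    rw [← (hB.2 M hM N hN hNM.symm).2]
    exact ⟨hMF.convexHull_subset hb, hbN⟩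
  exact (hMs.subset_of_forall_affine hMF.subset inter_subset_left hbF hbG).trans
    (inter_subset_right.trans (subset_convexHull ℝ _))

end MinimalPairSpaces

/-! ### Counting minimal pairs over the faces of the leaves -/

section Counting

open TaggedSimplex

variable {d : ℕ} {T T' T₀ : Finset (TaggedSimplex d)} {K L M N C D : TaggedSimplex d}
  {F F' : Set (EuclideanSpace ℝ (Fin d))} {x z a b v w : EuclideanSpace ℝ (Fin d)}
  {ν : Measure (EuclideanSpace ℝ (Fin d))}

theorem hasFace_face (K : TaggedSimplex d) (i : Fin (d + 1)) : K.HasFace (K.face i) := ⟨i, rfl⟩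

theorem face_injective (hK : IsSimplex K.vertexSet) : Function.Injective K.face := by
  intro i j h
  rw [face_eq hK, face_eq hK] at h
  by_contra hij
  have : K.vert i ∈ K.vertexSet \ {K.vert j} :=
    ⟨mem_range_self i, fun e => hij ((isSimplex_iff.1 hK).injective e)⟩
  rw [← h] at this
  exact this.2 rfl

theorem ae_disjoint_of_volume (hν : ν ≪ volume) {A B : Set (EuclideanSpace ℝ (Fin d))}
    (h : volume (A ∩ B) = 0) : AEDisjoint ν A B := hν h

theorem IsGoodMesh.conf_children (hT₀ : IsGoodMesh T₀) (hK : InMasterTree T₀ K) :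
    volume (K.child₁.carrier ∩ K.child₂.carrier) = 0 := by
  obtain ⟨n, hn⟩ := hK.exists_unif
  have hc := (hT₀.isGoodMesh_uniformMesh (n + 1)).conf
  have hKs := hK.isSimplex hT₀.conf
  have h : ∀ {C : TaggedSimplex d}, C.IsChild K → C ∈ uniformMesh T₀ (n + 1) := fun h => by
    rw [uniformMesh_succ]; exact mem_bisectAll.2 ⟨K, hn, h⟩
  refine hc.volume_inter (h (Or.inl rfl)) (h (Or.inr rfl)) fun e => v_zero_ne_last hKs ?_
  have e' := congrArg (fun C : TaggedSimplex d => C.v 0) e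
  simpa [child₁_v _ (Nat.zero_le d), child₂_v _ (Nat.zero_le d)] using e'

/-- The trivial bound would have `d + 1` terms ν(K). One is saved because the faces opposite `z_0`
and `z_d` see only one child each, and the two children overlap in a null set. -/
theorem IsGoodMesh.sum_minimalPair_inter_le (hT₀ : IsGoodMesh T₀) (hK : InMasterTree T₀ K)
    (hν : ν ≪ volume) :
    ∑ i, ν (minimalPair T₀ (K.face i) ∩ K.carrier) ≤ d * ν K.carrier := by
  have hKs := hK.isSimplex hT₀.conf
  have hdim := K.dim_pos
  have h0l : (0 : Fin (d + 1)) ≠ Fin.last d := fun h => hdim.ne (congrArg Fin.val h)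
  have h0 : minimalPair T₀ (K.face 0) ∩ K.carrier ⊆ K.child₂.carrier := by
    rw [face_eq hKs, vert_zero_eq_v]
    exact hT₀.minimalPair_inter_subset_child hK (childAt_child₂ hKs)
  have hl : minimalPair T₀ (K.face (Fin.last d)) ∩ K.carrier ⊆ K.child₁.carrier := by
    rw [face_eq hKs, vert_last_eq_v]
    exact hT₀.minimalPair_inter_subset_child hK (childAt_child₁ hKs)
  have hch : ν K.child₁.carrier + ν K.child₂.carrier ≤ ν K.carrier := by
    rw [← measure_union₀ K.child₂.measurableSet_carrier.nullMeasurableSet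
      (ae_disjoint_of_volume hν (hT₀.conf_children hK))]
    exact measure_mono (union_subset (IsChild.carrier_subset hKs (Or.inl rfl))
      (IsChild.carrier_subset hKs (Or.inr rfl)))
  rw [← Finset.add_sum_erase _ _ (Finset.mem_univ (0 : Fin (d + 1))),
    ← Finset.add_sum_erase _ _ (Finset.mem_erase.2 ⟨h0l.symm, Finset.mem_univ _⟩), ← add_assoc]
  have hrest : ∑ i ∈ (Finset.univ.erase (0 : Fin (d + 1))).erase (Fin.last d),
      ν (minimalPair T₀ (K.face i) ∩ K.carrier) ≤ (d - 1 : ℕ) * ν K.carrier := by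
    refine (Finset.sum_le_card_nsmul _ _ (ν K.carrier) fun i _ =>
      measure_mono inter_subset_right).trans ?_
    rw [Finset.card_erase_of_mem (Finset.mem_erase.2 ⟨h0l.symm, Finset.mem_univ _⟩),
      Finset.card_erase_of_mem (Finset.mem_univ _), Finset.card_univ, Fintype.card_fin,
      nsmul_eq_mul]
    exact le_of_eq (by norm_num)
  calc _ ≤ ν K.carrier + (d - 1 : ℕ) * ν K.carrier := by
        refine add_le_add ?_ hrest
        rw [add_comm]
        exact (add_le_add (measure_mono hl) (measure_mono h0)).trans hch
    _ = d * ν K.carrier := by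
        obtain ⟨e, rfl⟩ : ∃ e, d = e + 1 := ⟨d - 1, by omega⟩
        push_cast [Nat.add_sub_cancel]
        ring

/-- `F` lies in the boundary face of `K` opposite to the `j`-th vertex. -/
def LiesInFace (K : TaggedSimplex d) (F : Set (EuclideanSpace ℝ (Fin d))) (j : Fin (d + 1)) :
    Prop := ∀ y ∈ F, baryCoord K.vertexSet (K.vert j) y = 0

theorem LiesInFace.subset_convexHull (hK : IsSimplex K.vertexSet) {j : Fin (d + 1)}
    (h : LiesInFace K F j) (hF : F ⊆ K.carrier) : F ⊆ convexHull ℝ (K.face j) := fun y hy => by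
  rw [face_eq hK, hK.mem_face_iff (mem_range_self j)]
  exact ⟨hF hy, h y hy⟩

theorem baryCoord_ne_zero (hK : IsSimplex K.vertexSet) (j : Fin (d + 1)) :
    baryCoord K.vertexSet (K.vert j) ≠ 0 := fun h => by
  have := hK.baryCoord_self (mem_range_self j)
  rw [h] at this
  exact zero_ne_one this

/-- Every face of `K` is a face, containing the refinement edge, of `K` or one of its children. -/
theorem exists_anchor (hd : 2 ≤ d) {n : ℕ} (hT₀ : IsGoodMesh T₀) (hK : K ∈ uniformMesh T₀ n)
    (j : Fin (d + 1)) : ∃ m ≤ n + 1, ∃ A ∈ uniformMesh T₀ m, A.HasFace (K.face j) ∧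
      A.refinementEdge ⊆ K.face j := by
  have hKs := (hT₀.isGoodMesh_uniformMesh n).conf.isSimplex hK
  have hch : ∀ {C : TaggedSimplex d}, C.IsChild K → C ∈ uniformMesh T₀ (n + 1) := fun h => by
    rw [uniformMesh_succ]; exact mem_bisectAll.2 ⟨K, hK, h⟩
  have key : ∀ K' : TaggedSimplex d, (K' = K ∨ K' = K.reflect) →
      ∃ A ∈ uniformMesh T₀ (n + 1), A.HasFace (K.vertexSet \ {K'.v d}) ∧
      A.refinementEdge ⊆ K.vertexSet \ {K'.v d} := by
    intro K' hK'
    have hV := eq_or_reflect_vertexSet hK'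
    rw [← hV] at hKs ⊢
    -- For `d ≥ 2`, the refinement edge of the first child is `z₀ z_{d-1}`, which avoids `z_d`. The
    -- face opposite `z₀` is obtained by applying this to the reflection.
    refine ⟨K'.child₁, hch ((eq_or_reflect_isChild hK').1 (Or.inl rfl)),
      (childAt_child₁ hKs).hasFace_right hKs, ?_⟩
    rw [refinementEdge_eq_pair, child₁_v _ (Nat.zero_le d), child₁_v _ le_rfl, if_pos rfl,
      if_neg (by omega), if_neg (by omega)]
    rintro x (rfl | rfl)
    · exact ⟨K'.v_mem_vertexSet _, v_zero_ne_last hKs⟩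
    · refine ⟨K'.v_mem_vertexSet _, fun e => ?_⟩
      have := v_inj hKs (by omega) le_rfl e
      omega
  rw [face_eq hKs]
  by_cases h0 : j = 0
  · refine ⟨n + 1, le_rfl, ?_⟩
    rw [h0, vert_zero_eq_v, ← reflect_v_last]
    exact key _ (Or.inr rfl)
  by_cases hl : j = Fin.last d
  · refine ⟨n + 1, le_rfl, ?_⟩
    rw [hl, vert_last_eq_v]
    exact key _ (Or.inl rfl)
  · refine ⟨n, by omega, K, hK, (hasFace_iff hKs).2 ⟨_, mem_range_self j, rfl⟩, ?_⟩
    have hinj := (isSimplex_iff.1 hKs).injective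
    rintro x (rfl | rfl)
    · exact ⟨mem_range_self _, fun e => h0 (hinj e).symm⟩
    · exact ⟨mem_range_self _, fun e => hl (hinj e).symm⟩

open Classical in
/-- The pairs of an element and one of its faces that is not in the boundary of `K`. -/
noncomputable def interiorFaces (K : TaggedSimplex d) (T : Finset (TaggedSimplex d)) :
    Finset (TaggedSimplex d × Fin (d + 1)) :=
  (T ×ˢ Finset.univ).filter fun x => ∀ j, ¬ LiesInFace K (x.1.face x.2) j

open Classical in
/-- The pairs of an element and one of its faces in the `j`-th boundary face of `K`. -/
noncomputable def boundaryFaces (K : TaggedSimplex d) (T : Finset (TaggedSimplex d))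
    (j : Fin (d + 1)) : Finset (TaggedSimplex d × Fin (d + 1)) :=
  (T ×ˢ Finset.univ).filter fun x => LiesInFace K (x.1.face x.2) j

theorem mem_interiorFaces {x : TaggedSimplex d × Fin (d + 1)} :
    x ∈ interiorFaces K T ↔ x.1 ∈ T ∧ ∀ j, ¬ LiesInFace K (x.1.face x.2) j := by
  simp [interiorFaces]

theorem mem_boundaryFaces {x : TaggedSimplex d × Fin (d + 1)} {j : Fin (d + 1)} :
    x ∈ boundaryFaces K T j ↔ x.1 ∈ T ∧ LiesInFace K (x.1.face x.2) j := by
  simp [boundaryFaces]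

theorem exists_partner (hK : IsSimplex K.vertexSet) (B : BisectionTree K)
    (hB : IsConformingMesh B.leaves) {x : TaggedSimplex d × Fin (d + 1)}
    (hx : x ∈ interiorFaces K B.leaves) : ∃ y ∈ interiorFaces K B.leaves, y.1 ≠ x.1 ∧
      y.1.face y.2 = x.1.face x.2 := by
  rw [mem_interiorFaces] at hx
  obtain ⟨N, hN, hNM, i, hi⟩ := exists_other_leaf hK B hB hx.1 (hasFace_face x.1 x.2) (by
    rintro v ⟨j, rfl⟩
    have := hx.2 j
    rw [LiesInFace] at this
    push Not at this
    exact this)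
  refine ⟨(N, i), mem_interiorFaces.2 ⟨hN, ?_⟩, hNM, hi.symm⟩
  rw [← hi]
  exact hx.2

/-- Each interior face belongs to a second leaf, and its minimal pair lies in the union of the two.
Passing to the partner is injective, so the partners' contributions are bounded by the same sum once
more. -/
theorem IsGoodMesh.sum_interiorFaces_le (hT₀ : IsGoodMesh T₀) (hK : InMasterTree T₀ K)
    (B : BisectionTree K) (hB : IsConformingMesh B.leaves) :
    ∑ x ∈ interiorFaces K B.leaves, ν (minimalPair T₀ (x.1.face x.2)) ≤
      2 * ∑ x ∈ interiorFaces K B.leaves,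
        ν (minimalPair T₀ (x.1.face x.2) ∩ x.1.carrier) := by
  classical
  have hKs := hK.isSimplex hT₀.conf
  choose! p hp hp1 hpf using fun x hx => exists_partner hKs B hB (x := x) hx
  have hleaf := inMasterTree_of_mem_leaves hK B
  have h1 : ∀ x ∈ interiorFaces K B.leaves, ν (minimalPair T₀ (x.1.face x.2)) ≤
      ν (minimalPair T₀ (x.1.face x.2) ∩ x.1.carrier) +
        ν (minimalPair T₀ ((p x).1.face (p x).2) ∩ (p x).1.carrier) := by
    intro x hx
    have hx' := (mem_interiorFaces.1 hx).1
    have hy' := (mem_interiorFaces.1 (hp x hx)).1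
    have hsub := hT₀.minimalPair_subset_union hB hx' hy' (hp1 x hx).symm (hleaf _ hx')
      (hleaf _ hy') (hasFace_face x.1 x.2) (hpf x hx ▸ hasFace_face (p x).1 (p x).2)
    rw [hpf x hx]
    refine (measure_mono fun z hz => ?_).trans (measure_union_le _ _)
    rcases hsub hz with h | h
    exacts [Or.inl ⟨hz, h⟩, Or.inr ⟨hz, h⟩]
  have hinj : Set.InjOn p (interiorFaces K B.leaves) := by
    intro x hx y hy hxy
    have hx' := (mem_interiorFaces.1 hx).1
    have hy' := (mem_interiorFaces.1 hy).1
    have hq' := (mem_interiorFaces.1 (hp x hx)).1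
    have hF : x.1.face x.2 = y.1.face y.2 := by rw [← hpf x hx, hxy, hpf y hy]
    -- Entries with the same partner share its face, and at most two leaves can have that face.
    have e1 : x.1 = y.1 := hB.eq_of_three hq' hx' hy'
      (hpf x hx ▸ hasFace_face (p x).1 (p x).2) (hasFace_face x.1 x.2)
      (hF ▸ hasFace_face y.1 y.2) (hp1 x hx) (by rw [hxy]; exact hp1 y hy)
    refine Prod.ext e1 (face_injective (hB.isSimplex hx') ?_)
    rw [hF, e1]
  refine (Finset.sum_le_sum h1).trans ?_
  rw [Finset.sum_add_distrib, two_mul]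
  refine add_le_add le_rfl ?_
  rw [← Finset.sum_image (f := fun y : TaggedSimplex d × Fin (d + 1) =>
    ν (minimalPair T₀ (y.1.face y.2) ∩ y.1.carrier)) hinj]
  refine Finset.sum_le_sum_of_subset fun y hy => ?_
  obtain ⟨x, hx, rfl⟩ := Finset.mem_image.1 hy
  exact hp x hx

/-- The minimal pairs of faces in one boundary face of `K` overlap in null sets: two such faces
cannot belong to one nondegenerate leaf, and for different leaves both lie on the same side of the
boundary hyperplane. The set `Z` allows counting only outside `K`. -/
theorem IsGoodMesh.sum_boundaryFaces_le (hT₀ : IsGoodMesh T₀) (hν : ν ≪ volume) {n : ℕ}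
    (hK : K ∈ uniformMesh T₀ n) (B : BisectionTree K) (hB : IsConformingMesh B.leaves)
    (j : Fin (d + 1)) {Z W : Set (EuclideanSpace ℝ (Fin d))} (hZ : MeasurableSet Z)
    (hsub : ∀ x ∈ boundaryFaces K B.leaves j, minimalPair T₀ (x.1.face x.2) ⊆ W) :
    ∑ x ∈ boundaryFaces K B.leaves j, ν (minimalPair T₀ (x.1.face x.2) ∩ Z) ≤ ν (W ∩ Z) := by
  have hKm := inMasterTree_of_mem_unif hK
  have hKs := hKm.isSimplex hT₀.conf
  have hg0 := baryCoord_ne_zero hKs j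
  rw [← measure_biUnion_finset₀]
  · refine measure_mono (iUnion₂_subset fun x hx => ?_)
    exact inter_subset_inter_left _ (hsub x hx)
  · rintro x hx y hy hxy
    rw [Finset.mem_coe, mem_boundaryFaces] at hx hy
    have hx0 := hx.2
    have hy0 := hy.2
    have hxs := hB.isSimplex hx.1
    have hne : x.1 ≠ y.1 := by
      intro e
      have h2 : x.2 ≠ y.2 := fun h => hxy (Prod.ext e h)
      refine hg0 (hxs.affineMap_ext (g := 0) fun u hu => ?_)
      obtain ⟨i, rfl⟩ := hu
      by_cases hi : i = x.2
      · refine hy0 _ ?_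
        rw [← e]
        exact ⟨i, fun h => h2 (hi.symm.trans h), rfl⟩
      · exact hx0 _ ⟨i, hi, rfl⟩
    have hpos : ∀ M ∈ B.leaves, ∀ u ∈ M.vertexSet, 0 ≤ baryCoord K.vertexSet (K.vert j) u :=
      fun M hM u hu => hKs.mem_convexHull_self_iff.1
        (leaf_carrier_subset hKs B hM (subset_convexHull ℝ _ hu)) _ (mem_range_self j)
    obtain ⟨m, -, hm⟩ := exists_unif_of_mem_leaves hK B _ hx.1
    obtain ⟨m', -, hm'⟩ := exists_unif_of_mem_leaves hK B _ hy.1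
    have hvol : volume (minimalPair T₀ (x.1.face x.2) ∩ minimalPair T₀ (y.1.face y.2)) = 0 := by
      rcases le_total m m' with h | h
      · exact hT₀.volume_minimalPair_inter hB hx.1 hy.1 hne h hm hm' (hasFace_face _ _)
          (hasFace_face _ _) hg0 (hpos _ hx.1) (hpos _ hy.1) hx0 hy0
      · rw [inter_comm]
        exact hT₀.volume_minimalPair_inter hB hy.1 hx.1 hne.symm h hm' hm (hasFace_face _ _)
          (hasFace_face _ _) hg0 (hpos _ hy.1) (hpos _ hx.1) hy0 hx0
    exact ae_disjoint_of_volume hν (measure_mono_null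
      (inter_subset_inter inter_subset_left inter_subset_left) hvol)
  · exact fun x _ => ((measurableSet_minimalPair T₀ _).inter hZ).nullMeasurableSet

/-- Inside `K`, the minimal pair of a boundary face lies in the adjacent leaf. -/
theorem IsGoodMesh.minimalPair_inter_subset_leaf (hT₀ : IsGoodMesh T₀) (hK : InMasterTree T₀ K)
    (B : BisectionTree K) {j : Fin (d + 1)} (hM : M ∈ B.leaves) (hMF : M.HasFace F)
    (hj : LiesInFace K F j) : minimalPair T₀ F ∩ K.carrier ⊆ M.carrier := by
  rintro x ⟨hx, hxK⟩
  have hKs := hK.isSimplex hT₀.conf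
  have hM' := inMasterTree_of_mem_leaves hK B M hM
  have hMs := hM'.isSimplex hT₀.conf
  obtain ⟨u, hu, hFu⟩ := (hasFace_iff hMs).1 hMF
  have hprop := hMs.eq_mul_baryCoord hu (f := baryCoord K.vertexSet (K.vert j))
    fun y hy => hj y (hFu ▸ hy)
  refine hT₀.mem_carrier_of_mem_minimalPair hM' hu hFu hx ?_
  have h1 := hKs.mem_convexHull_self_iff.1 (leaf_carrier_subset hKs B hM
    (subset_convexHull ℝ _ hu)) _ (mem_range_self j)
  have h2 := hKs.mem_convexHull_self_iff.1 hxK _ (mem_range_self j)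
  rcases h1.eq_or_lt with h0 | h0
  · refine absurd (hKs.baryCoord_self (mem_range_self j)) ?_
    rw [hprop, ← h0, zero_mul]
    exact zero_ne_one
  · rw [hprop] at h2
    exact nonneg_of_mul_nonneg_right h2 h0

/-- An inequality suffices, so it is not necessary to know that a face lies in only one boundary
face of `K`. -/
theorem sum_leaves_le {α : TaggedSimplex d → Fin (d + 1) → ℝ≥0∞} :
    ∑ M ∈ T, ∑ i, α M i ≤ ∑ x ∈ interiorFaces K T, α x.1 x.2 +
      ∑ j, ∑ x ∈ boundaryFaces K T j, α x.1 x.2 := by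
  classical
  rw [← Finset.sum_product' T Finset.univ α,
    ← Finset.sum_filter_add_sum_filter_not (T ×ˢ Finset.univ)
      fun x => ∀ j, ¬ LiesInFace K (x.1.face x.2) j]
  refine add_le_add (le_of_eq (Finset.sum_congr (by unfold interiorFaces; congr) fun _ _ => rfl)) ?_
  unfold boundaryFaces
  simp only [Finset.sum_filter (s := T ×ˢ Finset.univ)]
  rw [Finset.sum_comm]
  refine Finset.sum_le_sum fun x _ => ?_
  split_ifs with h
  · exact zero_le
  · push Not at h
    obtain ⟨j, hj⟩ := h
    refine le_trans ?_ (Finset.single_le_sum (fun _ _ => zero_le) (Finset.mem_univ j))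
    rw [if_pos hj]

end Counting

/-! ### Error functionals, the one-dimensional case and the final estimate -/

section ErrorEstimates

open TaggedSimplex

variable {d : ℕ} {T T' T₀ : Finset (TaggedSimplex d)} {K L M N C D : TaggedSimplex d}
  {F F' : Set (EuclideanSpace ℝ (Fin d))} {x z a b v w : EuclideanSpace ℝ (Fin d)}
  {ℓ : ℕ} {ε : ℝ} {u : EuclideanSpace ℝ (Fin d) → ℝ}
  {Du : EuclideanSpace ℝ (Fin d) → EuclideanSpace ℝ (Fin d)}

/-- The measure whose value at `A` is the squared reaction-diffusion norm on `A`. -/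
noncomputable def rdMeasure (ε : ℝ) (w : EuclideanSpace ℝ (Fin d) → ℝ)
    (Dw : EuclideanSpace ℝ (Fin d) → EuclideanSpace ℝ (Fin d)) :
    Measure (EuclideanSpace ℝ (Fin d)) :=
  volume.withDensity (fun x => ‖w x‖ₑ ^ 2) +
    ENNReal.ofReal ε • volume.withDensity fun x => ‖Dw x‖ₑ ^ 2

theorem rdMeasure_apply {A : Set (EuclideanSpace ℝ (Fin d))} (hA : MeasurableSet A)
    (w : EuclideanSpace ℝ (Fin d) → ℝ)
    (Dw : EuclideanSpace ℝ (Fin d) → EuclideanSpace ℝ (Fin d)) :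
    rdMeasure ε w Dw A = rdNormSq ε A w Dw := by
  rw [rdMeasure, rdNormSq, Measure.add_apply, Measure.smul_apply, withDensity_apply _ hA,
    withDensity_apply _ hA, smul_eq_mul]

theorem rdMeasure_absolutelyContinuous (w : EuclideanSpace ℝ (Fin d) → ℝ)
    (Dw : EuclideanSpace ℝ (Fin d) → EuclideanSpace ℝ (Fin d)) :
    rdMeasure ε w Dw ≪ volume := by
  refine Measure.AbsolutelyContinuous.add_left (withDensity_absolutelyContinuous _ _) ?_
  exact (withDensity_absolutelyContinuous _ _).smul_left _

theorem zero_mem_minimalPairSpace : (fun _ => 0) ∈ minimalPairSpace T₀ ℓ F :=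
  ⟨continuousOn_const, fun _ _ _ _ _ => ⟨0, by simp, fun _ _ => by simp⟩⟩

theorem bestErrorSq_le {P : EuclideanSpace ℝ (Fin d) → ℝ} (hP : P ∈ minimalPairSpace T₀ ℓ F) :
    bestErrorSq T₀ ℓ ε u Du F ≤
      rdMeasure ε (fun x => u x - P x) (fun x => Du x - gradient P x) (minimalPair T₀ F) := by
  rw [rdMeasure_apply (measurableSet_minimalPair T₀ F)]
  exact iInf₂_le P hP

theorem bestErrorSq_eq_zero (h : volume (minimalPair T₀ F) = 0) :
    bestErrorSq T₀ ℓ ε u Du F = 0 :=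
  nonpos_iff_eq_zero.1 ((bestErrorSq_le zero_mem_minimalPairSpace).trans
    (rdMeasure_absolutelyContinuous _ _ h).le)

theorem lintegral_enorm_sq_lt_top {E : Type*} [NormedAddCommGroup E]
    {μ : Measure (EuclideanSpace ℝ (Fin d))} {f : EuclideanSpace ℝ (Fin d) → E}
    (hf : MemLp f 2 μ) : ∫⁻ x, ‖f x‖ₑ ^ 2 ∂μ < ⊤ := by
  have := lintegral_rpow_enorm_lt_top_of_eLpNorm_lt_top two_ne_zero ENNReal.ofNat_ne_top
    hf.eLpNorm_lt_top
  simpa using this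

/-- A point of an element outside the domain lies on the boundary of that element, and boundaries of
convex sets are null sets. -/
theorem biUnion_carrier_ae_le_meshDomain (T : Finset (TaggedSimplex d)) :
    (⋃ K ∈ T, K.carrier : Set (EuclideanSpace ℝ (Fin d))) ≤ᵐ[volume] meshDomain T := by
  have hnull : volume (⋃ K ∈ T, frontier K.carrier) = 0 :=
    (measure_biUnion_null_iff T.finite_toSet.countable).2
      fun K _ => (convex_convexHull ℝ _).addHaar_frontier volume
  rw [ae_le_set]
  refine measure_mono_null ?_ hnull
  rintro x ⟨hx, hxn⟩
  obtain ⟨K, hK, hxK⟩ := mem_iUnion₂.1 hx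
  refine mem_iUnion₂.2 ⟨K, hK, subset_closure hxK, fun h => hxn ?_⟩
  exact interior_mono (subset_biUnion_of_mem (u := fun K : TaggedSimplex d => K.carrier) hK) h

theorem IsGoodMesh.minimalPair_subset (hT₀ : IsGoodMesh T₀) (hK : InMasterTree T₀ K)
    (hKF : K.HasFace F) : minimalPair T₀ F ⊆ ⋃ K ∈ T₀, K.carrier := by
  intro x hx
  obtain ⟨n, hn⟩ := hK.exists_unif
  obtain ⟨N, hN, -, hxN⟩ := hx _ (hT₀.uniformMesh_mem n) ⟨K, hn, hKF⟩
  obtain ⟨A, hA, hNA⟩ := hT₀.exists_ancestor (Nat.zero_le n) hN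
  exact mem_iUnion₂.2 ⟨A, hA, hNA hxN⟩

/-- The zero function is an admissible competitor, and the minimal pair lies in the domain up to a
null set. -/
theorem IsGoodMesh.bestErrorSq_lt_top (hT₀ : IsGoodMesh T₀)
    (hu : IsSobolevH1 (meshDomain T₀) u Du) (hK : InMasterTree T₀ K) (hKF : K.HasFace F) :
    bestErrorSq T₀ ℓ ε u Du F < ⊤ := by
  have hle : minimalPair T₀ F ≤ᵐ[volume] meshDomain T₀ :=
    (hT₀.minimalPair_subset hK hKF).eventuallyLE.trans (biUnion_carrier_ae_le_meshDomain T₀)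
  refine (bestErrorSq_le zero_mem_minimalPairSpace).trans_lt ?_
  rw [rdMeasure_apply (measurableSet_minimalPair T₀ F), rdNormSq]
  have hgrad : ∀ x : EuclideanSpace ℝ (Fin d),
      gradient (fun _ : EuclideanSpace ℝ (Fin d) => (0 : ℝ)) x = 0 := fun x => by
    simp [gradient]
  simp only [sub_zero, hgrad]
  refine ENNReal.add_lt_top.2 ⟨?_, ENNReal.mul_lt_top ENNReal.ofReal_lt_top ?_⟩
  · exact (lintegral_mono_set' hle).trans_lt (lintegral_enorm_sq_lt_top hu.memLp)
  · exact (lintegral_mono_set' hle).trans_lt (lintegral_enorm_sq_lt_top hu.memLp_grad)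

/-! ### The one-dimensional case -/

theorem exists_dist_le {T₀ : Finset (TaggedSimplex 1)} : ∃ c : ℝ, ∀ n, ∀ K ∈ uniformMesh T₀ n,
    dist (K.v 0) (K.v 1) ≤ c * (1 / 2) ^ n := by
  refine ⟨∑ K ∈ T₀, dist (K.v 0) (K.v 1), fun n => ?_⟩
  induction n with
  | zero =>
    intro K hK
    simpa using Finset.single_le_sum (s := T₀) (f := fun K : TaggedSimplex 1 => dist (K.v 0) (K.v 1))
      (fun _ _ => dist_nonneg) hK
  | succ n ih =>
    intro C hC
    rw [uniformMesh_succ] at hC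
    obtain ⟨K, hK, hCK⟩ := mem_bisectAll.1 hC
    have h := ih K hK
    have : dist (C.v 0) (C.v 1) = 1 / 2 * dist (K.v 0) (K.v 1) := by
      rcases hCK with rfl | rfl
      · rw [child₁_v _ (Nat.zero_le 1), child₁_v _ le_rfl, if_pos rfl, if_neg one_ne_zero,
          if_pos rfl, mid_eq_v, dist_left_midpoint]
        norm_num
      · rw [child₂_v _ (Nat.zero_le 1), child₂_v _ le_rfl, if_pos rfl, if_neg one_ne_zero,
          if_pos rfl, mid_eq_v, dist_right_midpoint]
        norm_num
    rw [this, pow_succ]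
    linarith

/-- A face is a single point, which never contains a refinement edge, so it remains a face of all
finer uniform meshes. Their elements shrink geometrically, and the minimal pair is at most that
point. -/
theorem IsGoodMesh.volume_minimalPair_eq_zero {T₀ : Finset (TaggedSimplex 1)}
    (hT₀ : IsGoodMesh T₀) {K : TaggedSimplex 1} (hK : InMasterTree T₀ K)
    {F : Set (EuclideanSpace ℝ (Fin 1))} (hKF : K.HasFace F) :
    volume (minimalPair T₀ F) = 0 := by
  obtain ⟨n, hn⟩ := hK.exists_unif
  obtain ⟨c, hc⟩ := exists_dist_le (T₀ := T₀)
  obtain ⟨z, hz⟩ := hKF.nonempty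
  have hface : ∀ k, IsMeshFace (uniformMesh T₀ (n + k)) F := by
    intro k
    induction k with
    | zero => exact ⟨K, hn, hKF⟩
    | succ k ih =>
      obtain ⟨L, hL, hLF⟩ := ih
      have hLs := (hT₀.isGoodMesh_uniformMesh (n + k)).conf.isSimplex hL
      obtain ⟨C, hC, hCF⟩ := exists_child_hasFace hLs hLF (by
        obtain ⟨v, hv, rfl⟩ := (hasFace_iff hLs).1 hLF
        intro h
        rw [refinementEdge_eq_pair] at h
        obtain ⟨m, hm, rfl⟩ := mem_vertexSet_iff.1 hv
        interval_cases m
        · exact (h (Or.inl rfl)).2 rfl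
        · exact (h (Or.inr rfl)).2 rfl)
      refine ⟨C, ?_, hCF⟩
      rw [← add_assoc, uniformMesh_succ]
      exact mem_bisectAll.2 ⟨L, hL, hC⟩
  refine measure_mono_null (t := {z}) (fun x hx => ?_) (measure_singleton z)
  have hdist : ∀ k, dist x z ≤ c * (1 / 2) ^ (n + k) := by
    intro k
    obtain ⟨N, hN, hNF, hxN⟩ := hx _ (hT₀.uniformMesh_mem (n + k)) (hface k)
    refine le_trans ?_ (hc _ N hN)
    have hball : ∀ y ∈ N.vertexSet, N.carrier ⊆ Metric.closedBall y (dist (N.v 0) (N.v 1)) := by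
      intro y hy
      refine convexHull_min (fun y' hy' => ?_) (convex_closedBall _ _)
      obtain ⟨i, hi, rfl⟩ := mem_vertexSet_iff.1 hy
      obtain ⟨i', hi', rfl⟩ := mem_vertexSet_iff.1 hy'
      rw [Metric.mem_closedBall]
      interval_cases i <;> interval_cases i' <;> simp [dist_comm]
    exact hball z (hNF.subset hz) hxN
  have hlim : Filter.Tendsto (fun k : ℕ => c * (1 / 2 : ℝ) ^ (n + k)) Filter.atTop (nhds 0) := by
    have := ((tendsto_pow_atTop_nhds_zero_of_lt_one (r := (1 / 2 : ℝ)) (by norm_num)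
      (by norm_num)).const_mul (c * (1 / 2) ^ n))
    rw [mul_zero] at this
    refine this.congr fun k => ?_
    rw [pow_add]; ring
  have := ge_of_tendsto' hlim hdist
  exact dist_le_zero.1 this

theorem IsGoodMesh.localError_eq_zero (hT₀ : IsGoodMesh T₀) (hd : d = 1)
    (hK : InMasterTree T₀ K) : localError T₀ ℓ ε u Du K = 0 := by
  subst hd
  exact Finset.sum_eq_zero fun i _ =>
    bestErrorSq_eq_zero (hT₀.volume_minimalPair_eq_zero hK (hasFace_face K i))

/-! ### Weak subadditivity -/

/-- Arbitrary competitors `P j` replace the infima on the right, so that one fixed measure per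
boundary face governs all leaves. The level condition on the leaves is needed to go below the
anchors of the boundary faces, which may be children of `K`. -/
theorem IsGoodMesh.sum_localError_le (hT₀ : IsGoodMesh T₀) (hd : 2 ≤ d) {n : ℕ}
    (hK : K ∈ uniformMesh T₀ n) (B : BisectionTree K) (hB : IsConformingMesh B.leaves)
    (hlev : ∀ M ∈ B.leaves, ∃ m, n + 1 ≤ m ∧ M ∈ uniformMesh T₀ m)
    (P : Fin (d + 1) → EuclideanSpace ℝ (Fin d) → ℝ)
    (hP : ∀ j, P j ∈ minimalPairSpace T₀ ℓ (K.face j)) :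
    ∑ M ∈ B.leaves, localError T₀ ℓ ε u Du M ≤ 2 * (d : ℝ≥0∞) * ∑ j,
      rdNormSq ε (minimalPair T₀ (K.face j)) (fun x => u x - P j x)
        (fun x => Du x - gradient (P j) x) := by
  classical
  have hKm := inMasterTree_of_mem_unif hK
  have hKs := hKm.isSimplex hT₀.conf
  set ν : Fin (d + 1) → Measure (EuclideanSpace ℝ (Fin d)) := fun j =>
    rdMeasure ε (fun x => u x - P j x) (fun x => Du x - gradient (P j) x) with hνdef
  have hν : ∀ j, ν j ≪ volume := fun j => rdMeasure_absolutelyContinuous _ _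
  have hνP : ∀ j, rdNormSq ε (minimalPair T₀ (K.face j)) (fun x => u x - P j x)
      (fun x => Du x - gradient (P j) x) = ν j (minimalPair T₀ (K.face j)) := fun j =>
    (rdMeasure_apply (measurableSet_minimalPair T₀ _) _ _).symm
  simp only [hνP]
  have hleafm := inMasterTree_of_mem_leaves hKm B
  have hleafsub := fun M (hM : M ∈ B.leaves) => leaf_carrier_subset hKs B hM
  -- Position 1 is neither 0 nor `d` since `d ≥ 2`, so the opposite face contains the refinement
  -- edge.
  set o : Fin (d + 1) := ⟨1, by omega⟩ with ho
  have hoF : K.refinementEdge ⊆ K.face o := by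
    have hinj := (isSimplex_iff.1 hKs).injective
    rw [face_eq hKs]
    rintro x (rfl | rfl)
    · exact ⟨mem_range_self _, fun e => by simpa [ho] using congrArg Fin.val (hinj e)⟩
    · refine ⟨mem_range_self _, fun e => ?_⟩
      have := congrArg Fin.val (hinj e)
      simp only [Fin.val_last, ho] at this
      omega
  have hKo := hT₀.carrier_subset_minimalPair hKm (hasFace_face K o) hoF
  -- `P o` is a single polynomial on `K`, which contains both leaves at an interior face, so it is
  -- admissible on the pair.
  have hint : ∀ x ∈ interiorFaces K B.leaves, bestErrorSq T₀ ℓ ε u Du (x.1.face x.2) ≤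
      ν o (minimalPair T₀ (x.1.face x.2)) := by
    intro x hx
    obtain ⟨y, hy, hyx, hF⟩ := exists_partner hKs B hB hx
    have hx' := (mem_interiorFaces.1 hx).1
    have hy' := (mem_interiorFaces.1 hy).1
    refine bestErrorSq_le (mem_minimalPairSpace_of_subset ((hP o).1.mono hKo)
      (isPolynomialOn_carrier (hP o) (hT₀.uniformMesh_mem n) hK (hasFace_face K o) hKo) ?_)
    exact (hT₀.minimalPair_subset_union hB hx' hy' hyx.symm (hleafm _ hx') (hleafm _ hy')
      (hasFace_face _ _) (hF ▸ hasFace_face y.1 y.2)).trans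
      (union_subset (hleafsub _ hx') (hleafsub _ hy'))
  have hbd : ∀ j, ∀ x ∈ boundaryFaces K B.leaves j,
      bestErrorSq T₀ ℓ ε u Du (x.1.face x.2) ≤ ν j (minimalPair T₀ (x.1.face x.2)) ∧
      minimalPair T₀ (x.1.face x.2) ⊆ minimalPair T₀ (K.face j) := by
    intro j x hx
    obtain ⟨hx', hj⟩ := mem_boundaryFaces.1 hx
    obtain ⟨m, hm, hxm⟩ := hlev _ hx'
    obtain ⟨m', hm', A, hA, hAF, hAe⟩ := exists_anchor hd hT₀ hK j
    have hsub := hj.subset_convexHull hKs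
      (((subset_convexHull ℝ _).trans (hasFace_face x.1 x.2).convexHull_subset).trans
        (hleafsub _ hx'))
    exact ⟨bestErrorSq_le (hT₀.minimalPairSpace_mono (hm'.trans hm) hA hAF hAe hxm
      (hasFace_face _ _) hsub (hP j)),
      hT₀.minimalPair_mono (hm'.trans hm) hA hAF hAe ⟨_, hxm, hasFace_face _ _⟩ hsub⟩
  -- The part inside `K` lies in the adjacent leaf and is kept for the count over leaves;
  -- disjointness is used only for the part outside `K`. In this way `K` is not charged twice.
  have hbdo : ∑ x ∈ boundaryFaces K B.leaves o, bestErrorSq T₀ ℓ ε u Du (x.1.face x.2) ≤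
      ∑ x ∈ boundaryFaces K B.leaves o, ν o (minimalPair T₀ (x.1.face x.2) ∩ x.1.carrier) +
        ν o (minimalPair T₀ (K.face o) ∩ K.carrierᶜ) := by
    refine le_trans ?_ (add_le_add le_rfl (hT₀.sum_boundaryFaces_le (hν o) hK B hB o
      K.measurableSet_carrier.compl fun x hx => (hbd o x hx).2))
    rw [← Finset.sum_add_distrib]
    refine Finset.sum_le_sum fun x hx => (hbd o x hx).1.trans ?_
    obtain ⟨hx', hj⟩ := mem_boundaryFaces.1 hx
    refine (measure_mono fun y hy => ?_).trans (measure_union_le _ _)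
    by_cases hyK : y ∈ K.carrier
    · exact Or.inl ⟨hy, hT₀.minimalPair_inter_subset_leaf hKm B hx' (hasFace_face _ _) hj
        ⟨hy, hyK⟩⟩
    · exact Or.inr ⟨hy, hyK⟩
  have hbdj : ∀ j, ∑ x ∈ boundaryFaces K B.leaves j, bestErrorSq T₀ ℓ ε u Du (x.1.face x.2) ≤
      ν j (minimalPair T₀ (K.face j)) := by
    intro j
    have := hT₀.sum_boundaryFaces_le (hν j) hK B hB j MeasurableSet.univ
      fun x hx => (hbd j x hx).2
    simp only [inter_univ] at this
    exact (Finset.sum_le_sum fun x hx => (hbd j x hx).1).trans this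
  -- Interior faces and faces in `o` are disjoint families of leaf-face pairs, so the bound `d ν(M)`
  -- per leaf applies to both at once, and the leaves overlap in null sets.
  have hsum : ∑ x ∈ interiorFaces K B.leaves, ν o (minimalPair T₀ (x.1.face x.2) ∩ x.1.carrier) +
      ∑ x ∈ boundaryFaces K B.leaves o, ν o (minimalPair T₀ (x.1.face x.2) ∩ x.1.carrier) ≤
      d * ν o K.carrier := by
    have hdisj : Disjoint (interiorFaces K B.leaves) (boundaryFaces K B.leaves o) :=
      Finset.disjoint_left.2 fun x hx hx' =>
        (mem_interiorFaces.1 hx).2 o (mem_boundaryFaces.1 hx').2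
    rw [← Finset.sum_union hdisj]
    calc _ ≤ ∑ x ∈ B.leaves ×ˢ (Finset.univ : Finset (Fin (d + 1))),
          ν o (minimalPair T₀ (x.1.face x.2) ∩ x.1.carrier) :=
          Finset.sum_le_sum_of_subset (Finset.union_subset (Finset.filter_subset _ _)
            (Finset.filter_subset _ _))
      _ = ∑ M ∈ B.leaves, ∑ i, ν o (minimalPair T₀ (M.face i) ∩ M.carrier) :=
          Finset.sum_product _ _ _
      _ ≤ ∑ M ∈ B.leaves, d * ν o M.carrier :=
          Finset.sum_le_sum fun M hM => hT₀.sum_minimalPair_inter_le (hleafm M hM) (hν o)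
      _ = d * ν o (⋃ M ∈ B.leaves, M.carrier) := by
          rw [← Finset.mul_sum, measure_biUnion_finset₀]
          · intro M hM N hN hMN
            exact ae_disjoint_of_volume (hν o) (hB.volume_inter hM hN hMN)
          · exact fun M _ => M.measurableSet_carrier.nullMeasurableSet
      _ ≤ d * ν o K.carrier := by
          gcongr
          exact iUnion₂_subset hleafsub
  have hsplit : ν o K.carrier + ν o (minimalPair T₀ (K.face o) ∩ K.carrierᶜ) =
      ν o (minimalPair T₀ (K.face o)) := by
    rw [← measure_inter_add_sdiff (minimalPair T₀ (K.face o)) K.measurableSet_carrier,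
      inter_eq_right.2 hKo, sdiff_eq]
  have hd1 : (1 : ℝ≥0∞) ≤ 2 * d := by
    exact_mod_cast (by omega : 1 ≤ 2 * d)
  unfold localError
  refine (sum_leaves_le (K := K)).trans ?_
  rw [← Finset.add_sum_erase _ _ (Finset.mem_univ o),
    ← Finset.add_sum_erase Finset.univ (fun j => ν j (minimalPair T₀ (K.face j)))
      (Finset.mem_univ o), mul_add, ← add_assoc]
  refine add_le_add ?_ ?_
  · calc _ ≤ 2 * ∑ x ∈ interiorFaces K B.leaves,
            ν o (minimalPair T₀ (x.1.face x.2) ∩ x.1.carrier) +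
          (∑ x ∈ boundaryFaces K B.leaves o,
            ν o (minimalPair T₀ (x.1.face x.2) ∩ x.1.carrier) +
          ν o (minimalPair T₀ (K.face o) ∩ K.carrierᶜ)) := by
          refine add_le_add ?_ hbdo
          exact (Finset.sum_le_sum hint).trans (hT₀.sum_interiorFaces_le hKm B hB)
      _ ≤ 2 * (∑ x ∈ interiorFaces K B.leaves,
            ν o (minimalPair T₀ (x.1.face x.2) ∩ x.1.carrier) +
          ∑ x ∈ boundaryFaces K B.leaves o,
            ν o (minimalPair T₀ (x.1.face x.2) ∩ x.1.carrier)) +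
          2 * d * ν o (minimalPair T₀ (K.face o) ∩ K.carrierᶜ) := by
          rw [mul_add, add_assoc]
          refine add_le_add le_rfl (add_le_add ?_ ?_)
          · exact le_mul_of_one_le_left zero_le one_le_two
          · exact le_mul_of_one_le_left zero_le hd1
      _ ≤ 2 * (d * ν o K.carrier) +
          2 * d * ν o (minimalPair T₀ (K.face o) ∩ K.carrierᶜ) := by gcongr
      _ = _ := by rw [← hsplit]; ring
  · rw [Finset.mul_sum]
    exact Finset.sum_le_sum fun j _ => (hbdj j).trans (le_mul_of_one_le_left zero_le hd1)

/-- The infima need not be attained, so competitors optimal up to `δ` are used and `δ` tends to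
zero; finiteness of the errors provides them. -/
theorem IsGoodMesh.sum_localError_le_localError (hT₀ : IsGoodMesh T₀) (hd : 2 ≤ d) {n : ℕ}
    (hK : K ∈ uniformMesh T₀ n) (B : BisectionTree K) (hB : IsConformingMesh B.leaves)
    (hlev : ∀ M ∈ B.leaves, ∃ m, n + 1 ≤ m ∧ M ∈ uniformMesh T₀ m)
    (hfin : ∀ j, bestErrorSq T₀ ℓ ε u Du (K.face j) < ⊤) :
    ∑ M ∈ B.leaves, localError T₀ ℓ ε u Du M ≤
      2 * (d : ℝ≥0∞) * localError T₀ ℓ ε u Du K := by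
  have hnear : ∀ δ : ℝ≥0∞, δ ≠ 0 → ∑ M ∈ B.leaves, localError T₀ ℓ ε u Du M ≤
      2 * (d : ℝ≥0∞) * (localError T₀ ℓ ε u Du K + (d + 1 : ℕ) * δ) := by
    intro δ hδ
    have hex : ∀ j, ∃ P ∈ minimalPairSpace T₀ ℓ (K.face j),
        rdNormSq ε (minimalPair T₀ (K.face j)) (fun x => u x - P x)
          (fun x => Du x - gradient P x) < bestErrorSq T₀ ℓ ε u Du (K.face j) + δ := by
      intro j
      have := ENNReal.lt_add_right (hfin j).ne hδ
      conv_lhs at this => rw [bestErrorSq]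
      obtain ⟨P, hP⟩ := iInf_lt_iff.1 this
      obtain ⟨hP1, hP2⟩ := iInf_lt_iff.1 hP
      exact ⟨P, hP1, hP2⟩
    choose P hP hPle using hex
    refine (hT₀.sum_localError_le hd hK B hB hlev P hP).trans ?_
    gcongr
    refine (Finset.sum_le_sum fun j _ => (hPle j).le).trans ?_
    rw [Finset.sum_add_distrib, localError]
    simp
  have hlim : Filter.Tendsto (fun δ : ℝ≥0∞ => 2 * (d : ℝ≥0∞) *
      (localError T₀ ℓ ε u Du K + (d + 1 : ℕ) * δ)) (nhdsWithin 0 (Ioi 0))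
      (nhds (2 * (d : ℝ≥0∞) * localError T₀ ℓ ε u Du K)) := by
    have h1 : Filter.Tendsto (fun δ : ℝ≥0∞ => 2 * (d : ℝ≥0∞) *
        (localError T₀ ℓ ε u Du K + (d + 1 : ℕ) * δ)) (nhds 0)
        (nhds (2 * (d : ℝ≥0∞) * (localError T₀ ℓ ε u Du K + (d + 1 : ℕ) * 0))) := by
      refine ENNReal.Tendsto.const_mul (Filter.Tendsto.add tendsto_const_nhds
        (ENNReal.Tendsto.const_mul Filter.tendsto_id (Or.inr (ENNReal.natCast_ne_top _))))
        (Or.inr (ENNReal.mul_ne_top ENNReal.ofNat_ne_top (ENNReal.natCast_ne_top _)))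
    rw [mul_zero, add_zero] at h1
    exact h1.mono_left nhdsWithin_le_nhds
  refine ge_of_tendsto hlim ?_
  filter_upwards [self_mem_nhdsWithin] with δ hδ using hnear δ (ne_of_gt hδ)

end ErrorEstimates

theorem proposition6p2 {d : ℕ} (T₀ : Finset (TaggedSimplex d))
    (hconf : IsConformingMesh T₀) (hmatch : MatchingCondition T₀) (hface : FaceConnected T₀)
    (ℓ : ℕ) (ε : ℝ) (hε : 0 < ε)
    (u : EuclideanSpace ℝ (Fin d) → ℝ)
    (Du : EuclideanSpace ℝ (Fin d) → EuclideanSpace ℝ (Fin d))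
    (hu : IsSobolevH1 (meshDomain T₀) u Du)
    (K : TaggedSimplex d) (hK : InMasterTree T₀ K)
    (B : BisectionTree K) (hB : IsConformingMesh B.leaves) :
    localError T₀ ℓ ε u Du K ≠ ⊤ ∧
      ∑ K' ∈ B.leaves, localError T₀ ℓ ε u Du K' ≤ 2 * (d : ℝ≥0∞) * localError T₀ ℓ ε u Du K := by
  have hT₀ : IsGoodMesh T₀ := ⟨hconf, hmatch, hface⟩
  have hfin : ∀ j, bestErrorSq T₀ ℓ ε u Du (K.face j) < ⊤ := fun j =>
    hT₀.bestErrorSq_lt_top hu hK (hasFace_face K j)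
  refine ⟨(ENNReal.sum_lt_top.2 fun j _ => hfin j).ne, ?_⟩
  have hdim := K.dim_pos
  rcases (by omega : d = 1 ∨ 2 ≤ d) with hd | hd
  · rw [Finset.sum_eq_zero fun M hM =>
      hT₀.localError_eq_zero hd (inMasterTree_of_mem_leaves hK B M hM)]
    exact zero_le
  -- A single leaf is trivial because `1 ≤ 2 * d`. It is treated apart since the main estimate needs
  -- all leaves strictly below the level of `K`.
  · cases B with
    | leaf =>
      rw [BisectionTree.leaves, Finset.sum_singleton]
      refine le_mul_of_one_le_left zero_le ?_
      exact_mod_cast (by omega : 1 ≤ 2 * d)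
    | node _ l r =>
      obtain ⟨n, hn⟩ := hK.exists_unif
      refine hT₀.sum_localError_le_localError hd hn _ hB (fun M hM => ?_) hfin
      have hc : ∀ {C : TaggedSimplex d}, C.IsChild K → C ∈ uniformMesh T₀ (n + 1) := fun h => by
        rw [uniformMesh_succ]; exact mem_bisectAll.2 ⟨K, hn, h⟩
      rcases Finset.mem_union.1 hM with h | h
      · exact exists_unif_of_mem_leaves (hc (Or.inl rfl)) l M h
      · exact exists_unif_of_mem_leaves (hc (Or.inr rfl)) r M h
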